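/- Let $\Bbbk$ be a field of characteristic $0$ and $\mathbf{Vect}$ the category of finite dimensional $\Bbbk$-vector spaces. **Conventions.** A *graded 2-vector space* is a sequence $(\mathcal C_n)_{n\ge 0}$ of $\Bbbk$-linear categories, each $\Bbbk$-linearly equivalent to a finite sum of copies of $\mathbf{Vect}$; it is identified with its total category $\mathcal C=\bigoplus_n\mathcal C_n$. Its 1-morphisms are the $\Bbbk$-linear (hence exact) functors of bounded degree, its 2-morphisms the natural transformations; functors $\prod_i\mathcal C_i\to\mathcal D$ of several variables are required to be $\Bbbk$-linear in each variable and of bounded degree. A functor $\prod_i\mathcal C_i\to\mathcal D$ presents $\mathcal D$ as the *Deligne tensor product* $\bigotimes_i\mathcal C_i$ if precomposition with it is an equivalence from 1-morphisms $\mathcal D\to\mathcal E$ to functors $\prod_i\mathcal C_i\to\mathcal E$ of several variables, for every graded 2-vector space $\mathcal E$. A square $\alpha\colon h g\Rightarrow i f$ satisfies the *Beck–Chevalley condition* if its right mate $g f_R\Rightarrow h_R i$ is invertible. A *symmetric self-adjoint Hopf (SSH) category* is a pseudofunctor $\mathcal H$ from finite families of finite sets (a morphism $(S_i)_{i\in I}\to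 T$ is a family of maps $S_i\to T$) to finite families of graded 2-vector spaces (a morphism $(\mathcal C_i)_{i\in I}\to\mathcal D$ is a functor $\prod_i\mathcal C_i\to\mathcal D$ of several variables), compatible with the index sets and sending a family $(S_i)_i$ to $(\mathcal H(S_i))_i$, such that (1) all functors $\mathcal H(\varphi)$ have degree zero; (2) if $(\varphi_i\colon S_i\to T)_i$ presents $T$ as the disjoint union of the $S_i$, then $\mathcal H(\varphi)$ presents $\mathcal H(T)$ as the Deligne tensor product of the $\mathcal H(S_i)$; (3) Cartesian squares of finite sets go to squares satisfying the Beck–Chevalley condition. Write $[n]=\{1,\dots,n\}$, $\mathcal C=\mathcal H([1])$, $\mathcal C^{\otimes n}=\mathcal H([n])$, $m\colon\mathcal C^{\otimes 2}\to\mathcal C$ for $\mathcal H([2]\to[1])$, $\boxtimes\colon\mathcal C\times\mathcal C\to\mathcal C^{\otimes2}$ for $\mathcal H(\{1\},\{2\}\to[2])$, $F\otimes G$ for the value at $(F,G)$ of $\mathcal H$ on $(\mathrm{id},\mathrm{id})\colon([1],[1])\to[1]$, and $\mathbf 1\in\mathcal C$ for the object given by $\mathcal H(()\to[1])$. Let $i_F=F\boxtimes-$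 and $m_F=m\circ i_F$. For $\Phi\in\mathcal C^{\otimes2}$ let $i_\Phi\colon\mathcal C^{\otimes 2}\to\mathcal C^{\otimes4}$ be $\mathcal H(\bar c)(\Phi,-)$, where $\bar c\colon([2],[2])\to[4]$ consists of $1\mapsto1,2\mapsto3$ and $1\mapsto2,2\mapsto4$; let $m^2\colon\mathcal C^{\otimes4}\to\mathcal C^{\otimes2}$ be $\mathcal H$ of $1,2\mapsto1$; $3,4\mapsto2$, and $m^2_\Phi=m^2\circ i_\Phi$. A *PSH algebra* is a connected graded bialgebra $A$ over $\mathbb Z$ with an inner product and a distinguished orthonormal homogeneous $\mathbb Z$-basis, finite in each degree, such that multiplication and comultiplication are adjoint to each other, unit and counit are adjoint to each other, and all four are positive. For $x\in A$ let $m_x(y)=xy$ and $\Delta_x=j_x\circ\Delta$ with $j_x(y\otimes z)=\langle x,y\rangle z$, and let $\varphi\colon A\otimes A\to\operatorname{End}_{\mathbb Z}(A)$, $\varphi(x\otimes y)=m_x\Delta_y$. When $\varphi$ is injective with image a subring, $\operatorname{Heis}(A)$ is $A\otimes A$ with the ring structure induced by $\varphi$, and $\varphi$ is its Fock space representation on $A$.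 **Theorem.** Let $\mathcal H$ be an SSH category with $\mathcal C=\mathcal H([1])$. (a) The functor $m$ has a left adjoint $\Delta^l$ and a right adjoint $\Delta^r$, and $m^2$, $i_F$, $i_\Phi$ have right adjoints $(\Delta^r)^2$, $j^r_F$, $j^r_\Phi$, for all $F\in\mathcal C$, $\Phi\in\mathcal C^{\otimes 2}$. Put $\Delta^r_F=j^r_F\circ\Delta^r$ and $(\Delta^r)^2_\Phi=j^r_\Phi\circ(\Delta^r)^2$; these are right adjoint to $m_F$ and $m^2_\Phi$. The following holds for every choice of these adjoints. (b) The Deligne tensor product $\mathcal C\otimes\mathcal C^{op}$ exists, and for each presentation $\boxtimes\colon\mathcal C\times\mathcal C^{op}\to\mathcal C\otimes\mathcal C^{op}$ of it there is a $\Bbbk$-linear functor $\Psi\colon\mathcal C\otimes\mathcal C^{op}\to\operatorname{End}_{ad}(\mathcal C)$ to the category of bounded $\Bbbk$-linear endofunctors of $\mathcal C$ that admit left and right adjoints, together with isomorphisms $\Psi(F\boxtimes G)\cong m_F\circ\Delta^r_G$ natural in $F$ and $G$. (c) The canonical isomorphisms $m_Fm_G\cong m_{F\otimes G}$ given by the structure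 isomorphisms of $\mathcal H$, and their adjoints $\Delta^r_G\Delta^r_F\cong\Delta^r_{F\otimes G}$, are natural (in the argument and in $F$, $G$). (d) For every $F\in\mathcal C$ the canonical square $m_F\circ m\Rightarrow m\circ m^2_{\Delta^l(F)}$, composed of the unit $F\to m\Delta^l(F)$ and the structure isomorphisms of $\mathcal H$, has an invertible right mate $m\circ(\Delta^r)^2_{\Delta^l(F)}\xrightarrow{\ \sim\ }\Delta^r_F\circ m$ (the Heisenberg relation). (e) The Grothendieck group $K(\mathcal C)$ is a PSH algebra with $[F][G]=[F\otimes G]$, $1=[\mathbf 1]$, $\langle[F],[G]\rangle=\dim_{\Bbbk}\operatorname{Hom}(F,G)$, the distinguished basis consisting of classes of simple objects, homogeneous of the degree of the object, and with $\Delta[F]=[\Delta^r F]=[\Delta^l F]$ under the isomorphism $K(\mathcal C)\otimes K(\mathcal C)\cong K(\mathcal C^{\otimes2})$, $[F]\otimes[G]\mapsto[F\boxtimes G]$. The map $\varphi$ for $A=K(\mathcal C)$ is injective and its image is a subring, so that $\operatorname{Heis}(K(\mathcal C))$ is defined. (f) $\Psi$ descends to the Fock space representation of $\operatorname{Heis}(K(\mathcal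 C))$: there is an isomorphism $\kappa'\colon K(\mathcal C\otimes\mathcal C^{op})\cong K(\mathcal C)\otimes K(\mathcal C)$ with $\kappa'[F\boxtimes G]=[F]\otimes[G]$, and $[\Psi(t)(X)]=\varphi(\kappa'[t])([X])$ for all $t\in\mathcal C\otimes\mathcal C^{op}$ and $X\in\mathcal C$. -/

import Mathlib

open CategoryTheory CategoryTheory.Limits TensorProduct

universe u v

noncomputable section

/-! ### Graded 2-vector spaces -/

/-- A 2-vector space over `k`: a `k`-linear category which is `k`-linearly equivalent to a finite
sum of copies of the category of finite dimensional vector spaces. -/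
def IsTwoVectorSpace (k : Type v) [Field k] (C : Type u) [Category.{v} C] [Preadditive C]
    [Linear k C] : Prop :=
  ∃ (r : ℕ) (e : C ≌ (Fin r → FGModuleCat.{v} k)),
    ∀ i, (e.functor ⋙ Pi.eval _ i).Additive ∧ (e.functor ⋙ Pi.eval _ i).Linear k

/-- A graded 2-vector space `(C_n)_{n ≥ 0}`, presented by its total category `⨁ₙ C_n` (whose
objects are the finitely supported sequences) together with the full subcategories `C_n` of
objects that are homogeneous of degree `n`. -/
structure GrTwoVect (k : Type v) [Field k] where
  carrier : Type u
  [cat : Category.{v} carrier]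
  [preadditive : Preadditive carrier]
  [linear : Linear k carrier]
  [hasFiniteBiproducts : HasFiniteBiproducts carrier]
  deg : ℕ → ObjectProperty carrier
  deg_of_iso : ∀ (n : ℕ) {X Y : carrier}, (X ≅ Y) → deg n X → deg n Y
  isTwoVectorSpace : ∀ n, IsTwoVectorSpace k (deg n).FullSubcategory
  hom_eq_zero : ∀ {m n : ℕ} {X Y : carrier}, deg m X → deg n Y → m ≠ n → ∀ f : X ⟶ Y, f = 0
  exists_decomposition : ∀ X : carrier, ∃ (N : ℕ) (Y : Fin N → carrier),
    (∀ i : Fin N, deg i (Y i)) ∧ Nonempty (X ≅ ⨁ Y)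

attribute [instance] GrTwoVect.cat GrTwoVect.preadditive GrTwoVect.linear
  GrTwoVect.hasFiniteBiproducts

instance GrTwoVect.instCoeSort (k : Type v) [Field k] : CoeSort (GrTwoVect.{u, v} k) (Type u) :=
  ⟨GrTwoVect.carrier⟩

section Functors

variable {k : Type v} [Field k]

/-- The 1-morphisms of graded 2-vector spaces: `k`-linear functors (these are exact, since all
categories involved are semisimple) of bounded degree, i.e. there is an `N` such that an object
of degree `n` goes to an object with components only in degrees `m` with `|m - n| ≤ N`. -/
structure IsTwoVectMor {C D : GrTwoVect.{u, v} k} (F : C ⥤ D) : Prop where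
  additive : F.Additive
  linear : F.Linear k
  bounded : ∃ N : ℕ, ∀ (n m : ℕ) (X : C) (Y : D), C.deg n X → D.deg m Y →
    (m + N < n ∨ n + N < m) → ∀ f : F.obj X ⟶ Y, f = 0

/-- Bounded multi-exact functors `∏ᵢ C_i ⥤ D`: they are `k`-linear in each variable, that is,
multilinear on tuples of morphisms, and of bounded degree. -/
structure IsMultiExact {I : Type} [Finite I] {C : I → GrTwoVect.{u, v} k} {D : GrTwoVect.{u, v} k}
    (F : (∀ i, C i) ⥤ D) : Prop where
  multilinear : ∀ X Y : (∀ i, C i),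
    ∃ L : MultilinearMap k (fun i => X i ⟶ Y i) (F.obj X ⟶ F.obj Y),
      ∀ f : X ⟶ Y, F.map f = L (fun i => f i)
  bounded : ∃ N : ℕ, ∀ (n : I → ℕ) (m : ℕ) (X : ∀ i, C i) (Y : D),
    (∀ i, (C i).deg (n i) (X i)) → D.deg m Y →
    (m + N < ∑ᶠ i, n i ∨ (∑ᶠ i, n i) + N < m) → ∀ f : F.obj X ⟶ Y, f = 0

/-- A functor of several variables is of degree zero if it adds up the degrees. -/
def IsDegreeZero {I : Type} [Finite I] {C : I → GrTwoVect.{u, v} k} {D : GrTwoVect.{u, v} k}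
    (F : (∀ i, C i) ⥤ D) : Prop :=
  ∀ (n : I → ℕ) (X : ∀ i, C i), (∀ i, (C i).deg (n i) (X i)) → D.deg (∑ᶠ i, n i) (F.obj X)

/-- The bounded multi-exact functor `B : ∏ᵢ C_i ⥤ D` presents `D` as the Deligne tensor product
of the `C_i`: for every graded 2-vector space `E`, precomposition with `B` is an equivalence from
the category of 1-morphisms `D ⥤ E` to the category of bounded multi-exact functors
`∏ᵢ C_i ⥤ E`. -/
structure IsDeligneTensor {I : Type} [Finite I] {C : I → GrTwoVect.{u, v} k}
    {D : GrTwoVect.{u, v} k} (B : (∀ i, C i) ⥤ D) : Prop where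
  isMultiExact : IsMultiExact B
  essSurj : ∀ (E : GrTwoVect.{u, v} k) (M : (∀ i, C i) ⥤ E), IsMultiExact M →
    ∃ G : D ⥤ E, IsTwoVectMor G ∧ Nonempty (B ⋙ G ≅ M)
  fullyFaithful : ∀ (E : GrTwoVect.{u, v} k) (G G' : D ⥤ E), IsTwoVectMor G → IsTwoVectMor G' →
    Function.Bijective (fun τ : G ⟶ G' => Functor.whiskerLeft B τ)

/-- The right Beck-Chevalley condition for a square
```
  A --g--> B
  |        |
  f   ⇙α   h
  v        v
  C --i--> D
```
whose vertical functors have right adjoints: the mate `g ∘ f_R ⟶ h_R ∘ i` is invertible. -/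
def BeckChevalley {A B C D : Type*} [Category* A] [Category* B] [Category* C] [Category* D]
    {g : A ⥤ B} {f : A ⥤ C} {h : B ⥤ D} {i : C ⥤ D} (α : g ⋙ h ⟶ f ⋙ i) : Prop :=
  ∀ (fR : C ⥤ A) (hR : D ⥤ B) (adjf : f ⊣ fR) (adjh : h ⊣ hR),
    IsIso (mateEquiv adjf adjh (TwoSquare.mk g f h i α)).natTrans

end Functors

section Opposite

/-- The `k`-linear structure on the opposite of a `k`-linear category. -/
instance linearOpposite (k : Type v) [Field k] (C : Type u) [Category.{v} C] [Preadditive C]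
    [Linear k C] : Linear k Cᵒᵖ where
  homModule X Y :=
    { smul := fun r f => (r • f.unop).op
      one_smul := fun f => Quiver.Hom.unop_inj (one_smul k f.unop)
      mul_smul := fun r s f => Quiver.Hom.unop_inj (mul_smul r s f.unop)
      smul_zero := fun r => Quiver.Hom.unop_inj (smul_zero (A := Y.unop ⟶ X.unop) r)
      smul_add := fun r f g => Quiver.Hom.unop_inj (smul_add r f.unop g.unop)
      add_smul := fun r s f => Quiver.Hom.unop_inj (add_smul r s f.unop)
      zero_smul := fun f => Quiver.Hom.unop_inj (zero_smul k f.unop) }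
  smul_comp _ _ _ r f g := Quiver.Hom.unop_inj (Linear.comp_smul _ _ _ g.unop r f.unop)
  comp_smul _ _ _ f r g := Quiver.Hom.unop_inj (Linear.smul_comp _ _ _ r g.unop f.unop)

/-- Linear duality on a finite sum of copies of the category of finite dimensional spaces. -/
def dualFunctor (k : Type v) [Field k] (r : ℕ) :
    (Fin r → FGModuleCat.{v} k)ᵒᵖ ⥤ (Fin r → FGModuleCat.{v} k) where
  obj X i := FGModuleCat.of k (Module.Dual k (X.unop i))
  map f i := FGModuleCat.ofHom (Module.Dual.transpose (f.unop i).hom.hom)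
  map_id X := by funext i; rfl
  map_comp f g := by funext i; rfl

theorem dualFunctor_isEquivalence (k : Type v) [Field k] (r : ℕ) :
    (dualFunctor k r).IsEquivalence where
  faithful := ⟨fun {X Y f g} h => by
    apply Quiver.Hom.unop_inj
    funext i
    have h1 : Module.Dual.transpose (f.unop i).hom.hom = Module.Dual.transpose (g.unop i).hom.hom :=
      congrArg (fun t : (dualFunctor k r).obj X ⟶ (dualFunctor k r).obj Y => (t i).hom.hom) h
    apply ObjectProperty.hom_ext
    apply ModuleCat.hom_ext
    apply LinearMap.ext
    intro x
    rw [← sub_eq_zero, ← Module.forall_dual_apply_eq_zero_iff k]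
    intro φ
    have h2 := LinearMap.congr_fun (LinearMap.congr_fun h1 φ) x
    rw [map_sub, sub_eq_zero]
    exact h2⟩
  full := ⟨fun {X Y} t => by
    refine ⟨Quiver.Hom.op (fun i => FGModuleCat.ofHom
      ((Module.evalEquiv k (X.unop i)).symm.toLinearMap ∘ₗ
        Module.Dual.transpose (t i).hom.hom ∘ₗ (Module.Dual.eval k (Y.unop i)))), ?_⟩
    funext i
    apply ObjectProperty.hom_ext
    apply ModuleCat.hom_ext
    apply LinearMap.ext
    intro φ
    apply LinearMap.ext
    intro y
    exact LinearMap.congr_fun ((Module.evalEquiv k (X.unop i)).apply_symm_apply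
      (Module.Dual.transpose (t i).hom.hom (Module.Dual.eval k (Y.unop i) y))) φ⟩
  essSurj := ⟨fun V => ⟨Opposite.op (fun i => FGModuleCat.of k (Module.Dual k (V i))),
    ⟨Pi.isoMk (fun i => (Module.evalEquiv k (V i)).symm.toFGModuleCatIso)⟩⟩⟩

theorem IsTwoVectorSpace.op {k : Type v} [Field k] {C : Type u} [Category.{v} C] [Preadditive C]
    [Linear k C] (P : ObjectProperty C) (h : IsTwoVectorSpace k P.FullSubcategory) :
    IsTwoVectorSpace k P.op.FullSubcategory := by
  obtain ⟨r, e, he⟩ := h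
  have := dualFunctor_isEquivalence k r
  refine ⟨r, (P.opEquivalence.trans e.op).trans (dualFunctor k r).asEquivalence, fun i => ?_⟩
  obtain ⟨ha, hl⟩ := he i
  constructor
  · constructor
    intro X Y f g
    have h1 := ha.map_add (f := P.opEquivalence.functor.map f |>.unop)
      (g := P.opEquivalence.functor.map g |>.unop)
    have h2 := congrArg (fun t => FGModuleCat.ofHom (Module.Dual.transpose t.hom.hom)) h1
    refine h2.trans ?_
    apply ObjectProperty.hom_ext
    apply ModuleCat.hom_ext
    exact map_add Module.Dual.transpose _ _
  · constructor
    intro X Y f c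
    have h1 := hl.map_smul (P.opEquivalence.functor.map f |>.unop) c
    have h2 := congrArg (fun t => FGModuleCat.ofHom (Module.Dual.transpose t.hom.hom)) h1
    refine h2.trans ?_
    apply ObjectProperty.hom_ext
    apply ModuleCat.hom_ext
    exact map_smul Module.Dual.transpose _ _

theorem hasFiniteBiproducts_op (C : Type u) [Category.{v} C] [Preadditive C]
    [HasFiniteBiproducts C] : HasFiniteBiproducts Cᵒᵖ :=
  HasFiniteBiproducts.of_hasFiniteProducts

/-- The biproduct bicone in the opposite category. -/
def biconeOp {C : Type u} [Category.{v} C] [Preadditive C] [HasFiniteBiproducts C] {N : ℕ}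
    (Y : Fin N → C) : Bicone (fun i => Opposite.op (Y i)) where
  pt := Opposite.op (⨁ Y)
  π i := (biproduct.ι Y i).op
  ι i := (biproduct.π Y i).op
  ι_π i j := by
    apply Quiver.Hom.unop_inj
    change biproduct.ι Y j ≫ biproduct.π Y i = _
    rw [biproduct.ι_π]
    by_cases h : i = j
    · subst h; simp
    · rw [dif_neg (Ne.symm h), dif_neg h]; rfl

theorem biconeOp_iso {C : Type u} [Category.{v} C] [Preadditive C] [HasFiniteBiproducts C]
    [HasFiniteBiproducts Cᵒᵖ] {N : ℕ} (Y : Fin N → C) :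
    Nonempty (Opposite.op (⨁ Y) ≅ ⨁ (fun i => Opposite.op (Y i))) := by
  refine ⟨biproduct.uniqueUpToIso _ (b := biconeOp Y) (isBilimitOfTotal _ ?_)⟩
  apply Quiver.Hom.unop_inj
  rw [unop_sum]
  exact biproduct.total

/-- The opposite of a graded 2-vector space, with the same degrees. -/
def GrTwoVect.op {k : Type v} [Field k] (C : GrTwoVect.{u, v} k) : GrTwoVect.{u, v} k where
  carrier := C.carrierᵒᵖ
  hasFiniteBiproducts := hasFiniteBiproducts_op C
  deg n := (C.deg n).op
  deg_of_iso n _ _ e h := C.deg_of_iso n e.unop.symm h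
  isTwoVectorSpace n := IsTwoVectorSpace.op _ (C.isTwoVectorSpace n)
  hom_eq_zero hX hY hmn f := Quiver.Hom.unop_inj (C.hom_eq_zero hY hX (Ne.symm hmn) f.unop)
  exists_decomposition X := by
    obtain ⟨N, Y, hY, ⟨e⟩⟩ := C.exists_decomposition X.unop
    have := hasFiniteBiproducts_op C
    obtain ⟨e'⟩ := biconeOp_iso Y
    exact ⟨N, fun i => Opposite.op (Y i), hY, ⟨e.symm.op ≪≫ e'⟩⟩

end Opposite

/-! ### Pseudofunctors on families of finite sets -/

section Multi

/-- Regrouping a doubly indexed family of objects as a family indexed by pairs. -/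
@[simps]
def uncurryPi {J : Type} {I : J → Type} (C : ∀ j, I j → Type u) [∀ j i, Category.{v} (C j i)] :
    (∀ j, ∀ i, C j i) ⥤ (∀ p : (Σ j, I j), C p.1 p.2) where
  obj X p := X p.1 p.2
  map f p := f p.1 p.2

/-- The evident bijection `(Σ _ : Unit, I) ≃ I`. -/
@[simps]
def unitSigma (I : Type) : (Σ _ : Unit, I) ≃ I where
  toFun p := p.2
  invFun i := ⟨(), i⟩

/-- Coherent data on a family of categories `obj S`, indexed by the finite sets `S`, which make it
a pseudofunctor from families of finite sets (a morphism `(S_i)_{i ∈ I} ⟶ T` being a family of maps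
`S_i → T`) to families of categories (a morphism `(C_i)_{i ∈ I} ⟶ D` being a functor
`∏ᵢ C_i ⥤ D`), compatible with the index sets. A morphism of families
`(S_i)_{i ∈ I} ⟶ (T_j)_{j ∈ J}` over a map `I → J` (or a partially defined one) is a `J`-tuple of
morphisms as above, so it is enough to give the functors `map φ`, the invertible 2-cells `unitIso`,
`compIso` for identities and compositions, the invertible 2-cells `reindexIso` for bijections of
index sets, and to require that these are coherent. -/
structure PseudoMultifunctor (obj : ∀ (S : Type) [Finite S], Type u)
    [∀ (S : Type) [Finite S], Category.{v} (obj S)] where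
  /-- the functor assigned to a family of maps `φ i : S i → T` -/
  map : ∀ {I : Type} [Finite I] {S : I → Type} [∀ i, Finite (S i)] {T : Type} [Finite T]
    (_ : ∀ i, S i → T), (∀ i, obj (S i)) ⥤ obj T
  unitIso : ∀ (S : Type) [Finite S],
    map (I := Unit) (S := fun _ => S) (fun _ => (id : S → S)) ≅ Pi.eval (fun _ : Unit => obj S) ()
  compIso : ∀ {J : Type} [Finite J] {I : J → Type} [∀ j, Finite (I j)] {S : ∀ j, I j → Type}
    [∀ j i, Finite (S j i)] {T : J → Type} [∀ j, Finite (T j)] {U : Type} [Finite U]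
    (φ : ∀ j i, S j i → T j) (ψ : ∀ j, T j → U),
    Functor.pi (fun j => map (φ j)) ⋙ map ψ ≅
      uncurryPi (fun j i => obj (S j i)) ⋙
        map (S := fun p : (Σ j, I j) => S p.1 p.2) (fun p => ψ p.1 ∘ φ p.1 p.2)
  reindexIso : ∀ {I I' : Type} [Finite I] [Finite I'] (e : I ≃ I') {S : I' → Type}
    [∀ i, Finite (S i)] {T : Type} [Finite T] (φ : ∀ i, S i → T),
    Pi.comap (fun i => obj (S i)) e ⋙ map (S := fun i => S (e i)) (fun i => φ (e i)) ≅ map φ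
  reindex_refl : ∀ {I : Type} [Finite I] {S : I → Type} [∀ i, Finite (S i)] {T : Type} [Finite T]
    (φ : ∀ i, S i → T) (X : ∀ i, obj (S i)),
    (reindexIso (Equiv.refl I) φ).hom.app X = 𝟙 ((map φ).obj X)
  reindex_trans : ∀ {I I' I'' : Type} [Finite I] [Finite I'] [Finite I''] (e : I ≃ I')
    (e' : I' ≃ I'') {S : I'' → Type} [∀ i, Finite (S i)] {T : Type} [Finite T]
    (φ : ∀ i, S i → T) (X : ∀ i, obj (S i)),
    (reindexIso (e.trans e') φ).hom.app X =
      (reindexIso e (S := fun i => S (e' i)) (fun i => φ (e' i))).hom.app (fun i => X (e' i)) ≫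
        (reindexIso e' φ).hom.app X
  comp_reindex_outer : ∀ {J J' : Type} [Finite J] [Finite J'] (e : J ≃ J') {I : J' → Type}
    [∀ j, Finite (I j)] {S : ∀ j, I j → Type} [∀ j i, Finite (S j i)] {T : J' → Type}
    [∀ j, Finite (T j)] {U : Type} [Finite U] (φ : ∀ j i, S j i → T j) (ψ : ∀ j, T j → U)
    (X : ∀ j i, obj (S j i)),
    (compIso (I := fun j => I (e j)) (S := fun j => S (e j)) (T := fun j => T (e j))
        (fun j => φ (e j)) (fun j => ψ (e j))).hom.app (fun j => X (e j)) ≫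
      (reindexIso (Equiv.sigmaCongrLeft e) (S := fun p : (Σ j, I j) => S p.1 p.2)
        (fun p => ψ p.1 ∘ φ p.1 p.2)).hom.app (fun p => X p.1 p.2) =
    (reindexIso e ψ).hom.app (fun j => (map (φ j)).obj (X j)) ≫ (compIso φ ψ).hom.app X
  comp_reindex_inner : ∀ {J : Type} [Finite J] {I I' : J → Type} [∀ j, Finite (I j)]
    [∀ j, Finite (I' j)] (e : ∀ j, I j ≃ I' j) {S : ∀ j, I' j → Type} [∀ j i, Finite (S j i)]
    {T : J → Type} [∀ j, Finite (T j)] {U : Type} [Finite U]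
    (φ : ∀ j i, S j i → T j) (ψ : ∀ j, T j → U) (X : ∀ j i, obj (S j i)),
    (compIso (S := fun j i => S j (e j i)) (fun j i => φ j (e j i)) ψ).hom.app
        (fun j i => X j (e j i)) ≫
      (reindexIso (Equiv.sigmaCongrRight e) (S := fun p : (Σ j, I' j) => S p.1 p.2)
        (fun p => ψ p.1 ∘ φ p.1 p.2)).hom.app (fun p => X p.1 p.2) =
    (map ψ).map (fun j => (reindexIso (e j) (φ j)).hom.app (X j)) ≫ (compIso φ ψ).hom.app X
  comp_assoc : ∀ {K : Type} [Finite K] {J : K → Type} [∀ k, Finite (J k)] {I : ∀ k, J k → Type}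
    [∀ k j, Finite (I k j)] {S : ∀ k j, I k j → Type} [∀ k j i, Finite (S k j i)]
    {T : ∀ k, J k → Type} [∀ k j, Finite (T k j)] {U : K → Type} [∀ k, Finite (U k)]
    {V : Type} [Finite V] (φ : ∀ k j i, S k j i → T k j) (ψ : ∀ k j, T k j → U k)
    (χ : ∀ k, U k → V) (X : ∀ k j i, obj (S k j i)),
    (compIso ψ χ).hom.app (fun k j => (map (φ k j)).obj (X k j)) ≫
      (compIso (I := fun p : (Σ k, J k) => I p.1 p.2) (S := fun p => S p.1 p.2)
        (T := fun p => T p.1 p.2) (fun p => φ p.1 p.2) (fun p => χ p.1 ∘ ψ p.1 p.2)).hom.app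
          (fun p => X p.1 p.2) ≫
      (reindexIso (Equiv.sigmaAssoc I) (S := fun q => S q.1 q.2.1 q.2.2)
        (fun q => χ q.1 ∘ ψ q.1 q.2.1 ∘ φ q.1 q.2.1 q.2.2)).hom.app
          (fun q => X q.1 q.2.1 q.2.2) =
    (map χ).map (fun k => (compIso (φ k) (ψ k)).hom.app (X k)) ≫
      (compIso (I := fun k => (Σ j, I k j)) (S := fun k p => S k p.1 p.2)
        (fun k p => ψ k p.1 ∘ φ k p.1 p.2) χ).hom.app (fun k p => X k p.1 p.2)
  comp_unit_inner : ∀ {J : Type} [Finite J] {S : J → Type} [∀ j, Finite (S j)] {U : Type}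
    [Finite U] (ψ : ∀ j, S j → U) (X : ∀ j, obj (S j)),
    (compIso (I := fun _ => Unit) (S := fun j _ => S j) (fun _ _ => id) ψ).hom.app
        (fun j _ => X j) ≫
      (reindexIso (Equiv.sigmaPUnit J) ψ).hom.app X =
    (map ψ).map (fun j => (unitIso (S j)).hom.app (fun _ => X j))
  comp_unit_outer : ∀ {I : Type} [Finite I] {S : I → Type} [∀ i, Finite (S i)] {U : Type}
    [Finite U] (φ : ∀ i, S i → U) (X : ∀ i, obj (S i)),
    (compIso (J := Unit) (I := fun _ => I) (S := fun _ => S) (T := fun _ => U)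
        (fun _ => φ) (fun _ => id)).hom.app (fun _ => X) ≫
      (reindexIso (unitSigma I) φ).hom.app X =
    (unitIso U).hom.app (fun _ => (map φ).obj X)

end Multi

section Pairs

/-- The functor `(X, Y) ↦ (X, Y)` to families indexed by `Fin 2`. -/
def pairFunctor (C : Type u) [Category.{v} C] : C × C ⥤ (Fin 2 → C) :=
  Functor.pi' ![CategoryTheory.Prod.fst C C, CategoryTheory.Prod.snd C C]

/-- Naturality of the pairing functor in the category. -/
def pairFunctorNat {C D : Type u} [Category.{v} C] [Category.{v} D] (G : C ⥤ D) :
    G.prod G ⋙ pairFunctor D ≅ pairFunctor C ⋙ Functor.pi (fun _ : Fin 2 => G) :=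
  NatIso.pi' (fun i => match i with
    | 0 => Iso.refl _
    | 1 => Iso.refl _)

/-- The fibres of the monotone surjections `{0, 1, 2} → {0, 1}`. -/
def fibre011zero : Unit ≃ {i : Fin 3 // (![0, 1, 1] : Fin 3 → Fin 2) i = 0} where
  toFun _ := ⟨0, rfl⟩
  invFun _ := ()
  left_inv := by decide
  right_inv := by decide

def fibre011one : Fin 2 ≃ {i : Fin 3 // (![0, 1, 1] : Fin 3 → Fin 2) i = 1} where
  toFun := ![⟨1, rfl⟩, ⟨2, rfl⟩]
  invFun i := ![0, 0, 1] i.1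
  left_inv := by decide
  right_inv := by decide

def fibre001zero : Fin 2 ≃ {i : Fin 3 // (![0, 0, 1] : Fin 3 → Fin 2) i = 0} where
  toFun := ![⟨0, rfl⟩, ⟨1, rfl⟩]
  invFun i := ![0, 1, 0] i.1
  left_inv := by decide
  right_inv := by decide

def fibre001one : Unit ≃ {i : Fin 3 // (![0, 0, 1] : Fin 3 → Fin 2) i = 1} where
  toFun _ := ⟨2, rfl⟩
  invFun _ := ()
  left_inv := by decide
  right_inv := by decide

end Pairs

namespace PseudoMultifunctor

variable {obj : ∀ (S : Type) [Finite S], Type u} [∀ (S : Type) [Finite S], Category.{v} (obj S)]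
  (P : PseudoMultifunctor.{u, v} obj)

/-- The functor assigned to a single map of finite sets. -/
def map₁ {S T : Type} [Finite S] [Finite T] (a : S → T) : obj S ⥤ obj T :=
  Functor.pi' (fun _ : Unit => 𝟭 (obj S)) ⋙ P.map (fun _ => a)

/-- The functor of two variables assigned to a pair of maps of finite sets. -/
def map₂ {S T : Type} [Finite S] [Finite T] (φ : Fin 2 → S → T) : obj S × obj S ⥤ obj T :=
  pairFunctor (obj S) ⋙ P.map φ

/-- `b ∘ a` for single maps `a`, `b`. -/
def comp₁₁ {S T U : Type} [Finite S] [Finite T] [Finite U] (a : S → T) (b : T → U) :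
    P.map₁ a ⋙ P.map₁ b ≅ P.map₁ (b ∘ a) :=
  (Functor.isoWhiskerLeft (Functor.pi' fun _ : Unit => Functor.pi' fun _ : Unit => 𝟭 (obj S))
    (P.compIso (J := Unit) (I := fun _ => Unit) (fun _ _ => a) (fun _ => b))) ≪≫
  (Functor.isoWhiskerLeft (Functor.pi' fun _ : Unit => 𝟭 (obj S))
    (P.reindexIso (unitSigma Unit) (fun _ => b ∘ a)))

/-- A pair of maps with the same target followed by a single map. -/
def comp₂₁ {S T U : Type} [Finite S] [Finite T] [Finite U] (φ : Fin 2 → S → T) (b : T → U) :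
    P.map₂ φ ⋙ P.map₁ b ≅ P.map₂ (fun i => b ∘ φ i) :=
  (Functor.isoWhiskerLeft (Functor.pi' fun _ : Unit => pairFunctor (obj S))
    (P.compIso (J := Unit) (I := fun _ => Fin 2) (fun _ => φ) (fun _ => b))) ≪≫
  (Functor.isoWhiskerLeft (pairFunctor (obj S))
    (P.reindexIso (unitSigma (Fin 2)) (fun i => b ∘ φ i)))

/-- The map `a` in both variables followed by a pair of maps with the same target. -/
def comp₁₂ {S T U : Type} [Finite S] [Finite T] [Finite U] (a : S → T) (ψ : Fin 2 → T → U) :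
    (P.map₁ a).prod (P.map₁ a) ⋙ P.map₂ ψ ≅ P.map₂ (fun i => ψ i ∘ a) :=
  (Functor.isoWhiskerRight (pairFunctorNat (P.map₁ a)) (P.map ψ)) ≪≫
  (Functor.isoWhiskerLeft
    (pairFunctor (obj S) ⋙ Functor.pi fun _ : Fin 2 => Functor.pi' fun _ : Unit => 𝟭 (obj S))
    (P.compIso (J := Fin 2) (I := fun _ => Unit) (fun _ _ => a) ψ)) ≪≫
  (Functor.isoWhiskerLeft (pairFunctor (obj S))
    (P.reindexIso (Equiv.sigmaPUnit (Fin 2)) (fun i => ψ i ∘ a)))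

/-- The invertible 2-cell assigned to a commutative square of finite sets. -/
def squareIso {S T R U : Type} [Finite S] [Finite T] [Finite R] [Finite U]
    (a : S → T) (c : S → R) (b : T → U) (d : R → U) (h : b ∘ a = d ∘ c) :
    P.map₁ a ⋙ P.map₁ b ≅ P.map₁ c ⋙ P.map₁ d :=
  P.comp₁₁ a b ≪≫ eqToIso (congrArg (fun f => P.map₁ f) h) ≪≫ (P.comp₁₁ c d).symm

/-- The tensor product on `obj S`, assigned to the pair of maps `(id, id) : (S, S) ⟶ S`. -/
def tensor (S : Type) [Finite S] : obj S × obj S ⥤ obj S := P.map₂ (fun _ => id)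

/-- The tensor product of a family of objects, assigned to the maps `(id)_i : (S)_i ⟶ S`. -/
def bigTensor {S I : Type} [Finite S] [Finite I] (Z : I → obj S) : obj S :=
  (P.map (I := I) (S := fun _ => S) (fun _ => id)).obj Z

/-- A tensor product over a one-element set. -/
def bigTensorOne {S I : Type} [Finite S] [Finite I] (e : Unit ≃ I) (Z : I → obj S) :
    P.bigTensor Z ≅ Z (e ()) :=
  ((P.reindexIso e (S := fun _ => S) (fun _ => id)).app Z).symm ≪≫
    (P.unitIso S).app (fun i => Z (e i))

/-- A tensor product over a two-element set. -/
def bigTensorTwo {S I : Type} [Finite S] [Finite I] (e : Fin 2 ≃ I) (Z : I → obj S) :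
    P.bigTensor Z ≅ (P.tensor S).obj (Z (e 0), Z (e 1)) :=
  ((P.reindexIso e (S := fun _ => S) (fun _ => id)).app Z).symm ≪≫
    (P.map (I := Fin 2) (S := fun _ => S) (fun _ => id)).mapIso (Pi.isoMk (fun i => match i with
      | 0 => Iso.refl _
      | 1 => Iso.refl _))

/-- A tensor product over `I`, grouped according to the fibres of a map `f : I → J`. -/
def bigTensorFibres {S I J : Type} [Finite S] [Finite I] [Finite J] (f : I → J) (Z : I → obj S) :
    P.bigTensor (fun j : J => P.bigTensor (fun i : {i // f i = j} => Z i.1)) ≅ P.bigTensor Z :=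
  (P.compIso (J := J) (I := fun j => {i // f i = j}) (S := fun _ _ => S) (T := fun _ => S)
      (fun _ _ => id) (fun _ => id)).app (fun _ i => Z i.1) ≪≫
    (P.reindexIso (Equiv.sigmaFiberEquiv f) (S := fun _ => S) (fun _ => id)).app Z

/-- `F ⊗ (G ⊗ X)` as a threefold tensor product. -/
def tensorRight {S : Type} [Finite S] (F G X : obj S) :
    (P.tensor S).obj (F, (P.tensor S).obj (G, X)) ≅ P.bigTensor ![F, G, X] :=
  (P.map (I := Fin 2) (S := fun _ => S) (fun _ => id)).mapIso
    (Pi.isoMk (Y := fun j => P.bigTensor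
      (fun i : {i : Fin 3 // (![0, 1, 1] : Fin 3 → Fin 2) i = j} =>
        (![F, G, X] : Fin 3 → obj S) i.1)) (fun j => match j with
    | 0 => (P.bigTensorOne (I := {i : Fin 3 // (![0, 1, 1] : Fin 3 → Fin 2) i = 0})
        fibre011zero
        (fun i => (![F, G, X] : Fin 3 → obj S) i.1)).symm
    | 1 => (P.bigTensorTwo (I := {i : Fin 3 // (![0, 1, 1] : Fin 3 → Fin 2) i = 1})
        fibre011one
        (fun i => (![F, G, X] : Fin 3 → obj S) i.1)).symm)) ≪≫
  P.bigTensorFibres ![0, 1, 1] ![F, G, X]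

/-- `(F ⊗ G) ⊗ X` as a threefold tensor product. -/
def tensorLeft {S : Type} [Finite S] (F G X : obj S) :
    (P.tensor S).obj ((P.tensor S).obj (F, G), X) ≅ P.bigTensor ![F, G, X] :=
  (P.map (I := Fin 2) (S := fun _ => S) (fun _ => id)).mapIso
    (Pi.isoMk (Y := fun j => P.bigTensor
      (fun i : {i : Fin 3 // (![0, 0, 1] : Fin 3 → Fin 2) i = j} =>
        (![F, G, X] : Fin 3 → obj S) i.1)) (fun j => match j with
    | 0 => (P.bigTensorTwo (I := {i : Fin 3 // (![0, 0, 1] : Fin 3 → Fin 2) i = 0})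
        fibre001zero
        (fun i => (![F, G, X] : Fin 3 → obj S) i.1)).symm
    | 1 => (P.bigTensorOne (I := {i : Fin 3 // (![0, 0, 1] : Fin 3 → Fin 2) i = 1})
        fibre001one
        (fun i => (![F, G, X] : Fin 3 → obj S) i.1)).symm)) ≪≫
  P.bigTensorFibres ![0, 0, 1] ![F, G, X]

end PseudoMultifunctor

/-! ### Symmetric self-adjoint Hopf categories -/

/-- A symmetric self-adjoint Hopf (SSH) structure; the underlying SSH category is `obj (Fin 1)`. -/
structure SSHCategory (k : Type v) [Field k] where
  obj : ∀ (S : Type) [Finite S], GrTwoVect.{u, v} k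
  functor : PseudoMultifunctor.{u, v} (fun S => (obj S).carrier)
  isMultiExact : ∀ {I : Type} [Finite I] {S : I → Type} [∀ i, Finite (S i)] {T : Type} [Finite T]
    (φ : ∀ i, S i → T), IsMultiExact (C := fun i => obj (S i)) (D := obj T) (functor.map φ)
  isDegreeZero : ∀ {I : Type} [Finite I] {S : I → Type} [∀ i, Finite (S i)] {T : Type} [Finite T]
    (φ : ∀ i, S i → T), IsDegreeZero (C := fun i => obj (S i)) (D := obj T) (functor.map φ)
  /-- presentations of a finite set as a disjoint union, i.e. the coCartesian arrows, go to
  Deligne tensor products -/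
  isDeligneTensor : ∀ {I : Type} [Finite I] {S : I → Type} [∀ i, Finite (S i)] {T : Type}
    [Finite T] (φ : ∀ i, S i → T),
    Function.Bijective (fun p : (Σ i, S i) => φ p.1 p.2) →
      IsDeligneTensor (C := fun i => obj (S i)) (D := obj T) (functor.map φ)
  /-- Cartesian squares of finite sets go to squares satisfying the Beck-Chevalley condition -/
  beckChevalley : ∀ {S T R U : Type} [Finite S] [Finite T] [Finite R] [Finite U]
    (a : S → T) (c : S → R) (b : T → U) (d : R → U) (h : b ∘ a = d ∘ c),
    (∀ (t : T) (r : R), b t = d r → ∃! s, a s = t ∧ c s = r) →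
      BeckChevalley (functor.squareIso a c b d h).hom

/-- The property of being an endofunctor of `C` (in graded 2-vector spaces) that admits a left and
a right adjoint. The category `End_ad(C)` is the corresponding full subcategory. -/
def EndAd {k : Type v} [Field k] (C : GrTwoVect.{u, v} k) : ObjectProperty (C ⥤ C) :=
  fun G => IsTwoVectMor G ∧ G.IsLeftAdjoint ∧ G.IsRightAdjoint

/-- The functor `(F, G) ↦ (F, G)` from `C × Cᵒᵖ` to families indexed by `Fin 2`. -/
def pairOp {k : Type v} [Field k] (C : GrTwoVect.{u, v} k) :
    C × Cᵒᵖ ⥤ (∀ i : Fin 2, (![C, C.op] i).carrier) :=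
  Functor.pi' (fun i => match i with
    | 0 => CategoryTheory.Prod.fst C Cᵒᵖ
    | 1 => CategoryTheory.Prod.snd C Cᵒᵖ)

namespace SSHCategory

variable {k : Type v} [Field k] (H : SSHCategory.{u, v} k)

/-- The SSH category `𝒞` itself. -/
abbrev C₁ : GrTwoVect.{u, v} k := H.obj (Fin 1)

/-- `𝒞^{⊗ 2}` -/
abbrev C₂ : GrTwoVect.{u, v} k := H.obj (Fin 2)

/-- `𝒞^{⊗ 4}` -/
abbrev C₄ : GrTwoVect.{u, v} k := H.obj (Fin 4)

/-- The multiplication `m : 𝒞^{⊗ 2} ⥤ 𝒞`. -/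
def m : H.C₂ ⥤ H.C₁ := H.functor.map₁ (fun _ => 0)

/-- The functor `⊠ : 𝒞 × 𝒞 ⥤ 𝒞^{⊗ 2}` assigned to `({1}, {2}) ⟶ {1, 2}`. -/
def box : H.C₁ × H.C₁ ⥤ H.C₂ := H.functor.map₂ (fun (i : Fin 2) (_ : Fin 1) => i)

/-- The tensor product `(F, G) ↦ F ⊗ G` on `𝒞`. -/
def tensor : H.C₁ × H.C₁ ⥤ H.C₁ := H.functor.tensor (Fin 1)

/-- The unit object of `𝒞`, assigned to the morphism from the empty family. -/
def unitObj : H.C₁ :=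
  (H.functor.map (I := Empty) (S := fun _ => Empty) (T := Fin 1) (fun i => i.elim)).obj
    (fun i => i.elim)

/-- `i_F = F ⊠ -`, as a functor of `F`. -/
def i : H.C₁ ⥤ H.C₁ ⥤ H.C₂ := Functor.curry.obj H.box

/-- `m_F = m ∘ i_F`, as a functor of `F`. -/
def mul : H.C₁ ⥤ H.C₁ ⥤ H.C₁ := H.i ⋙ (Functor.whiskeringRight _ _ _).obj H.m

/-- The canonical isomorphism `m (F ⊠ G) ≅ F ⊗ G`. -/
def boxMulIso : H.box ⋙ H.m ≅ H.tensor :=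
  H.functor.comp₂₁ _ _ ≪≫ eqToIso (congrArg (fun φ => H.functor.map₂ φ)
    (funext fun _ => funext fun _ => Subsingleton.elim _ _))

/-- The canonical isomorphism `m_F (m_G X) ≅ m_{F ⊗ G} X`. -/
def mulMulIso (F G X : H.C₁) :
    (H.mul.obj F).obj ((H.mul.obj G).obj X) ≅ (H.mul.obj (H.tensor.obj (F, G))).obj X :=
  H.boxMulIso.app (F, (H.mul.obj G).obj X) ≪≫
    H.tensor.mapIso (Iso.prod (Iso.refl F) (H.boxMulIso.app (G, X))) ≪≫
    H.functor.tensorRight F G X ≪≫ (H.functor.tensorLeft F G X).symm ≪≫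
    (H.boxMulIso.app (H.tensor.obj (F, G), X)).symm

/-- The functor `𝒞^{⊗ 2} × 𝒞^{⊗ 2} ⥤ 𝒞^{⊗ 4}` assigned to the pair of maps
`1 ↦ 1, 2 ↦ 3` and `1 ↦ 2, 2 ↦ 4`. -/
def box₂ : H.C₂ × H.C₂ ⥤ H.C₄ := H.functor.map₂ ![![0, 2], ![1, 3]]

/-- The functor `𝒞^{⊗ 4} ⥤ 𝒞^{⊗ 2}` assigned to `1, 3 ↦ 1` and `2, 4 ↦ 2`. -/
def mBar : H.C₄ ⥤ H.C₂ := H.functor.map₁ ![0, 1, 0, 1]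

/-- The multiplication `m² : 𝒞^{⊗ 4} ⥤ 𝒞^{⊗ 2}` assigned to `1, 2 ↦ 1` and `3, 4 ↦ 2`. -/
def mSq : H.C₄ ⥤ H.C₂ := H.functor.map₁ ![0, 0, 1, 1]

/-- `i_Φ` for `Φ` in `𝒞^{⊗ 2}`. -/
def i₂ : H.C₂ ⥤ H.C₂ ⥤ H.C₄ := Functor.curry.obj H.box₂

/-- `m²_Φ = m² ∘ i_Φ` for `Φ` in `𝒞^{⊗ 2}`. -/
def mul₂ : H.C₂ ⥤ H.C₂ ⥤ H.C₂ := H.i₂ ⋙ (Functor.whiskeringRight _ _ _).obj H.mSq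

/-- The canonical isomorphism `m Φ ⊠ m X ≅ mBar (i_Φ X)`. -/
def boxBarIso : H.m.prod H.m ⋙ H.box ≅ H.box₂ ⋙ H.mBar :=
  H.functor.comp₁₂ _ _ ≪≫ eqToIso (congrArg (fun φ => H.functor.map₂ φ) (by decide)) ≪≫
    (H.functor.comp₂₁ _ _).symm

/-- The canonical isomorphism `m ∘ mBar ≅ m ∘ m²`. -/
def hopfSquareIso : H.mBar ⋙ H.m ≅ H.mSq ⋙ H.m :=
  H.functor.squareIso _ _ _ _ rfl

/-- The canonical isomorphism `m (m Φ ⊠ m X) ≅ m (m²_Φ X)`. -/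
def mulBoxIso (Φ : H.C₂) : H.m ⋙ H.mul.obj (H.m.obj Φ) ≅ H.mul₂.obj Φ ⋙ H.m :=
  NatIso.ofComponents
    (fun X => H.m.mapIso (H.boxBarIso.app (Φ, X)) ≪≫ H.hopfSquareIso.app (H.box₂.obj (Φ, X)))
    (fun {X Y} f => by
      have h1 := H.boxBarIso.hom.naturality (X := (Φ, X)) (Y := (Φ, Y)) (𝟙 Φ, f)
      have h2 := H.hopfSquareIso.hom.naturality (H.box₂.map (X := (Φ, X)) (Y := (Φ, Y)) (𝟙 Φ, f))
      simp only [Functor.comp_map, Functor.prod_map, CategoryTheory.Functor.map_id] at h1 h2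
      have h3 := congrArg H.m.map h1
      simp only [Functor.map_comp] at h3
      change H.m.map (H.box.map (X := (H.m.obj Φ, H.m.obj X)) (Y := (H.m.obj Φ, H.m.obj Y))
          (𝟙 _, H.m.map f)) ≫ H.m.map (H.boxBarIso.hom.app (Φ, Y)) ≫
        H.hopfSquareIso.hom.app (H.box₂.obj (Φ, Y)) =
        (H.m.map (H.boxBarIso.hom.app (Φ, X)) ≫ H.hopfSquareIso.hom.app (H.box₂.obj (Φ, X))) ≫
        H.m.map (H.mSq.map (H.box₂.map (X := (Φ, X)) (Y := (Φ, Y)) (𝟙 Φ, f)))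
      rw [Category.assoc, ← h2, ← Category.assoc, ← Category.assoc]
      exact congrArg (· ≫ _) h3)

/-- A choice of the adjoints that enter the categorical Heisenberg double: the right adjoint `Δʳ`
and the left adjoint `Δˡ` of `m`, the right adjoint `(Δʳ)²` of `m²`, and the right adjoints
`jʳ_F` of `i_F` and `jʳ_Φ` of `i_Φ`. -/
structure Adjoints where
  Δr : H.C₁ ⥤ H.C₂
  adjΔr : H.m ⊣ Δr
  Δl : H.C₁ ⥤ H.C₂
  adjΔl : Δl ⊣ H.m
  ΔrSq : H.C₂ ⥤ H.C₄
  adjΔrSq : H.mSq ⊣ ΔrSq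
  jr : H.C₁ → (H.C₂ ⥤ H.C₁)
  adjjr : ∀ F, H.i.obj F ⊣ jr F
  jr₂ : H.C₂ → (H.C₄ ⥤ H.C₂)
  adjjr₂ : ∀ Φ, H.i₂.obj Φ ⊣ jr₂ Φ

namespace Adjoints

variable {H} (D : H.Adjoints)

/-- `Δʳ_F = jʳ_F ∘ Δʳ` -/
def Δ (F : H.C₁) : H.C₁ ⥤ H.C₁ := D.Δr ⋙ D.jr F

/-- `Δʳ_F` is right adjoint to `m_F`. -/
def adj (F : H.C₁) : H.mul.obj F ⊣ D.Δ F := (D.adjjr F).comp D.adjΔr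

/-- `(Δʳ)²_Φ = jʳ_Φ ∘ (Δʳ)²` -/
def Δ₂ (Φ : H.C₂) : H.C₂ ⥤ H.C₂ := D.ΔrSq ⋙ D.jr₂ Φ

/-- `(Δʳ)²_Φ` is right adjoint to `m²_Φ`. -/
def adj₂ (Φ : H.C₂) : H.mul₂.obj Φ ⊣ D.Δ₂ Φ := (D.adjjr₂ Φ).comp D.adjΔrSq

/-- `Δʳ_F` as a contravariant functor of `F`. -/
def Δfunctor : (H.C₁)ᵒᵖ ⥤ H.C₁ ⥤ H.C₁ where
  obj G := D.Δ G.unop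
  map {G G'} g := conjugateEquiv (D.adj G.unop) (D.adj G'.unop) (H.mul.map g.unop)
  map_id G := by simp
  map_comp f g := by simp

/-- The bifunctor `(F, G) ↦ m_F ∘ Δʳ_G`. -/
def fock : H.C₁ × (H.C₁)ᵒᵖ ⥤ H.C₁ ⥤ H.C₁ where
  obj p := D.Δfunctor.obj p.2 ⋙ H.mul.obj p.1
  map f := D.Δfunctor.map f.2 ◫ H.mul.map f.1
  map_id p := by ext; simp
  map_comp f g := by ext; simp

/-- The canonical square `m_F ∘ m ⟶ m ∘ m²_{Δˡ F}`, built from the unit `F ⟶ m (Δˡ F)` and the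
structure isomorphisms. -/
def heisenbergSquare (F : H.C₁) :
    TwoSquare H.m (H.mul₂.obj (D.Δl.obj F)) (H.mul.obj F) H.m :=
  TwoSquare.mk _ _ _ _ (Functor.whiskerLeft H.m (H.mul.map (D.adjΔl.unit.app F)) ≫
    (H.mulBoxIso (D.Δl.obj F)).hom)

/-- The Heisenberg relation morphism `m ∘ (Δʳ)²_{Δˡ F} ⟶ Δʳ_F ∘ m`: the right mate of the
canonical square. -/
def heisenbergMate (F : H.C₁) : D.Δ₂ (D.Δl.obj F) ⋙ H.m ⟶ H.m ⋙ D.Δ F :=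
  (mateEquiv (D.adj₂ (D.Δl.obj F)) (D.adj F) (D.heisenbergSquare F)).natTrans

end Adjoints

end SSHCategory

/-! ### Grothendieck groups, PSH algebras and the Heisenberg double -/

/-- The Grothendieck group of an additive category: it is generated by the objects, with a
relation `[X] = [Y] + [Z]` whenever `X` is a direct sum of `Y` and `Z`. (In a semisimple category
all short exact sequences split.) -/
def K₀ (C : Type u) [Category.{v} C] [Preadditive C] : Type u :=
  FreeAbelianGroup C ⧸ AddSubgroup.closure
    {x : FreeAbelianGroup C | ∃ (Y Z : C) (b : BinaryBicone Y Z), Nonempty b.IsBilimit ∧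
      x = FreeAbelianGroup.of b.pt - FreeAbelianGroup.of Y - FreeAbelianGroup.of Z}

instance K₀.instAddCommGroup (C : Type u) [Category.{v} C] [Preadditive C] :
    AddCommGroup (K₀ C) :=
  inferInstanceAs (AddCommGroup (FreeAbelianGroup C ⧸ AddSubgroup.closure _))

/-- The class of an object in the Grothendieck group. -/
def K₀.mk {C : Type u} [Category.{v} C] [Preadditive C] (X : C) : K₀ C :=
  QuotientAddGroup.mk (FreeAbelianGroup.of X)

/-- A positive self-adjoint Hopf algebra on an abelian group `A`. As in Zelevinsky's definition,
the grading is the one given by the degrees of the distinguished basis, and no antipode is part of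
the data (a connected graded bialgebra has a unique one). -/
structure PSHAlgebra (A : Type*) [AddCommGroup A] where
  mul : A ⊗[ℤ] A →ₗ[ℤ] A
  one : A
  comul : A →ₗ[ℤ] A ⊗[ℤ] A
  counit : A →ₗ[ℤ] ℤ
  inner : A →ₗ[ℤ] A →ₗ[ℤ] ℤ
  ι : Type
  basis : Module.Basis ι ℤ A
  deg : ι → ℕ
  finite_deg : ∀ n, {b | deg b = n}.Finite
  inner_basis_self : ∀ b, inner (basis b) (basis b) = 1
  inner_basis_of_ne : ∀ b c, b ≠ c → inner (basis b) (basis c) = 0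
  mul_assoc : ∀ x y z, mul (mul (x ⊗ₜ y) ⊗ₜ z) = mul (x ⊗ₜ mul (y ⊗ₜ z))
  one_mul : ∀ x, mul (one ⊗ₜ x) = x
  mul_one : ∀ x, mul (x ⊗ₜ one) = x
  coassoc : ∀ x, TensorProduct.assoc ℤ A A A (comul.rTensor A (comul x)) =
    comul.lTensor A (comul x)
  counit_left : ∀ x, TensorProduct.lid ℤ A (counit.rTensor A (comul x)) = x
  counit_right : ∀ x, TensorProduct.rid ℤ A (counit.lTensor A (comul x)) = x
  /-- the Hopf axiom -/
  comul_mul : ∀ x y, comul (mul (x ⊗ₜ y)) = TensorProduct.map mul mul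
    (TensorProduct.tensorTensorTensorComm ℤ A A A A (comul x ⊗ₜ comul y))
  comul_one : comul one = one ⊗ₜ one
  counit_mul : ∀ x y, counit (mul (x ⊗ₜ y)) = counit x * counit y
  counit_one : counit one = 1
  /-- multiplication and comultiplication are graded -/
  deg_mul : ∀ a b c, basis.repr (mul (basis a ⊗ₜ basis b)) c ≠ 0 → deg c = deg a + deg b
  deg_comul : ∀ a b c, (basis.tensorProduct basis).repr (comul (basis a)) (b, c) ≠ 0 →
    deg a = deg b + deg c
  deg_one : ∀ b, basis.repr one b ≠ 0 → deg b = 0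
  deg_counit : ∀ b, counit (basis b) ≠ 0 → deg b = 0
  /-- multiplication and comultiplication, unit and counit are adjoint -/
  inner_mul : ∀ x y z, inner (mul (x ⊗ₜ y)) z =
    LinearMap.mul' ℤ ℤ (TensorProduct.map (inner x) (inner y) (comul z))
  inner_one : ∀ x, inner one x = counit x
  /-- multiplication and comultiplication are positive -/
  mul_nonneg : ∀ a b c, 0 ≤ basis.repr (mul (basis a ⊗ₜ basis b)) c
  comul_nonneg : ∀ a b c, 0 ≤ (basis.tensorProduct basis).repr (comul (basis a)) (b, c)
  one_nonneg : ∀ b, 0 ≤ basis.repr one b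
  counit_nonneg : ∀ b, 0 ≤ counit (basis b)
  /-- connectedness: the unit and the counit identify the degree zero part with `ℤ` -/
  connected : ∀ b, deg b = 0 → basis b = counit (basis b) • one

namespace PSHAlgebra

variable {A : Type*} [AddCommGroup A] (P : PSHAlgebra A)

/-- `m_x (y) = x y` -/
def mulOp (x : A) : A →ₗ[ℤ] A := P.mul ∘ₗ TensorProduct.mk ℤ A A x

/-- `Δ_x = j_x ∘ Δ` where `j_x (y ⊗ z) = ⟨x, y⟩ z` -/
def comulOp (x : A) : A →ₗ[ℤ] A :=
  (TensorProduct.lid ℤ A).toLinearMap ∘ₗ (P.inner x).rTensor A ∘ₗ P.comul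

/-- The map `x ⊗ y ↦ m_x ∘ Δ_y` from `A ⊗ A` to the endomorphisms of `A`. If it is injective and
its image is a subring, then this gives the ring structure on `Heis(A) = A ⊗ A`, and the map is the
Fock space representation of `Heis(A)`. -/
def fock : A ⊗[ℤ] A →ₗ[ℤ] Module.End ℤ A :=
  TensorProduct.lift (LinearMap.mk₂ ℤ (fun x y => P.mulOp x ∘ₗ P.comulOp y)
    (fun x x' y => LinearMap.ext fun z => by
      change P.mul ((x + x') ⊗ₜ P.comulOp y z) = _
      rw [TensorProduct.add_tmul, map_add]; rfl)
    (fun c x y => LinearMap.ext fun z => by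
      change P.mul ((c • x) ⊗ₜ P.comulOp y z) = c • P.mul (x ⊗ₜ P.comulOp y z)
      rw [← TensorProduct.smul_tmul', map_smul])
    (fun x y y' => LinearMap.ext fun z => by
      change P.mulOp x (TensorProduct.lid ℤ A ((P.inner (y + y')).rTensor A (P.comul z))) = _
      rw [map_add, LinearMap.rTensor_add, LinearMap.add_apply, map_add, map_add]; rfl)
    (fun c x y => LinearMap.ext fun z => by
      change P.mulOp x (TensorProduct.lid ℤ A ((P.inner (c • y)).rTensor A (P.comul z))) = _
      rw [map_smul, LinearMap.rTensor_smul, LinearMap.smul_apply, map_smul, map_smul]; rfl))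

end PSHAlgebra

end

/-! Everything rests on semisimplicity. The total category of a graded 2-vector space has simple
objects S_j with End(S_j) = k, finitely many in each degree, and every object is a finite direct sum
of them (`GrTwoVect.exists_simples`). For a linear functor F, a morphism F X ⟶ Y is therefore the
same as a family of linear maps Hom(S_j, X) → Hom(F S_j, Y) (`SemisimpleFamily.restrict_bijective`).
Hence F has a right adjoint as soon as, for each Y, only finitely many Hom(F S_j, Y) are nonzero.
Bounded degree guarantees this, and passing to opposite categories gives left adjoints. The classes
[S_j] form a basis of the Grothendieck group which is orthonormal for the Hom form; so the form is
symmetric, and Δˡ F and Δʳ F have the same class.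

The universal property of a Deligne tensor product B, tested against vector spaces, yields Hom(B X,
B Y) = ⨂ Hom(X_i, Y_i) by a Yoneda argument (`IsDeligneTensor.lift_bijective`). Consequently the
values of B on tuples of simple objects are the simple objects of the tensor product. Since 𝒞 and
𝒞ᵒᵖ have simple objects with the same index set and degrees, they are equivalent, and 𝒞 ⊗ 𝒞 serves
as 𝒞 ⊗ 𝒞ᵒᵖ. The bifunctor m_F Δʳ_G extends along ⊠ to Ψ by a version of the universal property with
parameters (`IsDeligneTensor.exists_functor`).

For the Heisenberg relation, the canonical square is pasted from two. The first is i_F m ⟹ mBar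
i_{Δˡ F}, where mBar multiplies the factors 1, 3 and the factors 2, 4. The second is the image m
mBar ≅ m m² of the Cartesian square [4] = [2] × [2], whose mate is invertible by Beck–Chevalley. The
mate of the first becomes, under Yoneda, the map Hom(Δˡ F ⊠ Δˡ Y, Z) → Hom(F ⊠ Y, mBar Z). For Z = Φ
⊠ X it is a tensor product of two adjunction bijections for Δˡ ⊣ m, and every Z is a direct sum of
such objects (`boxAdj_bijective`).

On Grothendieck groups, the Hopf axiom is Beck–Chevalley for the same Cartesian square; Δ(1) = 1 ⊗ 1
and ⟨1, 1⟩ = 1 come from Cartesian squares with empty corners; coassociativity and the counit laws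
are adjoint to the laws of multiplication. Connectedness has to be proved. If x ≠ 1 is a basis
element of degree zero, positivity makes Δ_x at least a derivation, so Δ_x(x^{n+1}) ≥ (n+1) x^n, and
m_x Δ_x would be unbounded on the degree zero part, which has finite rank
(`basis_eq_one_of_deg_eq_zero`). Connectedness gives Δ_b(c) = δ_{bc} for basis elements with deg c ≤
deg b, whence φ is injective; the identity Δ_y m_z = ∑ m_{Δ_{y₁} z} Δ_{y₂} makes its image a
subring. Finally Ψ and φ agree on the classes [F ⊠ G] with F, G simple, which form a basis. -/

noncomputable section

/-! ### Grothendieck groups of additive categories -/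

namespace K₀

section

variable {C : Type*} [Category* C] [Preadditive C]

theorem mk_bicone {Y Z : C} (b : BinaryBicone Y Z) (hb : b.IsBilimit) :
    (K₀.mk b.pt : K₀ C) = K₀.mk Y + K₀.mk Z := by
  have h : (FreeAbelianGroup.of b.pt - FreeAbelianGroup.of Y - FreeAbelianGroup.of Z) ∈
      AddSubgroup.closure
    {x : FreeAbelianGroup C | ∃ (Y Z : C) (b : BinaryBicone Y Z), Nonempty b.IsBilimit ∧
      x = FreeAbelianGroup.of b.pt - FreeAbelianGroup.of Y - FreeAbelianGroup.of Z} :=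
    AddSubgroup.subset_closure ⟨Y, Z, b, ⟨hb⟩, rfl⟩
  have h2 := (QuotientAddGroup.eq_zero_iff _).2 h
  have h3 : (K₀.mk b.pt : K₀ C) - K₀.mk Y - K₀.mk Z = 0 := h2
  rw [sub_sub, sub_eq_zero] at h3
  exact h3

/-- A function on objects which is additive on direct sums extends to the Grothendieck group. -/
def lift {A : Type*} [AddCommGroup A] (φ : C → A)
    (h : ∀ (Y Z : C) (b : BinaryBicone Y Z), b.IsBilimit → φ b.pt = φ Y + φ Z) : K₀ C →+ A :=
  QuotientAddGroup.lift _ (FreeAbelianGroup.lift φ) (by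
    rw [AddSubgroup.closure_le]
    rintro x ⟨Y, Z, b, ⟨hb⟩, rfl⟩
    simp [h Y Z b hb])

@[simp]
theorem lift_mk {A : Type*} [AddCommGroup A] (φ : C → A)
    (h : ∀ (Y Z : C) (b : BinaryBicone Y Z), b.IsBilimit → φ b.pt = φ Y + φ Z) (X : C) :
    lift φ h (K₀.mk X) = φ X :=
  FreeAbelianGroup.lift_apply_of φ X

theorem hom_ext {A : Type*} [AddCommGroup A] {f g : K₀ C →+ A}
    (h : ∀ X, f (K₀.mk X) = g (K₀.mk X)) : f = g := by
  apply QuotientAddGroup.addMonoidHom_ext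
  apply FreeAbelianGroup.lift_ext
  intro X
  exact h X

/-- A zero object is a direct sum of two copies of itself, so its class satisfies x = x + x. -/
theorem mk_zero {X : C} (hX : IsZero X) : (K₀.mk X : K₀ C) = 0 := by
  let b : BinaryBicone X X :=
    { pt := X, fst := 0, snd := 0, inl := 0, inr := 0, inl_fst := hX.eq_of_src _ _,
      inl_snd := by simp, inr_fst := by simp, inr_snd := hX.eq_of_src _ _ }
  have h := mk_bicone b (isBinaryBilimitOfTotal _ (hX.eq_of_src _ _))
  have h' : (K₀.mk X : K₀ C) = K₀.mk X + K₀.mk X := h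
  simpa using h'

/-- The defining relations speak only of direct sums; an isomorphism enters by presenting X as a
direct sum of Y and a zero object. -/
theorem mk_iso [HasZeroObject C] {X Y : C} (e : X ≅ Y) : (K₀.mk X : K₀ C) = K₀.mk Y := by
  obtain ⟨Z, hZ⟩ := HasZeroObject.zero (C := C)
  let b : BinaryBicone Y Z :=
    { pt := X, fst := e.hom, snd := 0, inl := e.inv, inr := 0, inl_fst := by simp,
      inl_snd := by simp, inr_fst := by simp, inr_snd := hZ.eq_of_src _ _ }
  have h := mk_bicone b (isBinaryBilimitOfTotal _ (by simp [b]))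
  have h' : (K₀.mk X : K₀ C) = K₀.mk Y + K₀.mk Z := h
  rw [h', mk_zero hZ, add_zero]

end

section Biproducts

variable {C : Type*} [Category* C] [Preadditive C] [HasFiniteBiproducts C]

theorem mk_biproduct : ∀ {n : ℕ} (Y : Fin n → C),
    (K₀.mk (⨁ Y) : K₀ C) = ∑ a, K₀.mk (Y a)
  | 0, Y => by
    rw [Fintype.sum_empty]
    apply mk_zero
    rw [IsZero.iff_id_eq_zero]
    ext a
    exact a.elim0
  | n + 1, Y => by
    rw [Fin.sum_univ_succ, ← mk_biproduct]
    let b : BinaryBicone (Y 0) (⨁ fun a : Fin n => Y a.succ) :=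
      { pt := ⨁ Y
        fst := biproduct.π Y 0
        snd := biproduct.lift fun a => biproduct.π Y a.succ
        inl := biproduct.ι Y 0
        inr := biproduct.desc fun a => biproduct.ι Y a.succ
        inl_fst := by simp
        inl_snd := by
          ext a
          simp [biproduct.ι_π_ne Y (Fin.succ_ne_zero a).symm]
        inr_fst := by
          ext a
          simp [biproduct.ι_π_ne Y (Fin.succ_ne_zero a)]
        inr_snd := by
          ext a b
          by_cases h : a = b
          · subst h; simp
          · simp [biproduct.ι_π_ne _ (Ne.symm h),
              biproduct.ι_π_ne Y ((Fin.succ_injective n).ne (Ne.symm h))] }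
    refine mk_bicone b (isBinaryBilimitOfTotal _ ?_)
    change biproduct.π Y 0 ≫ biproduct.ι Y 0 +
      (biproduct.lift fun a : Fin n => biproduct.π Y a.succ) ≫
        (biproduct.desc fun a : Fin n => biproduct.ι Y a.succ) = 𝟙 (⨁ Y)
    rw [biproduct.lift_desc, ← biproduct.total, Fin.sum_univ_succ]

end Biproducts

section Map

variable {C D : Type*} [Category* C] [Category* D] [Preadditive C] [Preadditive D]

/-- An additive functor sends direct sums to direct sums. -/
def mapBiconeIsBilimit (F : C ⥤ D) [F.Additive] {Y Z : C} (b : BinaryBicone Y Z)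
    (hb : b.IsBilimit) : (F.mapBinaryBicone b).IsBilimit :=
  isBinaryBilimitOfTotal _ (by
    have h := congrArg F.map (IsBilimit.binary_total hb)
    rw [F.map_add, F.map_comp, F.map_comp, F.map_id] at h
    exact h)

/-- The map on Grothendieck groups induced by an additive functor. -/
def map (F : C ⥤ D) [F.Additive] : K₀ C →+ K₀ D :=
  lift (fun X => K₀.mk (F.obj X)) (fun _ _ b hb =>
    mk_bicone (F.mapBinaryBicone b) (mapBiconeIsBilimit F b hb))

@[simp]
theorem map_mk (F : C ⥤ D) [F.Additive] (X : C) : map F (K₀.mk X) = K₀.mk (F.obj X) :=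
  lift_mk _ _ X

end Map

end K₀

/-! ### The Hom form on the Grothendieck group -/

section HomForm

variable (k : Type*) [Field k] {C : Type*} [Category* C] [Preadditive C] [Linear k C]

/-- Morphisms into a direct sum. -/
def homBiconeRight (X : C) {Y Z : C} (b : BinaryBicone Y Z) (hb : b.IsBilimit) :
    (X ⟶ b.pt) ≃ₗ[k] (X ⟶ Y) × (X ⟶ Z) :=
  LinearEquiv.ofLinearMap ((Linear.rightComp k X b.fst).prod (Linear.rightComp k X b.snd))
    ((Linear.rightComp k X b.inl).coprod (Linear.rightComp k X b.inr))
    (by ext f <;> simp)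
    (by
      ext f
      have h := IsBilimit.binary_total hb
      change (f ≫ b.fst) ≫ b.inl + (f ≫ b.snd) ≫ b.inr = f
      rw [Category.assoc, Category.assoc, ← Preadditive.comp_add, h, Category.comp_id])

/-- Morphisms out of a direct sum. -/
def homBiconeLeft (X : C) {Y Z : C} (b : BinaryBicone Y Z) (hb : b.IsBilimit) :
    (b.pt ⟶ X) ≃ₗ[k] (Y ⟶ X) × (Z ⟶ X) :=
  LinearEquiv.ofLinearMap ((Linear.leftComp k X b.inl).prod (Linear.leftComp k X b.inr))
    ((Linear.leftComp k X b.fst).coprod (Linear.leftComp k X b.snd))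
    (by ext f <;> simp)
    (by
      ext f
      have h := IsBilimit.binary_total hb
      change b.fst ≫ b.inl ≫ f + b.snd ≫ b.inr ≫ f = f
      rw [← Category.assoc, ← Category.assoc, ← Preadditive.add_comp, h, Category.id_comp])

variable [∀ X Y : C, Module.Finite k (X ⟶ Y)]

theorem finrank_hom_bicone_right (X : C) {Y Z : C} (b : BinaryBicone Y Z) (hb : b.IsBilimit) :
    Module.finrank k (X ⟶ b.pt) = Module.finrank k (X ⟶ Y) + Module.finrank k (X ⟶ Z) := by
  rw [(homBiconeRight k X b hb).finrank_eq, Module.finrank_prod]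

theorem finrank_hom_bicone_left (X : C) {Y Z : C} (b : BinaryBicone Y Z) (hb : b.IsBilimit) :
    Module.finrank k (b.pt ⟶ X) = Module.finrank k (Y ⟶ X) + Module.finrank k (Z ⟶ X) := by
  rw [(homBiconeLeft k X b hb).finrank_eq, Module.finrank_prod]

/-- The functional `[Y] ↦ dim Hom(X, Y)` on the Grothendieck group. -/
def homFormObj (X : C) : K₀ C →ₗ[ℤ] ℤ :=
  (K₀.lift (fun Y => (Module.finrank k (X ⟶ Y) : ℤ)) (fun Y Z b hb => by
    rw [finrank_hom_bicone_right k X b hb, Nat.cast_add])).toIntLinearMap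

@[simp]
theorem homFormObj_mk (X Y : C) : homFormObj k X (K₀.mk Y) = (Module.finrank k (X ⟶ Y) : ℤ) :=
  K₀.lift_mk (fun Y => (Module.finrank k (X ⟶ Y) : ℤ)) (fun Y Z b hb => by
    rw [finrank_hom_bicone_right k X b hb, Nat.cast_add]) Y

theorem K₀.linearMap_ext {A : Type*} [AddCommGroup A] {f g : K₀ C →ₗ[ℤ] A}
    (h : ∀ X, f (K₀.mk X) = g (K₀.mk X)) : f = g :=
  LinearMap.ext fun x => DFunLike.congr_fun
    (K₀.hom_ext (f := f.toAddMonoidHom) (g := g.toAddMonoidHom) h) x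

theorem homFormObj_bicone {Y Z : C} (b : BinaryBicone Y Z) (hb : b.IsBilimit) :
    homFormObj k b.pt = homFormObj k Y + homFormObj k Z :=
  K₀.linearMap_ext fun W => by simp [finrank_hom_bicone_left k W b hb]

/-- The bilinear form `⟨[X], [Y]⟩ = dim Hom(X, Y)` on the Grothendieck group. -/
def homForm : K₀ C →ₗ[ℤ] K₀ C →ₗ[ℤ] ℤ :=
  (K₀.lift (homFormObj k) (fun _ _ b hb => homFormObj_bicone k b hb)).toIntLinearMap

@[simp]
theorem homForm_mk (X Y : C) :
    homForm k (K₀.mk X) (K₀.mk Y) = (Module.finrank k (X ⟶ Y) : ℤ) :=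
  (LinearMap.congr_fun (K₀.lift_mk (homFormObj k) (fun _ _ b hb => homFormObj_bicone k b hb) X)
    (K₀.mk Y)).trans (homFormObj_mk k X Y)

end HomForm

/-! ### Semisimple categories -/

section Semisimple

variable (k : Type*) [Field k] {C : Type*} [Category* C] [Preadditive C] [Linear k C]
  [HasFiniteBiproducts C] {J : Type}

/-- A complete family of pairwise non-isomorphic simple objects with endomorphism ring `k`, in a
category in which every object is a finite direct sum of these. -/
structure SemisimpleFamily (S : J → C) : Prop where
  finrank_self : ∀ j, Module.finrank k (S j ⟶ S j) = 1
  hom_eq_zero : ∀ i j, i ≠ j → ∀ f : S i ⟶ S j, f = 0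
  exists_iso : ∀ X : C, ∃ (n : ℕ) (f : Fin n → J), Nonempty (X ≅ ⨁ fun a => S (f a))

/-- An object is a direct sum as soon as there are suitable inclusions and projections. -/
theorem exists_iso_of_total {S : J → C} {X : C} {α : Type} [Fintype α] [DecidableEq α] (f : α → J)
    (ι : ∀ a, S (f a) ⟶ X) (π : ∀ a, X ⟶ S (f a)) (h₁ : ∀ a, ι a ≫ π a = 𝟙 _)
    (h₂ : ∀ a b, a ≠ b → ι a ≫ π b = 0) (h₃ : ∑ a, π a ≫ ι a = 𝟙 X) :
    ∃ (n : ℕ) (f : Fin n → J), Nonempty (X ≅ ⨁ fun a => S (f a)) := by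
  let e := (Fintype.equivFin α).symm
  refine ⟨Fintype.card α, fun a => f (e a), ⟨?_⟩⟩
  refine
    { hom := biproduct.lift fun a => π (e a)
      inv := biproduct.desc fun a => ι (e a)
      hom_inv_id := ?_
      inv_hom_id := ?_ }
  · rw [biproduct.lift_desc, ← h₃]
    exact Equiv.sum_comp e (fun a => π a ≫ ι a)
  · ext a b
    by_cases h : a = b
    · subst h; simp [h₁]
    · simp [h₂ _ _ (e.injective.ne (Ne.symm h)), biproduct.ι_π_ne _ (Ne.symm h)]

namespace SemisimpleFamily

variable {k} {S : J → C}

theorem id_ne_zero (hS : SemisimpleFamily k S) (j : J) : 𝟙 (S j) ≠ 0 := by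
  intro h
  have h1 := hS.finrank_self j
  have : Subsingleton (S j ⟶ S j) := ⟨fun f g => by
    rw [← Category.id_comp f, ← Category.id_comp g, h, zero_comp, zero_comp]⟩
  rw [Module.finrank_zero_of_subsingleton] at h1
  exact zero_ne_one h1

theorem exists_smul_id (hS : SemisimpleFamily k S) {j : J} (f : S j ⟶ S j) :
    ∃ c : k, c • 𝟙 (S j) = f :=
  (finrank_eq_one_iff_of_nonzero' _ (hS.id_ne_zero j)).1 (hS.finrank_self j) f

theorem exists_total (hS : SemisimpleFamily k S) (X : C) :
    ∃ (n : ℕ) (f : Fin n → J) (ι : ∀ a, S (f a) ⟶ X)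
    (π : ∀ a, X ⟶ S (f a)), (∀ a, ι a ≫ π a = 𝟙 _) ∧ (∀ a b, a ≠ b → ι a ≫ π b = 0) ∧
      ∑ a, π a ≫ ι a = 𝟙 X := by
  obtain ⟨n, f, ⟨e⟩⟩ := hS.exists_iso X
  refine ⟨n, f, fun a => biproduct.ι (fun a => S (f a)) a ≫ e.inv,
    fun a => e.hom ≫ biproduct.π (fun a => S (f a)) a, fun a => by simp,
    fun a b h => by simp [biproduct.ι_π_ne _ h], ?_⟩
  have h : ∑ a, e.hom ≫ (biproduct.π (fun a => S (f a)) a ≫ biproduct.ι (fun a => S (f a)) a) ≫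
      e.inv = 𝟙 X := by
    rw [← Preadditive.comp_sum, ← Preadditive.sum_comp, biproduct.total]
    simp
  simpa using h

theorem finite_simple_hom (hS : SemisimpleFamily k S) (i j : J) : Module.Finite k (S i ⟶ S j) := by
  by_cases h : i = j
  · subst h
    exact Module.finite_of_finrank_eq_succ (hS.finrank_self i)
  · have : Subsingleton (S i ⟶ S j) := ⟨fun f g => by
      rw [hS.hom_eq_zero i j h f, hS.hom_eq_zero i j h g]⟩
    infer_instance

/-- A morphism is determined by its finite matrix of components between simple summands, and each
entry lies in a space of dimension at most one. -/
theorem finite_hom (hS : SemisimpleFamily k S) (X Y : C) : Module.Finite k (X ⟶ Y) := by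
  obtain ⟨n, f, ι, π, -, -, h⟩ := hS.exists_total X
  obtain ⟨n', f', ι', π', -, -, h'⟩ := hS.exists_total Y
  have := hS.finite_simple_hom
  let L : (X ⟶ Y) →ₗ[k] (∀ a b, S (f a) ⟶ S (f' b)) :=
    LinearMap.pi fun a => LinearMap.pi fun b =>
      Linear.rightComp k _ (π' b) ∘ₗ Linear.leftComp k _ (ι a)
  refine Module.Finite.of_injective L ?_
  rw [← LinearMap.ker_eq_bot, LinearMap.ker_eq_bot']
  intro g hg
  have hg' : ∀ a b, (ι a ≫ g) ≫ π' b = 0 := fun a b => congrFun (congrFun hg a) b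
  rw [← Category.comp_id g, ← h', ← Category.id_comp g, ← h]
  simp only [Preadditive.sum_comp, Preadditive.comp_sum]
  refine Finset.sum_eq_zero fun a _ => Finset.sum_eq_zero fun b _ => ?_
  have := hg' b a
  simp only [Category.assoc] at this ⊢
  rw [reassoc_of% this]
  simp

theorem finrank_hom (hS : SemisimpleFamily k S) (i j : J) [DecidableEq J] :
    Module.finrank k (S i ⟶ S j) = if i = j then 1 else 0 := by
  split_ifs with h
  · subst h
    exact hS.finrank_self i
  · have : Subsingleton (S i ⟶ S j) := ⟨fun f g => by
      rw [hS.hom_eq_zero i j h f, hS.hom_eq_zero i j h g]⟩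
    exact Module.finrank_zero_of_subsingleton

theorem span_eq_top (hS : SemisimpleFamily k S) :
    Submodule.span ℤ (Set.range fun j => (K₀.mk (S j) : K₀ C)) = ⊤ := by
  rw [eq_top_iff]
  rintro x -
  have : ∀ X : C, (K₀.mk X : K₀ C) ∈ Submodule.span ℤ (Set.range fun j => (K₀.mk (S j) : K₀ C)) := by
    intro X
    obtain ⟨n, f, ⟨e⟩⟩ := hS.exists_iso X
    rw [K₀.mk_iso e, K₀.mk_biproduct]
    exact Submodule.sum_mem _ fun a _ => Submodule.subset_span ⟨f a, rfl⟩
  induction x using QuotientAddGroup.induction_on with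
  | H x =>
    induction x using FreeAbelianGroup.induction_on with
    | zero => exact Submodule.zero_mem _
    | of X => exact this X
    | neg X _ => exact Submodule.neg_mem _ (this X)
    | add x y hx hy => exact Submodule.add_mem _ hx hy

/-- A nonzero monomorphism into S j is nonzero on some simple summand of its source. That summand
must be S j itself, where the composite is a nonzero scalar; rescaling its inverse splits the
monomorphism. -/
theorem simple (hS : SemisimpleFamily k S) (j : J) : Simple (S j) where
  mono_isIso_iff_nonzero {Y} g _ := by
    constructor
    · intro _ hg
      apply hS.id_ne_zero j
      rw [← IsIso.inv_hom_id g]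
      exact (congrArg (inv g ≫ ·) hg).trans comp_zero
    · intro hg
      obtain ⟨n, f, ι, π, -, -, h⟩ := hS.exists_total Y
      have : ∃ a, ι a ≫ g ≠ 0 := by
        by_contra! hc
        apply hg
        rw [← Category.id_comp g, ← h, Preadditive.sum_comp]
        exact Finset.sum_eq_zero fun a _ => by rw [Category.assoc, hc a, comp_zero]
      obtain ⟨a, ha⟩ := this
      have hj : f a = j := by
        by_contra hc
        exact ha (hS.hom_eq_zero _ _ hc _)
      let g' : S j ⟶ S j := eqToHom (by rw [hj]) ≫ ι a ≫ g
      have hg' : g' ≠ 0 := by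
        intro h0
        apply ha
        have := congrArg (eqToHom (by rw [hj] : S (f a) = S j) ≫ ·) h0
        simpa [g'] using this
      obtain ⟨c, hc⟩ := hS.exists_smul_id g'
      have hc0 : c ≠ 0 := by
        rintro rfl
        exact hg' (by rw [← hc, zero_smul])
      have : IsSplitEpi g := ⟨⟨⟨c⁻¹ • (eqToHom (by rw [hj]) ≫ ι a), by
        rw [Linear.smul_comp, Category.assoc]
        change c⁻¹ • g' = _
        rw [← hc, smul_smul, inv_mul_cancel₀ hc0, one_smul]⟩⟩⟩
      exact isIso_of_mono_of_isSplitEpi g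

variable [∀ X Y : C, Module.Finite k (X ⟶ Y)]

theorem homForm_self (hS : SemisimpleFamily k S) (j : J) :
    homForm k (K₀.mk (S j)) (K₀.mk (S j)) = 1 := by
  rw [homForm_mk, hS.finrank_self, Nat.cast_one]

theorem homForm_ne (hS : SemisimpleFamily k S) {i j : J} (h : i ≠ j) :
    homForm k (K₀.mk (S i)) (K₀.mk (S j)) = 0 := by
  classical
  rw [homForm_mk, hS.finrank_hom, if_neg h, Nat.cast_zero]

/-- The classes of the simple objects form a basis of the Grothendieck group. -/
def basis (hS : SemisimpleFamily k S) : Module.Basis J ℤ (K₀ C) :=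
  Module.Basis.mk (v := fun j => (K₀.mk (S j) : K₀ C)) (by
    rw [linearIndependent_iff']
    intro s g hg i hi
    have h := congrArg (homForm k (K₀.mk (S i))) hg
    rw [map_sum, map_zero, Finset.sum_eq_single i] at h
    · rwa [map_smul, hS.homForm_self, smul_eq_mul, mul_one] at h
    · intro j _ hj
      rw [map_smul, hS.homForm_ne hj.symm, smul_zero]
    · exact fun h => absurd hi h) hS.span_eq_top.ge

@[simp]
theorem basis_apply (hS : SemisimpleFamily k S) (j : J) :
    hS.basis j = K₀.mk (S j) := Module.Basis.mk_apply _ _ j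

theorem basis_repr (hS : SemisimpleFamily k S) (x : K₀ C) (j : J) :
    hS.basis.repr x j = homForm k (K₀.mk (S j)) x := by
  have h : Finsupp.lapply j ∘ₗ hS.basis.repr.toLinearMap = homForm k (K₀.mk (S j)) := by
    apply hS.basis.ext
    intro i
    change hS.basis.repr (hS.basis i) j = _
    rw [Module.Basis.repr_self, basis_apply]
    by_cases hij : i = j
    · subst hij
      rw [Finsupp.single_eq_same, hS.homForm_self]
    · rw [Finsupp.single_eq_of_ne (Ne.symm hij), hS.homForm_ne (Ne.symm hij)]
  exact LinearMap.congr_fun h x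

/-- Symmetry can be checked on the orthonormal basis of simple classes. It allows left and right
adjoints to be exchanged in the Grothendieck group, and the vanishing of Hom(X, Y) to be read off
from Hom(Y, X). -/
theorem homForm_comm (hS : SemisimpleFamily k S) (x y : K₀ C) : homForm k x y = homForm k y x := by
  have h : homForm k = (homForm k : K₀ C →ₗ[ℤ] K₀ C →ₗ[ℤ] ℤ).flip := by
    apply hS.basis.ext
    intro i
    apply hS.basis.ext
    intro j
    rw [LinearMap.flip_apply, basis_apply, basis_apply]
    by_cases hij : i = j
    · rw [hij]
    · rw [hS.homForm_ne hij, hS.homForm_ne (Ne.symm hij)]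
  exact LinearMap.congr_fun (LinearMap.congr_fun h x) y

theorem finrank_comm (hS : SemisimpleFamily k S) (X Y : C) :
    Module.finrank k (X ⟶ Y) = Module.finrank k (Y ⟶ X) := by
  have h := hS.homForm_comm (K₀.mk X) (K₀.mk Y)
  rw [homForm_mk, homForm_mk] at h
  exact_mod_cast h

/-- The coordinates of a class are its pairings with the simple objects. Identities between classes
are thereby reduced to equalities of dimensions, without constructing isomorphisms. -/
theorem ext_right (hS : SemisimpleFamily k S) {x y : K₀ C}
    (h : ∀ X : C, homForm k (K₀.mk X) x = homForm k (K₀.mk X) y) :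
    x = y := by
  apply hS.basis.ext_elem
  intro j
  rw [basis_repr, basis_repr, h]

theorem hom_eq_zero_comm (hS : SemisimpleFamily k S) {X Y : C} (h : ∀ f : X ⟶ Y, f = 0)
    (g : Y ⟶ X) : g = 0 := by
  have : Subsingleton (X ⟶ Y) := ⟨fun f g => by rw [h f, h g]⟩
  have h1 := hS.finrank_comm X Y
  rw [Module.finrank_zero_of_subsingleton] at h1
  have := Module.finrank_zero_iff.1 h1.symm
  exact Subsingleton.elim _ _

/-- There are objects with arbitrary finite multiplicities. -/
theorem exists_multiplicities (hS : SemisimpleFamily k S) (m : J →₀ ℕ) :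
    ∃ X : C, ∀ j, Module.finrank k (S j ⟶ X) = m j := by
  classical
  induction m using Finsupp.induction_linear with
  | zero =>
    obtain ⟨Z, hZ⟩ := HasZeroObject.zero (C := C)
    refine ⟨Z, fun j => ?_⟩
    have : Subsingleton (S j ⟶ Z) := ⟨fun f g => hZ.eq_of_tgt _ _⟩
    exact Module.finrank_zero_of_subsingleton
  | add m m' h h' =>
    obtain ⟨X, hX⟩ := h
    obtain ⟨X', hX'⟩ := h'
    have : HasBinaryBiproducts C := hasBinaryBiproducts_of_finite_biproducts C
    refine ⟨(BinaryBiproduct.bicone X X').pt, fun j => ?_⟩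
    rw [finrank_hom_bicone_right k (S j) _ (BinaryBiproduct.isBilimit X X'), hX, hX',
      Finsupp.add_apply]
  | single i n =>
    refine ⟨⨁ fun _ : Fin n => S i, fun j => ?_⟩
    have h : homForm k (K₀.mk (S j)) (K₀.mk (⨁ fun _ : Fin n => S i)) =
        (Finsupp.single i n j : ℕ) := by
      rw [K₀.mk_biproduct, map_sum]
      simp only [homForm_mk, hS.finrank_hom, Finsupp.single_apply]
      by_cases hij : i = j
      · simp [hij]
      · simp [hij, Ne.symm hij]
    rw [homForm_mk] at h
    exact_mod_cast h

end SemisimpleFamily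

end Semisimple

/-! ### Existence of adjoints -/

namespace SemisimpleFamily

section

variable {k : Type*} [Field k] {C : Type*} [Category* C] [Preadditive C] [Linear k C]
  {J : Type} {S : J → C}
  {D : Type*} [Category* D] [Preadditive D] [Linear k D] (F : C ⥤ D) [F.Additive] [F.Linear k]

/-- A morphism `F X ⟶ Y` acts on the multiplicity spaces `Hom(S j, X)`. -/
def restrict (S : J → C) {X : C} {Y : D} (g : F.obj X ⟶ Y) (j : J) :
    (S j ⟶ X) →ₗ[k] (F.obj (S j) ⟶ Y) :=
  Linear.rightComp k _ g ∘ₗ F.mapLinearMap k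

@[simp]
theorem restrict_apply {X : C} {Y : D} (g : F.obj X ⟶ Y) (j : J) (h : S j ⟶ X) :
    restrict (k := k) F S g j h = F.map h ≫ g := rfl

variable [HasFiniteBiproducts C]

/-- Decomposing X into simple objects decomposes F X, so a morphism out of F X is determined by its
composites with F of the inclusions. Conversely any family of linear maps may be prescribed, since
by Schur's lemma there are no further compatibilities between the multiplicity spaces. -/
theorem restrict_bijective (hS : SemisimpleFamily k S) (X : C) (Y : D) :
    Function.Bijective (restrict (k := k) F S (X := X) (Y := Y)) := by
  obtain ⟨n, f, ι, π, -, -, h⟩ := hS.exists_total X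
  constructor
  · intro g g' hg
    have h1 := congrArg F.map h
    rw [F.map_sum, F.map_id] at h1
    rw [← Category.id_comp g, ← Category.id_comp g', ← h1, Preadditive.sum_comp,
      Preadditive.sum_comp]
    refine Finset.sum_congr rfl fun a _ => ?_
    have := LinearMap.congr_fun (congrFun hg (f a)) (ι a)
    simp only [restrict_apply] at this
    rw [F.map_comp, Category.assoc, Category.assoc, this]
  · intro γ
    refine ⟨∑ a, F.map (π a) ≫ γ (f a) (ι a), ?_⟩
    funext j
    apply LinearMap.ext
    intro t
    rw [restrict_apply, Preadditive.comp_sum]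
    have ht : t = ∑ a, (t ≫ π a) ≫ ι a := by
      simp only [Category.assoc]
      rw [← Preadditive.comp_sum, h, Category.comp_id]
    -- The component `t ≫ π a` is a morphism between simple objects, hence zero or a scalar.
    -- Linearity of `γ` settles both cases; the generalisations make it possible to identify the two
    -- indices.
    have key : ∀ a, F.map t ≫ F.map (π a) ≫ γ (f a) (ι a) = γ j ((t ≫ π a) ≫ ι a) := by
      intro a
      rw [← Category.assoc, ← F.map_comp]
      generalize t ≫ π a = s
      generalize ι a = r
      generalize f a = i at s r
      by_cases hij : j = i
      · subst hij
        obtain ⟨c, rfl⟩ := hS.exists_smul_id s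
        simp
      · rw [hS.hom_eq_zero j i hij s]
        simp
    conv_rhs => rw [ht]
    rw [map_sum]
    exact Finset.sum_congr rfl fun a _ => key a

variable [∀ X Y : C, Module.Finite k (X ⟶ Y)] [∀ X Y : D, Module.Finite k (X ⟶ Y)]

/-- The value of the right adjoint at Y is an object in which S_j has multiplicity dim Hom(F S_j,
Y); the finiteness hypothesis makes these multiplicities finitely supported. Arbitrary isomorphisms
Hom(S_j, R Y) ≅ Hom(F S_j, Y) assemble, by `restrict_bijective`, into a universal morphism F (R Y) ⟶
Y. -/
theorem isLeftAdjoint (hS : SemisimpleFamily k S)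
    (hF : ∀ Y : D, {j | ∃ f : F.obj (S j) ⟶ Y, f ≠ 0}.Finite) :
    F.IsLeftAdjoint := by
  have hR : ∀ Y : D, ∃ (R : C), ∀ j, Nonempty ((S j ⟶ R) ≃ₗ[k] (F.obj (S j) ⟶ Y)) := by
    intro Y
    let m : J →₀ ℕ := Finsupp.ofSupportFinite (fun j => Module.finrank k (F.obj (S j) ⟶ Y)) (by
      refine (hF Y).subset fun j hj => ?_
      by_contra hc
      apply hj
      have : Subsingleton (F.obj (S j) ⟶ Y) := ⟨fun f g => by
        have hc' : ∀ f : F.obj (S j) ⟶ Y, f = 0 := by simpa using hc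
        rw [hc' f, hc' g]⟩
      exact Module.finrank_zero_of_subsingleton)
    obtain ⟨R, hR⟩ := hS.exists_multiplicities m
    exact ⟨R, fun j => ⟨LinearEquiv.ofFinrankEq _ _ (hR j)⟩⟩
  choose R hR using hR
  have e := fun Y j => (hR Y j).some
  choose u hu using fun Y => (hS.restrict_bijective F (R Y) Y).2 (fun j => (e Y j).toLinearMap)
  -- Morphisms X ⟶ R Y and F X ⟶ Y are both families of linear maps out of the spaces Hom(S j, X).
  -- In this description composition with `u Y` is composition with the isomorphisms `e Y j`.
  have hb : ∀ X Y, Function.Bijective (fun f : X ⟶ R Y => F.map f ≫ u Y) := by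
    intro X Y
    rw [← Function.Bijective.of_comp_iff' (hS.restrict_bijective F X Y)]
    have : restrict (k := k) F S (X := X) (Y := Y) ∘ (fun f : X ⟶ R Y => F.map f ≫ u Y) =
        (fun γ j => (e Y j).toLinearMap ∘ₗ γ j) ∘ restrict (k := k) (𝟭 C) S (X := X) (Y := R Y) := by
      funext f j
      apply LinearMap.ext
      intro t
      have := LinearMap.congr_fun (congrFun (hu Y) j) (t ≫ f)
      rw [restrict_apply, F.map_comp, Category.assoc] at this
      exact this
    rw [this]
    refine Function.Bijective.comp ?_ (hS.restrict_bijective (𝟭 C) X (R Y))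
    refine Function.bijective_iff_has_inverse.2 ⟨fun γ j => (e Y j).symm.toLinearMap ∘ₗ γ j, ?_, ?_⟩
    · intro γ; funext j; ext; simp
    · intro γ; funext j; ext; simp
  exact (Adjunction.adjunctionOfEquivRight (fun X Y => (Equiv.ofBijective _ (hb X Y)).symm)
    (fun X' X Y f g => by
      apply (hb _ _).1
      have h1 := (Equiv.ofBijective _ (hb X' Y)).apply_symm_apply (F.map f ≫ g)
      have h2 := (Equiv.ofBijective _ (hb X Y)).apply_symm_apply g
      simp only [Equiv.ofBijective_apply] at h1 h2
      simp only [F.map_comp, Category.assoc]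
      rw [h1, h2])).isLeftAdjoint

end

end SemisimpleFamily

/-! ### Simple objects of graded 2-vector spaces -/

section TwoVectorSpace

variable {k : Type v} [Field k]

/-- The simple objects of a finite sum of copies of the category of vector spaces. -/
def simpleVect (k : Type v) [Field k] {r : ℕ} (i : Fin r) : Fin r → FGModuleCat.{v} k :=
  fun i' => FGModuleCat.of k (PLift (i' = i) → k)

/-- The morphism from a simple object given by a vector. -/
def simpleVectIncl {r : ℕ} (V : Fin r → FGModuleCat.{v} k) (i : Fin r) (x : V i) :
    simpleVect k i ⟶ V :=
  fun i' => FGModuleCat.ofHom (LinearMap.lsum k (fun _ => k) k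
    (fun h : PLift (i' = i) => LinearMap.toSpanSingleton k (V i') (h.down ▸ x)))

/-- The morphism to a simple object given by a linear form. -/
def simpleVectProj {r : ℕ} (V : Fin r → FGModuleCat.{v} k) (i : Fin r) (ℓ : V i →ₗ[k] k) :
    V ⟶ simpleVect k i :=
  fun i' => FGModuleCat.ofHom (LinearMap.pi
    (fun h : PLift (i' = i) => (show V i' →ₗ[k] k from h.down ▸ ℓ)))

theorem simpleVectProj_incl {r : ℕ} (V : Fin r → FGModuleCat.{v} k) (i : Fin r)
    (ℓ : V i →ₗ[k] k) (x : V i) (y : V i) :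
    ((simpleVectProj V i ℓ ≫ simpleVectIncl V i x) i).hom.hom y = ℓ y • x := by
  change LinearMap.lsum k (fun _ => k) k (fun h : PLift (i = i) =>
    LinearMap.toSpanSingleton k (V i) (h.down ▸ x)) (fun _ => ℓ y) = _
  simp

theorem simpleVectProj_incl_ne {r : ℕ} (V : Fin r → FGModuleCat.{v} k) {i i' : Fin r}
    (h : i' ≠ i) (ℓ : V i →ₗ[k] k) (x : V i) (y : V i') :
    ((simpleVectProj V i ℓ ≫ simpleVectIncl V i x) i').hom.hom y = 0 := by
  have : IsEmpty (PLift (i' = i)) := ⟨fun t => h t.down⟩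
  change LinearMap.lsum k (fun _ => k) k (fun h : PLift (i' = i) =>
    LinearMap.toSpanSingleton k (V i') (h.down ▸ x)) _ = _
  simp only [LinearMap.lsum_apply, Finset.univ_eq_empty, Finset.sum_empty]
  rfl

theorem simpleVectIncl_proj {r : ℕ} (V : Fin r → FGModuleCat.{v} k) (i : Fin r)
    (ℓ : V i →ₗ[k] k) (x : V i) (φ : PLift (i = i) → k) (t : PLift (i = i)) :
    (show PLift (i = i) → k from ((simpleVectIncl V i x ≫ simpleVectProj V i ℓ) i).hom.hom φ) t =
      φ t * ℓ x := by
  change ℓ (LinearMap.lsum k (fun _ => k) k (fun h : PLift (i = i) =>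
    LinearMap.toSpanSingleton k (V i) (h.down ▸ x)) φ) = _
  have : t = ⟨rfl⟩ := Subsingleton.elim _ _
  subst this
  simp only [LinearMap.lsum_apply, LinearMap.sum_apply, LinearMap.comp_apply, LinearMap.proj_apply,
    LinearMap.toSpanSingleton_apply]
  rw [Fintype.sum_subsingleton _ (⟨rfl⟩ : PLift (i = i)), map_smul, smul_eq_mul]

theorem simpleVect_hom_eq_zero {r : ℕ} {i j : Fin r} (h : i ≠ j)
    (φ : simpleVect k i ⟶ simpleVect k j) (i' : Fin r) : φ i' = 0 := by
  apply FGModuleCat.hom_ext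
  by_cases hi : i' = i
  · have : IsEmpty (PLift (i' = j)) := ⟨fun t => h (hi.symm.trans t.down)⟩
    exact LinearMap.ext fun x => funext fun t => this.elim t
  · have : IsEmpty (PLift (i' = i)) := ⟨fun t => hi t.down⟩
    refine LinearMap.ext fun x => ?_
    have hx : x = 0 := funext fun t => this.elim t
    rw [hx, map_zero, map_zero]

theorem simpleVect_endomorphism {r : ℕ} {i : Fin r} (φ : simpleVect k i ⟶ simpleVect k i) :
    ∃ c : k, ∀ i', φ i' = c • 𝟙 (simpleVect k i i') := by
  refine ⟨(show PLift (i = i) → k from (φ i).hom.hom (fun _ => (1 : k))) ⟨rfl⟩, fun i' => ?_⟩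
  apply FGModuleCat.hom_ext
  by_cases hi : i' = i
  · subst hi
    refine LinearMap.ext fun x => funext fun t => ?_
    have ht : t = ⟨rfl⟩ := Subsingleton.elim _ _
    subst ht
    have h : ∀ (L : (PLift (i' = i') → k) →ₗ[k] (PLift (i' = i') → k)) (y : PLift (i' = i') → k),
        L y ⟨rfl⟩ = L (fun _ => (1 : k)) ⟨rfl⟩ * y ⟨rfl⟩ := by
      intro L y
      have hy : y = y ⟨rfl⟩ • (fun _ => (1 : k)) := by
        funext t
        have ht : t = ⟨rfl⟩ := Subsingleton.elim _ _
        subst ht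
        exact (mul_one _).symm
      conv_lhs => rw [hy]
      rw [map_smul, Pi.smul_apply, smul_eq_mul, mul_comm]
    exact h _ x
  · have : IsEmpty (PLift (i' = i)) := ⟨fun t => hi t.down⟩
    refine LinearMap.ext fun x => ?_
    have hx : x = 0 := funext fun t => this.elim t
    rw [hx, map_zero, map_zero]

variable {C : Type u} [Category.{v} C] [Preadditive C] [Linear k C]

/-- Everything is transported along the equivalence with a sum of copies of the category of vector
spaces. The decomposition is recorded by inclusions and projections, because no biproducts are
assumed in the category itself. -/
theorem IsTwoVectorSpace.exists_simples (h : IsTwoVectorSpace k C) :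
    ∃ (r : ℕ) (S : Fin r → C), (∀ i, Module.finrank k (S i ⟶ S i) = 1) ∧
      (∀ i j, i ≠ j → ∀ f : S i ⟶ S j, f = 0) ∧
      ∀ X : C, ∃ (α : Type) (_ : Fintype α) (_ : DecidableEq α) (f : α → Fin r)
        (ι : ∀ a, S (f a) ⟶ X) (π : ∀ a, X ⟶ S (f a)), (∀ a, ι a ≫ π a = 𝟙 _) ∧
          (∀ a b, a ≠ b → ι a ≫ π b = 0) ∧ ∑ a, π a ≫ ι a = 𝟙 X := by
  obtain ⟨r, e, he⟩ := h
  have hadd := fun i => (he i).1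
  have hlin := fun i => (he i).2
  let c : ∀ i, e.functor.obj (e.inverse.obj (simpleVect k i)) ≅ simpleVect k i :=
    fun i => e.counitIso.app _
  have hext : ∀ {X Y : C} {f g : X ⟶ Y}, (∀ i, e.functor.map f i = e.functor.map g i) → f = g :=
    fun h => e.functor.map_injective (funext h)
  have hzero : ∀ {X Y : C} (i), e.functor.map (0 : X ⟶ Y) i = 0 :=
    fun {X Y} i => (e.functor ⋙ Pi.eval _ i).map_zero X Y
  have h0 : ∀ i j, i ≠ j → ∀ f : e.inverse.obj (simpleVect k i) ⟶ e.inverse.obj (simpleVect k j),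
      f = 0 := by
    intro i j hij f
    apply hext
    intro i'
    have h1 := simpleVect_hom_eq_zero hij ((c i).inv ≫ e.functor.map f ≫ (c j).hom) i'
    have h2 : e.functor.map f = (c i).hom ≫ ((c i).inv ≫ e.functor.map f ≫ (c j).hom) ≫ (c j).inv := by
      simp
    rw [h2, hzero, Pi.comp_apply, Pi.comp_apply, h1, zero_comp, comp_zero]
  refine ⟨r, fun i => e.inverse.obj (simpleVect k i), fun i => ?_, h0, fun X => ?_⟩
  · rw [finrank_eq_one_iff_of_nonzero' (𝟙 (e.inverse.obj (simpleVect k i)))]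
    · intro f
      obtain ⟨x, hx⟩ := simpleVect_endomorphism ((c i).inv ≫ e.functor.map f ≫ (c i).hom)
      refine ⟨x, hext fun i' => ?_⟩
      have h2 : e.functor.map f = (c i).hom ≫ ((c i).inv ≫ e.functor.map f ≫ (c i).hom) ≫ (c i).inv := by
        simp
      have h3 : e.functor.map (x • 𝟙 (e.inverse.obj (simpleVect k i))) i' =
          x • (e.functor.map (𝟙 (e.inverse.obj (simpleVect k i))) i') :=
        (hlin i').map_smul _ _
      have h4 := congrFun (c i).hom_inv_id i'
      rw [h2, h3, Pi.comp_apply, Pi.comp_apply, hx, Linear.smul_comp, Linear.comp_smul,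
        Category.id_comp, e.functor.map_id]
      rw [Pi.comp_apply] at h4
      rw [h4]
    · intro h
      have h1 := congrArg (fun f => e.functor.map f i) h
      simp only [hzero, e.functor.map_id] at h1
      have h2 := congrFun (c i).inv_hom_id i
      have h3 : (c i).inv i ≫ 𝟙 (e.functor.obj (e.inverse.obj (simpleVect k i))) i ≫ (c i).hom i =
          𝟙 (simpleVect k i) i := by
        rw [← h2]; simp
      rw [h1, zero_comp, comp_zero] at h3
      have h4 := congrArg (fun t => (show PLift (i = i) → k from t.hom.hom (fun _ => (1 : k))) ⟨rfl⟩) h3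
      exact zero_ne_one h4
  -- Bases of the component spaces decompose X: a basis vector gives an inclusion of a simple
  -- object, and its coordinate form gives the projection.
  · let V := e.functor.obj X
    let b := fun i => Module.finBasis k (V i)
    let ι : ∀ p : (Σ i, Fin (Module.finrank k (V i))), e.inverse.obj (simpleVect k p.1) ⟶ X :=
      fun p => e.functor.preimage ((c p.1).hom ≫ simpleVectIncl V p.1 (b p.1 p.2))
    let π : ∀ p : (Σ i, Fin (Module.finrank k (V i))), X ⟶ e.inverse.obj (simpleVect k p.1) :=
      fun p => e.functor.preimage (simpleVectProj V p.1 ((b p.1).coord p.2) ≫ (c p.1).inv)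
    have hι : ∀ p, e.functor.map (ι p) = (c p.1).hom ≫ simpleVectIncl V p.1 (b p.1 p.2) :=
      fun p => e.functor.map_preimage _
    have hπ : ∀ p, e.functor.map (π p) = simpleVectProj V p.1 ((b p.1).coord p.2) ≫ (c p.1).inv :=
      fun p => e.functor.map_preimage _
    have hb : ∀ i (a a' : Fin (Module.finrank k (V i))),
        simpleVectIncl V i (b i a) ≫ simpleVectProj V i ((b i).coord a') =
          fun i' => (if a = a' then (1 : k) else 0) • 𝟙 (simpleVect k i i') := by
      intro i a a'
      obtain ⟨x, hx⟩ := simpleVect_endomorphism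
        (simpleVectIncl V i (b i a) ≫ simpleVectProj V i ((b i).coord a'))
      have h1 := simpleVectIncl_proj V i ((b i).coord a') (b i a) (fun _ => (1 : k)) ⟨rfl⟩
      rw [hx] at h1
      have h2 : x * 1 = 1 * (b i).coord a' (b i a) := h1
      funext i'
      rw [hx, ← mul_one x, h2, one_mul, Module.Basis.coord_apply, Module.Basis.repr_self,
        Finsupp.single_apply]
    refine ⟨_, inferInstance, inferInstance, Sigma.fst, ι, π, ?_, ?_, ?_⟩
    · intro p
      apply e.functor.map_injective
      rw [e.functor.map_comp, hι, hπ, e.functor.map_id, Category.assoc, ← Category.assoc _ _ (c p.1).inv,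
        hb]
      simp only [if_true, one_smul]
      exact (congrArg ((c p.1).hom ≫ ·) (Category.id_comp (c p.1).inv)).trans (c p.1).hom_inv_id
    · rintro ⟨i, a⟩ ⟨j, a'⟩ h
      by_cases hij : i = j
      · subst hij
        have haa : a ≠ a' := fun hc => h (by rw [hc])
        apply hext
        intro i'
        rw [e.functor.map_comp, hι, hπ, hzero, Category.assoc, ← Category.assoc _ _ (c i).inv, hb]
        simp only [if_neg haa, zero_smul, Pi.comp_apply, zero_comp, comp_zero]
      · exact h0 i j hij _
    · apply hext
      intro i'
      have h1 : e.functor.map (∑ a, π a ≫ ι a) i' = ∑ a, e.functor.map (π a ≫ ι a) i' :=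
        (e.functor ⋙ Pi.eval _ i').map_sum _ _
      have h2 : ∀ p, e.functor.map (π p ≫ ι p) =
          simpleVectProj V p.1 ((b p.1).coord p.2) ≫ simpleVectIncl V p.1 (b p.1 p.2) := by
        intro p
        rw [e.functor.map_comp, hι, hπ]
        simp
      rw [h1, e.functor.map_id]
      simp only [h2]
      apply FGModuleCat.hom_ext
      refine LinearMap.ext fun y => ?_
      have h3 : ∀ (s : Finset (Σ i, Fin (Module.finrank k (V i)))) (g : (Σ i, Fin (Module.finrank k (V i))) → (V i' ⟶ V i')),
          (∑ a ∈ s, g a).hom.hom y = ∑ a ∈ s, (g a).hom.hom y := by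
        intro s g
        induction s using Finset.cons_induction with
        | empty => rfl
        | cons a s ha ih => rw [Finset.sum_cons, Finset.sum_cons, ← ih]; rfl
      refine (h3 _ _).trans ?_
      rw [Fintype.sum_sigma, Finset.sum_eq_single i']
      · simp only [simpleVectProj_incl]
        exact (b i').sum_repr y
      · intro i _ hi
        exact Finset.sum_eq_zero fun a _ => simpleVectProj_incl_ne V hi.symm _ _ y
      · exact fun h => absurd (Finset.mem_univ _) h

end TwoVectorSpace

/-- Morphisms in the opposite category. -/
def opLinearEquiv (k : Type v) [Field k] {C : Type u} [Category.{v} C] [Preadditive C] [Linear k C]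
    (X Y : C) : (Opposite.op X ⟶ Opposite.op Y) ≃ₗ[k] (Y ⟶ X) where
  toFun f := f.unop
  invFun f := f.op
  map_add' _ _ := rfl
  map_smul' _ _ := rfl

theorem SemisimpleFamily.op {k : Type v} [Field k] {C : Type u} [Category.{v} C] [Preadditive C]
    [Linear k C] [HasFiniteBiproducts C] [HasFiniteBiproducts Cᵒᵖ] {J : Type} {S : J → C}
    (hS : SemisimpleFamily k S) : SemisimpleFamily k (fun j => Opposite.op (S j)) where
  finrank_self j := by rw [(opLinearEquiv k (S j) (S j)).finrank_eq, hS.finrank_self]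
  hom_eq_zero i j hij f := Quiver.Hom.unop_inj (hS.hom_eq_zero j i hij.symm f.unop)
  exists_iso X := by
    obtain ⟨n, f, ι, π, h₁, h₂, h₃⟩ := hS.exists_total X.unop
    refine exists_iso_of_total (S := fun j => Opposite.op (S j)) f (fun a => (π a).op)
      (fun a => (ι a).op) (fun a => Quiver.Hom.unop_inj (h₁ a))
      (fun a b hab => Quiver.Hom.unop_inj (h₂ b a hab.symm)) ?_
    apply Quiver.Hom.unop_inj
    rw [unop_sum]
    exact h₃

namespace GrTwoVect

variable {k : Type v} [Field k] (C : GrTwoVect.{u, v} k)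

/-- The simple objects of all the graded pieces are collected. There are no morphisms between
different degrees, and the decomposition of an object into homogeneous pieces is refined in each
piece. -/
theorem exists_simples : ∃ (J : Type) (S : J → C) (d : J → ℕ), SemisimpleFamily k S ∧
    (∀ j, C.deg (d j) (S j)) ∧ ∀ n, {j | d j = n}.Finite := by
  choose r S h₁ h₂ h₃ using fun n => (C.isTwoVectorSpace n).exists_simples
  have hlin : ∀ (n : ℕ) (X Y : (C.deg n).FullSubcategory),
      Nonempty ((X ⟶ Y) ≃ₗ[k] (X.obj ⟶ Y.obj)) := fun n X Y =>
    ⟨{ toFun := fun f => f.hom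
       invFun := fun f => ⟨f⟩
       map_add' := fun _ _ => rfl
       map_smul' := fun _ _ => rfl
       left_inv := fun _ => rfl
       right_inv := fun _ => rfl }⟩
  refine ⟨Σ n, Fin (r n), fun p => (S p.1 p.2).obj, Sigma.fst, ⟨?_, ?_, ?_⟩,
    fun p => (S p.1 p.2).property, fun n => ?_⟩
  · rintro ⟨n, i⟩
    rw [← h₁ n i]
    exact ((hlin n (S n i) (S n i)).some.finrank_eq).symm
  · rintro ⟨n, i⟩ ⟨n', i'⟩ hne f
    by_cases hn : n = n'
    · subst hn
      have hi : i ≠ i' := fun hc => hne (by rw [hc])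
      exact congrArg (fun g => g.hom) (h₂ n i i' hi ⟨f⟩)
    · exact C.hom_eq_zero (S n i).property (S n' i').property hn f
  · intro X
    obtain ⟨N, Y, hY, ⟨e⟩⟩ := C.exists_decomposition X
    choose α fα dα f ι π t₁ t₂ t₃ using fun i : Fin N => h₃ i ⟨Y i, hY i⟩
    refine exists_iso_of_total (S := fun p : (Σ n, Fin (r n)) => (S p.1 p.2).obj)
      (α := Σ i, α i) (fun p => ⟨p.1, f p.1 p.2⟩)
      (fun p => (ι p.1 p.2).hom ≫ biproduct.ι Y p.1 ≫ e.inv)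
      (fun p => e.hom ≫ biproduct.π Y p.1 ≫ (π p.1 p.2).hom) ?_ ?_ ?_
    · rintro ⟨i, a⟩
      simpa using congrArg (fun g => g.hom) (t₁ i a)
    · rintro ⟨i, a⟩ ⟨i', a'⟩ h
      by_cases hi : i = i'
      · subst hi
        have ha : a ≠ a' := fun hc => h (by rw [hc])
        simpa using congrArg (fun g => g.hom) (t₂ i a a' ha)
      · simp [biproduct.ι_π_ne_assoc Y hi]
    · rw [Fintype.sum_sigma]
      have hsum : ∀ i, ∑ a, (π i a).hom ≫ (ι i a).hom = 𝟙 (Y i) := by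
        intro i
        have h := congrArg (fun g => g.hom) (t₃ i)
        have h3 : ∀ (s : Finset (α i)) (g : α i → ((⟨Y i, hY i⟩ : (C.deg i).FullSubcategory) ⟶ ⟨Y i, hY i⟩)),
            (∑ a ∈ s, g a).hom = ∑ a ∈ s, (g a).hom := by
          intro s g
          induction s using Finset.cons_induction with
          | empty => rfl
          | cons a s ha ih => rw [Finset.sum_cons, Finset.sum_cons, ← ih]; rfl
        exact (h3 _ _).symm.trans h
      have h4 : ∀ i, ∑ a, (e.hom ≫ biproduct.π Y i ≫ (π i a).hom) ≫ (ι i a).hom ≫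
          biproduct.ι Y i ≫ e.inv = e.hom ≫ (biproduct.π Y i ≫ biproduct.ι Y i) ≫ e.inv := by
        intro i
        have := hsum i
        calc _ = e.hom ≫ biproduct.π Y i ≫ (∑ a, (π i a).hom ≫ (ι i a).hom) ≫
              biproduct.ι Y i ≫ e.inv := by
                simp only [Preadditive.sum_comp, Preadditive.comp_sum, Category.assoc]
          _ = _ := by rw [this]; simp
      simp only [h4]
      rw [← Preadditive.comp_sum, ← Preadditive.sum_comp, biproduct.total]
      simp
  · refine (Set.finite_range fun i : Fin (r n) => (⟨n, i⟩ : Σ n, Fin (r n))).subset ?_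
    rintro ⟨m, i⟩ hm
    change m = n at hm
    subst hm
    exact ⟨i, rfl⟩

/-- The set of isomorphism classes of simple objects. -/
def Irr : Type := C.exists_simples.choose

/-- The simple objects. -/
def simpleObj : C.Irr → C := C.exists_simples.choose_spec.choose

/-- The degrees of the simple objects. -/
def irrDeg : C.Irr → ℕ := C.exists_simples.choose_spec.choose_spec.choose

theorem semisimpleFamily : SemisimpleFamily k C.simpleObj :=
  C.exists_simples.choose_spec.choose_spec.choose_spec.1

theorem deg_simpleObj (j : C.Irr) : C.deg (C.irrDeg j) (C.simpleObj j) :=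
  C.exists_simples.choose_spec.choose_spec.choose_spec.2.1 j

theorem finite_irrDeg (n : ℕ) : {j | C.irrDeg j = n}.Finite :=
  C.exists_simples.choose_spec.choose_spec.choose_spec.2.2 n

theorem finite_irrDeg_lt (n : ℕ) : {j | C.irrDeg j < n}.Finite := by
  have : {j | C.irrDeg j < n} = ⋃ m ∈ Finset.range n, {j | C.irrDeg j = m} := by
    ext j; simp
  rw [this]
  exact Set.Finite.biUnion (Finset.finite_toSet _) fun m _ => C.finite_irrDeg m

instance finite_hom (X Y : C) : Module.Finite k (X ⟶ Y) := C.semisimpleFamily.finite_hom X Y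

variable {C}

theorem hom_eq_zero_comm {X Y : C} (h : ∀ f : X ⟶ Y, f = 0) (g : Y ⟶ X) : g = 0 :=
  C.semisimpleFamily.hom_eq_zero_comm h g

/-- Every object is a direct sum of homogeneous ones. -/
theorem exists_homogeneous (X : C) : ∃ (N : ℕ) (Y : Fin N → C) (ι : ∀ i, Y i ⟶ X)
    (π : ∀ i, X ⟶ Y i), (∀ i : Fin N, C.deg i (Y i)) ∧ ∑ i, π i ≫ ι i = 𝟙 X := by
  obtain ⟨N, Y, hY, ⟨e⟩⟩ := C.exists_decomposition X
  refine ⟨N, Y, fun i => biproduct.ι Y i ≫ e.inv, fun i => e.hom ≫ biproduct.π Y i, hY, ?_⟩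
  have h : ∑ i, e.hom ≫ (biproduct.π Y i ≫ biproduct.ι Y i) ≫ e.inv = 𝟙 X := by
    rw [← Preadditive.comp_sum, ← Preadditive.sum_comp, biproduct.total]
    simp
  simpa using h

theorem exists_degree_bound (X : C) : ∃ N : ℕ, ∀ (n : ℕ) (Y : C), C.deg n Y → N ≤ n →
    ∀ f : X ⟶ Y, f = 0 := by
  obtain ⟨N, Z, ι, π, hZ, h⟩ := exists_homogeneous X
  refine ⟨N, fun n Y hY hn f => ?_⟩
  rw [← Category.id_comp f, ← h, Preadditive.sum_comp]
  refine Finset.sum_eq_zero fun i _ => ?_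
  rw [Category.assoc, C.hom_eq_zero (hZ i) hY (by omega) (ι i ≫ f), comp_zero]

theorem semisimpleFamily_op : SemisimpleFamily (C := C.op.carrier) k
    (fun j => (Opposite.op (C.simpleObj j) : C.op)) :=
  have := hasFiniteBiproducts_op C
  C.semisimpleFamily.op

end GrTwoVect

/-! ### Existence of adjoints for 1-morphisms -/

section Adjoints

variable {k : Type v} [Field k] {C D : GrTwoVect.{u, v} k}

/-- Boundedness supplies the finiteness needed for a right adjoint: Y lives in degrees below some M,
so F (S j) maps nontrivially to Y only if the degree of S j is below M + N, and there are finitely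
many such simple objects. -/
theorem IsTwoVectMor.isLeftAdjoint {F : C ⥤ D} (hF : IsTwoVectMor F) : F.IsLeftAdjoint := by
  have := hF.additive
  have := hF.linear
  obtain ⟨N, hN⟩ := hF.bounded
  refine C.semisimpleFamily.isLeftAdjoint F fun Y => ?_
  obtain ⟨M, Z, ι, π, hZ, h⟩ := GrTwoVect.exists_homogeneous Y
  refine (C.finite_irrDeg_lt (M + N)).subset ?_
  rintro j ⟨f, hf⟩
  by_contra hc
  apply hf
  rw [← Category.comp_id f, ← h, Preadditive.comp_sum]
  refine Finset.sum_eq_zero fun i _ => ?_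
  simp only [Set.mem_ofPred_eq] at hc
  rw [← Category.assoc, hN _ _ _ _ (C.deg_simpleObj j) (hZ i) (Or.inl (by omega)) (f ≫ π i),
    zero_comp]

theorem IsTwoVectMor.op {F : C ⥤ D} (hF : IsTwoVectMor F) :
    IsTwoVectMor (C := C.op) (D := D.op) F.op where
  additive := by
    have := hF.additive
    exact inferInstanceAs F.op.Additive
  linear := ⟨fun f r => Quiver.Hom.unop_inj (hF.linear.map_smul f.unop r)⟩
  bounded := by
    obtain ⟨N, hN⟩ := hF.bounded
    exact ⟨N, fun n m X Y hX hY h f => Quiver.Hom.unop_inj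
      (GrTwoVect.hom_eq_zero_comm (hN n m X.unop Y.unop hX hY h) f.unop)⟩

/-- The opposite functor is again a 1-morphism, because the vanishing of Hom spaces is symmetric.
Its right adjoint is a left adjoint of F. -/
theorem IsTwoVectMor.isRightAdjoint {F : C ⥤ D} (hF : IsTwoVectMor F) : F.IsRightAdjoint := by
  obtain ⟨G, ⟨adj⟩⟩ := hF.op.isLeftAdjoint
  exact ⟨_, ⟨Adjunction.unop (C := D.carrier) (D := C.carrier) (G := F.op) adj⟩⟩

end Adjoints

/-! ### A small model of the category of finite dimensional vector spaces -/

section SmallVect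

variable (k : Type v) [Field k]

/-- The standard vector spaces `k ^ n`. -/
def stdSpace (n : ULift.{u} ℕ) : FGModuleCat.{v} k := FGModuleCat.of k (Fin n.down → k)

/-- The category of the standard vector spaces `k ^ n`. -/
abbrev SmallVect : Type u := InducedCategory (FGModuleCat.{v} k) (stdSpace.{u, v} k)

/-- The inclusion of the standard vector spaces. -/
abbrev SmallVect.incl : SmallVect.{u, v} k ⥤ FGModuleCat.{v} k := inducedFunctor (stdSpace.{u, v} k)

instance : (SmallVect.incl.{u, v} k).EssSurj where
  mem_essImage V := ⟨(⟨Module.finrank k V⟩ : ULift.{u} ℕ),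
    ⟨(Module.finBasis k V).equivFun.symm.toFGModuleCatIso⟩⟩

instance : (SmallVect.incl.{u, v} k).IsEquivalence where

instance : (SmallVect.incl.{u, v} k).Additive where

instance : (SmallVect.incl.{u, v} k).Linear k where

instance : (SmallVect.incl.{u, v} k).inv.Additive :=
  have : (SmallVect.incl.{u, v} k).asEquivalence.functor.Additive :=
    inferInstanceAs (SmallVect.incl.{u, v} k).Additive
  inferInstanceAs (SmallVect.incl.{u, v} k).asEquivalence.inverse.Additive

instance : (SmallVect.incl.{u, v} k).inv.Linear k :=
  have : (SmallVect.incl.{u, v} k).asEquivalence.functor.Additive :=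
    inferInstanceAs (SmallVect.incl.{u, v} k).Additive
  have : (SmallVect.incl.{u, v} k).asEquivalence.functor.Linear k :=
    inferInstanceAs ((SmallVect.incl.{u, v} k).Linear k)
  inferInstanceAs ((SmallVect.incl.{u, v} k).asEquivalence.inverse.Linear k)

instance : HasFiniteBiproducts (SmallVect.{u, v} k) := by
  have : HasFiniteProducts (SmallVect.{u, v} k) :=
    ⟨fun _ => Adjunction.hasLimitsOfShape_of_equivalence (SmallVect.incl.{u, v} k)⟩
  exact HasFiniteBiproducts.of_hasFiniteProducts

/-- The category of finite dimensional vector spaces as a graded 2-vector space, concentrated in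
degree zero. -/
def smallVect : GrTwoVect.{u, v} k where
  carrier := SmallVect.{u, v} k
  -- Zero objects are homogeneous of every degree, so that the pieces of positive degree are zero
  -- categories rather than empty ones.
  deg n X := n = 0 ∨ IsZero X
  deg_of_iso n X Y e h := h.imp id fun h => h.of_iso e.symm
  isTwoVectorSpace n := by
    by_cases hn : n = 0
    · let F : (ObjectProperty.FullSubcategory (fun X : SmallVect.{u, v} k => n = 0 ∨ IsZero X)) ⥤
          (Fin 1 → FGModuleCat.{v} k) :=
        Functor.pi' (fun _ => ObjectProperty.ι _ ⋙ SmallVect.incl.{u, v} k)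
      have h1 : F.Faithful := ⟨fun {X Y f g} h => by
        have h' := congrFun h 0
        apply ObjectProperty.hom_ext
        exact (SmallVect.incl.{u, v} k).map_injective h'⟩
      have h2 : F.Full := ⟨fun {X Y} g => by
        refine ⟨⟨(SmallVect.incl.{u, v} k).preimage (g 0)⟩, funext fun i => ?_⟩
        obtain rfl : i = 0 := Subsingleton.elim _ _
        exact (SmallVect.incl.{u, v} k).map_preimage (g 0)⟩
      have h3 : F.EssSurj := ⟨fun V => ⟨⟨(SmallVect.incl.{u, v} k).objPreimage (V 0), Or.inl hn⟩,
        ⟨Pi.isoMk fun i => (SmallVect.incl.{u, v} k).objObjPreimageIso (V 0) ≪≫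
          eqToIso (congrArg V (Subsingleton.elim _ _))⟩⟩⟩
      have : F.IsEquivalence := {}
      exact ⟨1, F.asEquivalence, fun i => ⟨⟨rfl⟩, ⟨fun _ _ => rfl⟩⟩⟩
    · let F : (ObjectProperty.FullSubcategory (fun X : SmallVect.{u, v} k => n = 0 ∨ IsZero X)) ⥤
          (Fin 0 → FGModuleCat.{v} k) := Functor.pi' (fun i => i.elim0)
      have hz : ∀ X : (ObjectProperty.FullSubcategory
          (fun X : SmallVect.{u, v} k => n = 0 ∨ IsZero X)), IsZero X.obj :=
        fun X => X.property.resolve_left hn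
      have h1 : F.Faithful := ⟨fun {X Y f g} _ => by
        apply ObjectProperty.hom_ext
        exact (hz X).eq_of_src _ _⟩
      have h2 : F.Full := ⟨fun {X Y} g => ⟨⟨0⟩, funext fun i => i.elim0⟩⟩
      have h3 : F.EssSurj := ⟨fun V => by
        obtain ⟨Z, hZ⟩ := HasZeroObject.zero (C := SmallVect.{u, v} k)
        exact ⟨⟨Z, Or.inr hZ⟩, ⟨Pi.isoMk fun i => i.elim0⟩⟩⟩
      have : F.IsEquivalence := {}
      exact ⟨0, F.asEquivalence, fun i => i.elim0⟩
  hom_eq_zero {m n X Y} hX hY hmn f := by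
    rcases hX with rfl | hX
    · rcases hY with rfl | hY
      · exact absurd rfl hmn
      · exact hY.eq_of_tgt _ _
    · exact hX.eq_of_src _ _
  exists_decomposition X := ⟨1, fun _ => X, fun i => Or.inl (by omega),
    ⟨(biproductUniqueIso (fun _ : Fin 1 => X)).symm⟩⟩

end SmallVect

/-! ### Deligne tensor products -/

section VectMor

variable {k : Type v} [Field k] {D : GrTwoVect.{u, v} k}

/-- Linear functors from a graded 2-vector space to vector spaces which vanish in large degrees. -/
structure IsVectMor (G : D ⥤ FGModuleCat.{v} k) : Prop where
  additive : G.Additive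
  linear : G.Linear k
  bounded : ∃ N : ℕ, ∀ (n : ℕ) (X : D), D.deg n X → N < n → ∀ x : G.obj X, x = 0

theorem isZero_of_forall_eq_zero {V : FGModuleCat.{v} k} (h : ∀ x : V, x = 0) : IsZero V := by
  rw [IsZero.iff_id_eq_zero]
  apply FGModuleCat.hom_ext
  exact LinearMap.ext fun x => h x

/-- The universal property of a Deligne tensor product only tests against categories whose objects
form a type in the given universe. A functor to vector spaces is brought into this form by composing
with an inverse of the inclusion of the small model. -/
theorem IsVectMor.isTwoVectMor {G : D ⥤ FGModuleCat.{v} k} (hG : IsVectMor G) :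
    IsTwoVectMor (C := D) (D := smallVect.{u, v} k) (G ⋙ (SmallVect.incl.{u, v} k).inv) where
  additive := by
    have := hG.additive
    exact inferInstanceAs (G ⋙ (SmallVect.incl.{u, v} k).inv).Additive
  linear := by
    have := hG.linear
    exact inferInstanceAs ((G ⋙ (SmallVect.incl.{u, v} k).inv).Linear k)
  bounded := by
    obtain ⟨N, hN⟩ := hG.bounded
    refine ⟨N, fun n m X Y hX hY h f => ?_⟩
    rcases hY with rfl | hY
    · have : IsZero (G.obj X) := isZero_of_forall_eq_zero (hN n X hX (by omega))
      exact ((SmallVect.incl.{u, v} k).inv.map_isZero this).eq_of_src _ _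
    · exact hY.eq_of_tgt _ _

variable {I : Type} [Finite I] {C : I → GrTwoVect.{u, v} k} {B : (∀ i, C i) ⥤ D}

theorem IsDeligneTensor.whiskerLeft_injective (hB : IsDeligneTensor B)
    {G G' : D ⥤ FGModuleCat.{v} k} (hG : IsVectMor G) (hG' : IsVectMor G') {τ τ' : G ⟶ G'}
    (h : Functor.whiskerLeft B τ = Functor.whiskerLeft B τ') : τ = τ' := by
  have h1 := (hB.fullyFaithful (smallVect.{u, v} k) _ _ hG.isTwoVectMor hG'.isTwoVectMor).1
    (a₁ := Functor.whiskerRight τ _) (a₂ := Functor.whiskerRight τ' _) (by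
      ext X
      have := congrArg (fun t => (SmallVect.incl.{u, v} k).inv.map (t.app X)) h
      exact this)
  ext1
  ext1 X
  exact (SmallVect.incl.{u, v} k).inv.map_injective (congrArg (fun t => t.app X) h1)

theorem IsDeligneTensor.whiskerLeft_surjective (hB : IsDeligneTensor B)
    {G G' : D ⥤ FGModuleCat.{v} k} (hG : IsVectMor G) (hG' : IsVectMor G')
    (σ : B ⋙ G ⟶ B ⋙ G') : ∃ τ : G ⟶ G', Functor.whiskerLeft B τ = σ := by
  let R := (SmallVect.incl.{u, v} k).inv
  obtain ⟨τ', h⟩ := (hB.fullyFaithful (smallVect.{u, v} k) _ _ hG.isTwoVectMor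
    hG'.isTwoVectMor).2 (Functor.whiskerRight σ R)
  refine ⟨{ app := fun X => R.preimage (τ'.app X), naturality := fun X Y f => ?_ }, ?_⟩
  · apply R.map_injective
    rw [R.map_comp, R.map_comp]
    refine (congrArg (R.map (G.map f) ≫ ·) (R.map_preimage _)).trans (Eq.trans ?_
      (congrArg (· ≫ R.map (G'.map f)) (R.map_preimage _)).symm)
    exact τ'.naturality f
  · ext1
    ext1 X
    apply R.map_injective
    refine (R.map_preimage _).trans ?_
    exact congrArg (fun t => t.app X) h

theorem IsDeligneTensor.exists_vectMor (hB : IsDeligneTensor B) (M : (∀ i, C i) ⥤ FGModuleCat.{v} k)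
    (hM : ∀ X Y : (∀ i, C i),
      ∃ L : MultilinearMap k (fun i => X i ⟶ Y i) (M.obj X ⟶ M.obj Y),
        ∀ f : X ⟶ Y, M.map f = L (fun i => f i))
    (hM' : ∃ N : ℕ, ∀ (n : I → ℕ) (X : ∀ i, C i), (∀ i, (C i).deg (n i) (X i)) →
      N < ∑ᶠ i, n i → ∀ x : M.obj X, x = 0) :
    ∃ G : D ⥤ FGModuleCat.{v} k, IsVectMor G ∧ Nonempty (B ⋙ G ≅ M) := by
  let R := (SmallVect.incl.{u, v} k).inv
  obtain ⟨G, hG, ⟨e⟩⟩ := hB.essSurj (smallVect.{u, v} k) (M ⋙ R)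
    { multilinear := fun X Y => by
        obtain ⟨L, hL⟩ := hM X Y
        exact ⟨(R.mapLinearMap k).compMultilinearMap L, fun f => congrArg R.map (hL f)⟩
      bounded := by
        obtain ⟨N, hN⟩ := hM'
        refine ⟨N, fun n m X Y hX hY h f => ?_⟩
        rcases hY with rfl | hY
        · have : IsZero (M.obj X) := isZero_of_forall_eq_zero (hN n X hX (by omega))
          exact (R.map_isZero this).eq_of_src _ _
        · exact hY.eq_of_tgt _ _ }
  refine ⟨G ⋙ SmallVect.incl.{u, v} k, ⟨?_, ?_, ?_⟩, ⟨?_⟩⟩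
  · exact ⟨congrArg (SmallVect.incl.{u, v} k).map hG.additive.map_add⟩
  · exact ⟨fun f r => congrArg (SmallVect.incl.{u, v} k).map (hG.linear.map_smul f r)⟩
  · obtain ⟨N, hN⟩ := hG.bounded
    refine ⟨N, fun n X hX h x => ?_⟩
    have h1 := hN n 0 X (G.obj X) hX (Or.inl rfl) (Or.inl (by omega)) (𝟙 _)
    have h2 := congrArg (SmallVect.incl.{u, v} k).map h1
    exact congrArg (fun t => t.hom.hom x) h2
  · exact Functor.isoWhiskerRight e (SmallVect.incl.{u, v} k) ≪≫
      Functor.isoWhiskerLeft M (SmallVect.incl.{u, v} k).asEquivalence.counitIso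

end VectMor

/-! ### Morphisms and simple objects of a Deligne tensor product -/

section Deligne

variable {k : Type v} [Field k] {D : GrTwoVect.{u, v} k}

/-- The functor `Hom(Z, -)` to vector spaces. -/
def homVect (Z : D) : D ⥤ FGModuleCat.{v} k where
  obj W := FGModuleCat.of k (Z ⟶ W)
  map g := FGModuleCat.ofHom (Linear.rightComp k Z g)
  map_id W := by
    apply FGModuleCat.hom_ext
    exact LinearMap.ext fun f => Category.comp_id f
  map_comp g h := by
    apply FGModuleCat.hom_ext
    exact LinearMap.ext fun f => (Category.assoc f g h).symm

theorem isVectMor_homVect (Z : D) : IsVectMor (homVect Z) where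
  additive := ⟨by
    intro X Y f g
    apply FGModuleCat.hom_ext
    exact LinearMap.ext fun h => Preadditive.comp_add _ _ _ h f g⟩
  linear := ⟨fun f r => by
    apply FGModuleCat.hom_ext
    exact LinearMap.ext fun h => Linear.comp_smul _ _ _ h r f⟩
  bounded := by
    obtain ⟨N, hN⟩ := GrTwoVect.exists_degree_bound Z
    exact ⟨N, fun n X hX hn x => hN n X hX hn.le x⟩

theorem piTensorProduct_eq_zero {I : Type} {V : I → Type v} [∀ i, AddCommGroup (V i)]
    [∀ i, Module k (V i)]
    {i : I} (h : ∀ x : V i, x = 0) (z : ⨂[k] i, V i) : z = 0 := by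
  induction z using PiTensorProduct.induction_on with
  | smul_tprod r f =>
    rw [MultilinearMap.map_coord_zero (PiTensorProduct.tprod k) i (h (f i)), smul_zero]
  | add x y hx hy => rw [hx, hy, add_zero]

theorem finrank_piTensorProduct {I : Type} {V : I → Type v} [∀ i, AddCommGroup (V i)]
    [∀ i, Module k (V i)]
    [∀ i, Module.Finite k (V i)] [Fintype I] :
    Module.finrank k (⨂[k] i, V i) = ∏ i, Module.finrank k (V i) := by
  classical
  rw [Module.finrank_eq_card_basis (Basis.piTensorProduct fun i => Module.finBasis k (V i))]
  simp

variable {I : Type} [Finite I] {C : I → GrTwoVect.{u, v} k}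

/-- The functor `Y ↦ ⨂ᵢ Hom(X i, Y i)` to vector spaces. -/
def tensorHomVect (X : ∀ i, C i) : (∀ i, C i) ⥤ FGModuleCat.{v} k where
  obj Y := FGModuleCat.of k (⨂[k] i, (X i ⟶ Y i))
  map f := FGModuleCat.ofHom (PiTensorProduct.map fun i => Linear.rightComp k (X i) (f i))
  map_id Y := by
    apply FGModuleCat.hom_ext
    apply PiTensorProduct.ext
    ext g
    change PiTensorProduct.map _ (PiTensorProduct.tprod k g) = PiTensorProduct.tprod k g
    rw [PiTensorProduct.map_tprod]
    congr
    funext i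
    exact Category.comp_id (g i)
  map_comp f f' := by
    apply FGModuleCat.hom_ext
    apply PiTensorProduct.ext
    ext g
    change PiTensorProduct.map _ (PiTensorProduct.tprod k g) =
      PiTensorProduct.map _ (PiTensorProduct.map _ (PiTensorProduct.tprod k g))
    rw [PiTensorProduct.map_tprod, PiTensorProduct.map_tprod, PiTensorProduct.map_tprod]
    congr
    funext i
    exact (Category.assoc (g i) (f i) (f' i)).symm

variable {B : (∀ i, C i) ⥤ D}

/-- This is a Yoneda argument. The functor Y ↦ ⨂ Hom(X_i, Y_i) extends along B to a functor G, and
the canonical comparison with Hom(B X, B Y) extends to τ : G ⟶ Hom(B X, -). The element of G (B X)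
corresponding to the tensor product of identities defines a map in the other direction. -/
theorem IsDeligneTensor.lift_bijective (hB : IsDeligneTensor B) (X Y : ∀ i, C i)
    (L : MultilinearMap k (fun i => X i ⟶ Y i) (B.obj X ⟶ B.obj Y))
    (hL : ∀ f : X ⟶ Y, B.map f = L (fun i => f i)) :
    Function.Bijective (PiTensorProduct.lift L) := by
  obtain ⟨G, hG, ⟨θ⟩⟩ := hB.exists_vectMor (tensorHomVect X)
    (fun Y Y' => ⟨(show (_ →ₗ[k] ((tensorHomVect X).obj Y ⟶ (tensorHomVect X).obj Y')) from
        { toFun := fun f => FGModuleCat.ofHom f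
          map_add' := fun _ _ => rfl
          map_smul' := fun _ _ => rfl }).compMultilinearMap
        ((PiTensorProduct.mapMultilinear k (fun i => X i ⟶ Y i) (fun i => X i ⟶ Y' i)).compLinearMap
          (fun i => (Linear.comp (S := k) (X i) (Y i) (Y' i)).flip)), fun f => rfl⟩)
    (by
      have := Fintype.ofFinite I
      -- If the total degree of Y exceeds the sum of the bounds for the X i, then some Y i exceeds
      -- its own bound, and a single vanishing factor kills the tensor product.
      choose N hN using fun i => GrTwoVect.exists_degree_bound (X i)
      refine ⟨∑ᶠ i, N i, fun n Y hY h x => ?_⟩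
      rw [finsum_eq_sum_of_fintype, finsum_eq_sum_of_fintype] at h
      obtain ⟨i, -, hi⟩ := Finset.exists_lt_of_sum_lt h
      exact piTensorProduct_eq_zero (fun f => hN i (n i) (Y i) (hY i) hi.le f) x)
  -- The multilinear map is determined by `B.map`. It may thus be taken from a family over all
  -- targets, as needed to form the natural transformation `c`.
  choose L' hL' using hB.isMultiExact.multilinear X
  obtain rfl : L = L' Y := by
    ext f
    exact (hL f).symm.trans (hL' Y f)
  let c : tensorHomVect X ⟶ B ⋙ homVect (B.obj X) :=
    { app := fun Y => FGModuleCat.ofHom (PiTensorProduct.lift (L' Y))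
      naturality := fun Y Y' f => by
        apply FGModuleCat.hom_ext
        apply PiTensorProduct.ext
        ext g
        change PiTensorProduct.lift (L' Y') (PiTensorProduct.map _ (PiTensorProduct.tprod k g)) =
          PiTensorProduct.lift (L' Y) (PiTensorProduct.tprod k g) ≫ B.map f
        rw [PiTensorProduct.map_tprod, PiTensorProduct.lift.tprod, PiTensorProduct.lift.tprod]
        have h1 := B.map_comp (X := X) (Y := Y) (Z := Y') (fun i => g i) f
        rw [hL', hL'] at h1
        exact h1 }
  obtain ⟨τ, hτ⟩ := hB.whiskerLeft_surjective hG (isVectMor_homVect (B.obj X)) (θ.hom ≫ c)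
  let one : (tensorHomVect X).obj X := PiTensorProduct.tprod k (fun i => 𝟙 (X i))
  -- The universal element: G (f) applied to `w` is the candidate for the tensor corresponding to f.
  let w : G.obj (B.obj X) := (θ.inv.app X).hom.hom one
  have hinv : ∀ Y (z : (tensorHomVect X).obj Y),
      (θ.hom.app Y).hom.hom ((θ.inv.app Y).hom.hom z) = z := fun Y z =>
    congrArg (fun t => t.hom.hom z) (θ.inv_hom_id_app Y)
  have hτ' : ∀ Y (z : G.obj (B.obj Y)), (τ.app (B.obj Y)).hom.hom z =
      PiTensorProduct.lift (L' Y) ((θ.hom.app Y).hom.hom z) := fun Y z =>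
    congrArg (fun t => (t.app Y).hom.hom z) hτ
  have hL1 : PiTensorProduct.lift (L' X) one = 𝟙 (B.obj X) := by
    refine (PiTensorProduct.lift.tprod _).trans ?_
    exact (hL' X (𝟙 X)).symm.trans (B.map_id X)
  constructor
  -- On a pure tensor the morphism is `B.map` of a tuple, and naturality of θ applies; the general
  -- case follows by linearity. Thus z can be recovered from the morphism it defines.
  · have hleft : ∀ z : (tensorHomVect X).obj Y,
        (G.map (show B.obj X ⟶ B.obj Y from PiTensorProduct.lift (L' Y) z)).hom.hom w =
          (θ.inv.app Y).hom.hom z := by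
      have hadd := hG.additive
      have hlin := hG.linear
      intro z
      induction z using PiTensorProduct.induction_on with
      | smul_tprod r f =>
        rw [map_smul, PiTensorProduct.lift.tprod]
        change (G.map (r • _)).hom.hom w = _
        rw [Functor.map_smul, ← hL' Y f]
        have h1 := congrArg (fun t => t.hom.hom one) (θ.inv.naturality (X := X) (Y := Y) f)
        have h2 : (θ.inv.app Y).hom.hom (((tensorHomVect X).map f).hom.hom one) =
          (G.map (B.map f)).hom.hom w := h1
        have h3 : ((tensorHomVect X).map f).hom.hom one = PiTensorProduct.tprod k f := by
          refine (PiTensorProduct.map_tprod _ _).trans ?_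
          congr
          funext i
          exact Category.id_comp (f i)
        rw [h3] at h2
        refine (congrArg (r • ·) h2.symm).trans ?_
        exact (map_smul (θ.inv.app Y).hom.hom r _).symm
      | add x y hx hy =>
        rw [map_add]
        change (G.map (_ + _)).hom.hom w = _
        rw [Functor.map_add]
        refine (congrArg₂ (· + ·) hx hy).trans ?_
        exact (map_add (θ.inv.app Y).hom.hom x y).symm
    intro z z' h
    have h1 := (hleft z).symm.trans
      ((congrArg (fun t => (G.map t).hom.hom w) h).trans (hleft z'))
    exact (hinv Y z).symm.trans ((congrArg (θ.hom.app Y).hom.hom h1).trans (hinv Y z'))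
  -- Naturality of τ at f sends G (f) applied to `w` to the composite of τ applied to `w`, which is
  -- the identity, with f.
  · intro f
    refine ⟨(θ.hom.app Y).hom.hom ((G.map f).hom.hom w), ?_⟩
    rw [← hτ']
    have h1 : (τ.app (B.obj Y)).hom.hom ((G.map f).hom.hom w) =
        (show B.obj X ⟶ B.obj X from (τ.app (B.obj X)).hom.hom w) ≫ f :=
      congrArg (fun t => t.hom.hom w) (τ.naturality f)
    rw [h1, hτ', hinv]
    exact (congrArg (· ≫ f) hL1).trans (Category.id_comp f)

/-- If every B X ⟶ s vanished, so would every s ⟶ B X by symmetry of the Hom form. The identity of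
Hom(s, -) would then restrict to zero along B, which is impossible because restriction along B is
injective on transformations. -/
theorem IsDeligneTensor.exists_hom_ne_zero (hB : IsDeligneTensor B) {s : D} (hs : 𝟙 s ≠ 0) :
    ∃ (X : ∀ i, C i) (f : B.obj X ⟶ s), f ≠ 0 := by
  by_contra! hc
  apply hs
  have h := hB.whiskerLeft_injective (isVectMor_homVect s) (isVectMor_homVect s)
    (τ := 𝟙 _) (τ' := 0) (by
      ext1
      ext1 X
      apply FGModuleCat.hom_ext
      exact LinearMap.ext fun f => GrTwoVect.hom_eq_zero_comm (hc X) f)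
  exact congrArg (fun t => (t.app s).hom.hom (𝟙 s)) h

theorem IsDeligneTensor.finrank_hom (hB : IsDeligneTensor B) [Fintype I] (X Y : ∀ i, C i) :
    Module.finrank k (B.obj X ⟶ B.obj Y) = ∏ i, Module.finrank k (X i ⟶ Y i) := by
  obtain ⟨L, hL⟩ := hB.isMultiExact.multilinear X Y
  rw [← finrank_piTensorProduct,
    (LinearEquiv.ofBijective _ (hB.lift_bijective X Y L hL)).finrank_eq]

/-- Some morphism S j ⟶ X has nonzero, hence scalar, composite with g, so g has a section after
rescaling. The other composite is a scalar d on X with d • g = g, which forces d = 1. -/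
theorem SemisimpleFamily.nonempty_iso {k : Type*} [Field k] {C : Type*} [Category* C]
    [Preadditive C] [Linear k C] [HasFiniteBiproducts C] {J : Type} {S : J → C}
    (hS : SemisimpleFamily k S) {X : C} (hX : Module.finrank k (X ⟶ X) = 1) {j : J} (g : X ⟶ S j)
    (hg : g ≠ 0) : Nonempty (X ≅ S j) := by
  obtain ⟨n, f, ι, π, -, -, h⟩ := hS.exists_total X
  obtain ⟨r, hr⟩ : ∃ r : S j ⟶ X, r ≫ g ≠ 0 := by
    by_contra! hc
    apply hg
    rw [← Category.id_comp g, ← h, Preadditive.sum_comp]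
    refine Finset.sum_eq_zero fun a _ => ?_
    rw [Category.assoc]
    have : ι a ≫ g = 0 := by
      by_cases hj : f a = j
      · have h1 := hc (eqToHom (by rw [hj]) ≫ ι a)
        have h2 := congrArg (eqToHom (by rw [hj] : S (f a) = S j) ≫ ·) h1
        simpa using h2
      · exact hS.hom_eq_zero _ _ hj _
    rw [this, comp_zero]
  obtain ⟨c, hc⟩ := hS.exists_smul_id (r ≫ g)
  have hc0 : c ≠ 0 := by
    rintro rfl
    exact hr (by rw [← hc, zero_smul])
  have hsec : (c⁻¹ • r) ≫ g = 𝟙 _ := by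
    rw [Linear.smul_comp, ← hc, smul_smul, inv_mul_cancel₀ hc0, one_smul]
  have hX0 : 𝟙 X ≠ 0 := by
    intro h0
    exact hg (by rw [← Category.id_comp g, h0, zero_comp])
  obtain ⟨d, hd⟩ := (finrank_eq_one_iff_of_nonzero' _ hX0).1 hX (g ≫ (c⁻¹ • r))
  have hd1 : d • g = g := by
    have h1 := congrArg (· ≫ g) hd
    simp only [Linear.smul_comp, Category.id_comp, Category.assoc] at h1
    rw [h1, ← Linear.smul_comp, hsec, Category.comp_id]
  have hd2 : d = 1 := by
    have h2 : (d - 1) • g = 0 := by rw [sub_smul, one_smul, hd1, sub_self]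
    exact sub_eq_zero.1 ((smul_eq_zero.1 h2).resolve_right hg)
  exact ⟨⟨g, c⁻¹ • r, by rw [← hd, hd2, one_smul], hsec⟩⟩

/-- Writing the identity of each X i as a sum over simple summands and expanding multilinearly
factors the identity of B X through values of B on tuples of simple objects. -/
theorem IsMultiExact.exists_hom_ne_zero (hB : IsMultiExact B) {J : I → Type} {S : ∀ i, J i → C i}
    (hS : ∀ i, SemisimpleFamily k (S i)) {X : ∀ i, C i} {s : D} {f : B.obj X ⟶ s} (hf : f ≠ 0) :
    ∃ (j : ∀ i, J i) (g : B.obj (fun i => S i (j i)) ⟶ s), g ≠ 0 := by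
  classical
  have := Fintype.ofFinite I
  by_contra! hc
  apply hf
  choose n a ι π h₁ h₂ h₃ using fun i => (hS i).exists_total (X i)
  obtain ⟨L, hL⟩ := hB.multilinear X X
  have h1 : B.map (𝟙 X) = ∑ r : (∀ i, Fin (n i)), B.map (fun i => π i (r i) ≫ ι i (r i)) := by
    have h2 : (𝟙 X : X ⟶ X) = fun i => ∑ r, π i r ≫ ι i r := by
      funext i
      exact (h₃ i).symm
    rw [h2, hL]
    simp only [hL]
    exact L.map_sum (fun i r => π i r ≫ ι i r)
  rw [← Category.id_comp f, ← B.map_id, h1, Preadditive.sum_comp]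
  refine Finset.sum_eq_zero fun r _ => ?_
  have h3 := B.map_comp (X := X) (Y := fun i => S i (a i (r i))) (Z := X)
    (fun i => π i (r i)) (fun i => ι i (r i))
  have h4 : B.map (X := X) (Y := X) (fun i => π i (r i) ≫ ι i (r i)) ≫ f =
      B.map (X := X) (Y := fun i => S i (a i (r i))) (fun i => π i (r i)) ≫
        B.map (X := fun i => S i (a i (r i))) (Y := X) (fun i => ι i (r i)) ≫ f := by
    rw [← Category.assoc, ← h3]
    rfl
  exact h4.trans ((congrArg _ (hc (fun i => a i (r i)) _)).trans comp_zero)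

/-- Orthogonality and one-dimensional endomorphisms come from the tensor formula for Hom. The family
is exhaustive because each simple s receives a nonzero morphism from some B X, hence from B of a
tuple of simple objects, and this morphism is invertible up to choice of an isomorphism by
`nonempty_iso`. -/
theorem IsDeligneTensor.semisimpleFamily (hB : IsDeligneTensor B) {J : I → Type}
    {S : ∀ i, J i → C i} (hS : ∀ i, SemisimpleFamily k (S i)) :
    SemisimpleFamily k (fun j : (∀ i, J i) => B.obj (fun i => S i (j i))) := by
  have := Fintype.ofFinite I
  have hself : ∀ j : (∀ i, J i), Module.finrank k
      (B.obj (fun i => S i (j i)) ⟶ B.obj (fun i => S i (j i))) = 1 := by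
    intro j
    rw [hB.finrank_hom]
    exact Finset.prod_eq_one fun i _ => (hS i).finrank_self (j i)
  refine ⟨hself, fun j j' hj => ?_, fun W => ?_⟩
  · obtain ⟨i, hi⟩ := Function.ne_iff.1 hj
    obtain ⟨L, hL⟩ := hB.isMultiExact.multilinear (fun i => S i (j i)) (fun i => S i (j' i))
    intro f
    obtain ⟨z, rfl⟩ := (hB.lift_bijective _ _ L hL).2 f
    rw [piTensorProduct_eq_zero (fun x => (hS i).hom_eq_zero _ _ hi x) z, map_zero]
  · have hD : ∀ s : D.Irr, ∃ j : (∀ i, J i),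
        Nonempty (D.simpleObj s ≅ B.obj (fun i => S i (j i))) := by
      intro s
      obtain ⟨X, f, hf⟩ := hB.exists_hom_ne_zero (D.semisimpleFamily.id_ne_zero s)
      obtain ⟨j, g, hg⟩ := hB.isMultiExact.exists_hom_ne_zero hS hf
      obtain ⟨e⟩ := D.semisimpleFamily.nonempty_iso (hself j) g hg
      exact ⟨j, ⟨e.symm⟩⟩
    choose c hc using hD
    obtain ⟨n, f, ⟨e⟩⟩ := D.semisimpleFamily.exists_iso W
    exact ⟨n, fun a => c (f a), ⟨e ≪≫ biproduct.mapIso fun a => (hc (f a)).some⟩⟩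

end Deligne

/-! ### Multilinear functors -/

/-- Additivity in one variable, phrased without `Function.update` so that it applies to families
which are only known slot by slot. -/
theorem MultilinearMap.map_add_of_eq {R ι : Type*} [Semiring R] {V : ι → Type*} {W : Type*}
    [∀ i, AddCommMonoid (V i)] [∀ i, Module R (V i)] [AddCommMonoid W] [Module R W]
    (L : MultilinearMap R V W) (i : ι) {f f' f'' : ∀ i, V i} (hi : f i = f' i + f'' i)
    (h' : ∀ j, j ≠ i → f j = f' j) (h'' : ∀ j, j ≠ i → f j = f'' j) : L f = L f' + L f'' := by
  classical
  have e : ∀ {g : ∀ i, V i}, (∀ j, j ≠ i → f j = g j) → g = Function.update f i (g i) := by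
    intro g hg
    funext j
    by_cases hj : j = i
    · subst hj; simp
    · rw [Function.update_of_ne hj, hg j hj]
  rw [e h', e h'', ← L.map_update_add, ← hi, Function.update_eq_self]

theorem MultilinearMap.map_smul_of_eq {R ι : Type*} [Semiring R] {V : ι → Type*} {W : Type*}
    [∀ i, AddCommMonoid (V i)] [∀ i, Module R (V i)] [AddCommMonoid W] [Module R W]
    (L : MultilinearMap R V W) (i : ι) {f f' : ∀ i, V i} {c : R} (hi : f i = c • f' i)
    (h' : ∀ j, j ≠ i → f j = f' j) : L f = c • L f' := by
  classical
  have e : f' = Function.update f i (f' i) := by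
    funext j
    by_cases hj : j = i
    · subst hj; simp
    · rw [Function.update_of_ne hj, h' j hj]
  rw [e, ← L.map_update_smul, ← hi, Function.update_eq_self]

section AdjunctionLinear

variable (k : Type*) [Field k] {C D : Type*} [Category* C] [Category* D] [Preadditive C]
  [Preadditive D] [Linear k C] [Linear k D] {F : C ⥤ D} {G : D ⥤ C}

/-- The adjunction bijection, when the right adjoint is linear. -/
def rightLinearEquiv (adj : F ⊣ G) [G.Additive] [G.Linear k] (X : C) (Y : D) :
    (F.obj X ⟶ Y) ≃ₗ[k] (X ⟶ G.obj Y) :=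
  { adj.homEquiv X Y with
    map_add' := fun f g => by simp [Adjunction.homEquiv_unit]
    map_smul' := fun r f => by simp [Adjunction.homEquiv_unit] }

@[simp]
theorem rightLinearEquiv_apply (adj : F ⊣ G) [G.Additive] [G.Linear k] {X : C} {Y : D}
    (f : F.obj X ⟶ Y) :
    rightLinearEquiv k adj X Y f = adj.unit.app X ≫ G.map f := adj.homEquiv_unit ..

/-- The adjunction bijection is linear as soon as one of the two functors is. Here it is the left
adjoint; the primed variant uses the right one. -/
theorem Adjunction.finrank_hom (adj : F ⊣ G) [F.Additive] [F.Linear k] (X : C) (Y : D) :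
    Module.finrank k (F.obj X ⟶ Y) = Module.finrank k (X ⟶ G.obj Y) := by
  let e : (X ⟶ G.obj Y) ≃ₗ[k] (F.obj X ⟶ Y) :=
    { (adj.homEquiv X Y).symm with
      map_add' := fun f g => by simp [Adjunction.homEquiv_counit]
      map_smul' := fun r f => by simp [Adjunction.homEquiv_counit] }
  exact e.finrank_eq.symm

theorem Adjunction.finrank_hom' (adj : F ⊣ G) [G.Additive] [G.Linear k] (X : C) (Y : D) :
    Module.finrank k (F.obj X ⟶ Y) = Module.finrank k (X ⟶ G.obj Y) :=
  (rightLinearEquiv k adj X Y).finrank_eq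

theorem Adjunction.linear_right (adj : F ⊣ G) [F.Additive] [F.Linear k] : G.Linear k where
  map_smul f r := by
    apply (adj.homEquiv _ _).symm.injective
    simp [Adjunction.homEquiv_counit]

end AdjunctionLinear

/-! ### Linearity and degrees of the functors assigned to maps of finite sets -/

namespace SSHCategory

variable {k : Type v} [Field k] (H : SSHCategory.{u, v} k)

section

variable {S T : Type} [Finite S] [Finite T]

theorem map₁_deg (a : S → T) {n : ℕ} {X : H.obj S} (hX : (H.obj S).deg n X) :
    (H.obj T).deg n ((H.functor.map₁ a).obj X) := by
  have h := H.isDegreeZero (I := Unit) (S := fun _ => S) (fun _ => a) (fun _ => n) (fun _ => X)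
    (fun _ => hX)
  rwa [finsum_unique] at h

theorem isTwoVectMor_map₁ (a : S → T) :
    IsTwoVectMor (C := H.obj S) (D := H.obj T) (H.functor.map₁ a) where
  additive := ⟨by
    intro X Y f g
    obtain ⟨L, hL⟩ := (H.isMultiExact (I := Unit) (S := fun _ => S) (fun _ => a)).multilinear
      (fun _ => X) (fun _ => Y)
    have h := L.map_add_of_eq () (f := fun _ => f + g) (f' := fun _ => f) (f'' := fun _ => g) rfl
      (fun j hj => absurd rfl hj) (fun j hj => absurd rfl hj)
    exact (hL (fun _ => f + g)).trans (h.trans (congrArg₂ (· + ·) (hL fun _ => f).symm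
      (hL fun _ => g).symm))⟩
  linear := ⟨fun {X Y} f r => by
    obtain ⟨L, hL⟩ := (H.isMultiExact (I := Unit) (S := fun _ => S) (fun _ => a)).multilinear
      (fun _ => X) (fun _ => Y)
    have h := L.map_smul_of_eq () (f := fun _ => r • f) (f' := fun _ => f) rfl
      (fun j hj => absurd rfl hj)
    exact (hL (fun _ => r • f)).trans (h.trans (congrArg (r • ·) (hL fun _ => f).symm))⟩
  bounded := ⟨0, fun n m X Y hX hY h f => (H.obj T).hom_eq_zero (H.map₁_deg a hX) hY (by omega) f⟩

instance (a : S → T) : (H.functor.map₁ a).Additive := (H.isTwoVectMor_map₁ a).additive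

instance (a : S → T) : (H.functor.map₁ a).Linear k := (H.isTwoVectMor_map₁ a).linear

end

end SSHCategory

/-- Functors of two variables which are linear in each variable and add up the degrees. -/
structure IsBilinearFunctor {k : Type v} [Field k] {C C' D : GrTwoVect.{u, v} k}
    (N : C × C' ⥤ D) : Prop where
  add_left : ∀ {X X' : C} {Y Y' : C'} (f f' : X ⟶ X') (g : Y ⟶ Y'),
    N.map (X := (X, Y)) (Y := (X', Y')) (f + f', g) =
      N.map (X := (X, Y)) (Y := (X', Y')) (f, g) + N.map (X := (X, Y)) (Y := (X', Y')) (f', g)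
  add_right : ∀ {X X' : C} {Y Y' : C'} (f : X ⟶ X') (g g' : Y ⟶ Y'),
    N.map (X := (X, Y)) (Y := (X', Y')) (f, g + g') =
      N.map (X := (X, Y)) (Y := (X', Y')) (f, g) + N.map (X := (X, Y)) (Y := (X', Y')) (f, g')
  smul_left : ∀ {X X' : C} {Y Y' : C'} (r : k) (f : X ⟶ X') (g : Y ⟶ Y'),
    N.map (X := (X, Y)) (Y := (X', Y')) (r • f, g) = r • N.map (X := (X, Y)) (Y := (X', Y')) (f, g)
  smul_right : ∀ {X X' : C} {Y Y' : C'} (r : k) (f : X ⟶ X') (g : Y ⟶ Y'),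
    N.map (X := (X, Y)) (Y := (X', Y')) (f, r • g) = r • N.map (X := (X, Y)) (Y := (X', Y')) (f, g)

namespace IsBilinearFunctor

variable {k : Type v} [Field k] {C C' D : GrTwoVect.{u, v} k} {N : C × C' ⥤ D}

theorem additive_curry (hN : IsBilinearFunctor N) (X : C) :
    ((Functor.curry.obj N).obj X).Additive :=
  ⟨fun {_ _ f g} => hN.add_right (𝟙 X) f g⟩

theorem linear_curry (hN : IsBilinearFunctor N) (X : C) : ((Functor.curry.obj N).obj X).Linear k :=
  ⟨fun f r => hN.smul_right r (𝟙 X) f⟩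

/-- The fixed object X has finitely many homogeneous components, of degrees less than some M, so
that tensoring with X shifts degrees by less than M. -/
theorem isTwoVectMor_curry (hN : IsBilinearFunctor N)
    (hdeg : ∀ (n n' : ℕ) (X : C) (Y : C'), C.deg n X → C'.deg n' Y →
    D.deg (n + n') (N.obj (X, Y))) (X : C) : IsTwoVectMor ((Functor.curry.obj N).obj X) where
  additive := hN.additive_curry X
  linear := hN.linear_curry X
  bounded := by
    obtain ⟨M, Z, ι, π, hZ, h⟩ := GrTwoVect.exists_homogeneous X
    refine ⟨M, fun n m Y W hY hW hnm f => ?_⟩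
    have h1 : N.map (X := (X, Y)) (Y := (X, Y)) (∑ i, π i ≫ ι i, 𝟙 Y) =
        ∑ i, N.map (X := (X, Y)) (Y := (X, Y)) (π i ≫ ι i, 𝟙 Y) :=
      map_sum (AddMonoidHom.mk' (fun t : X ⟶ X => N.map (X := (X, Y)) (Y := (X, Y)) (t, 𝟙 Y))
        (fun s t => hN.add_left s t (𝟙 Y))) _ _
    have h2 : 𝟙 (N.obj (X, Y)) = ∑ i, N.map (X := (X, Y)) (Y := (X, Y)) (π i ≫ ι i, 𝟙 Y) := by
      rw [← h1, h, ← N.map_id]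
      rfl
    change N.obj (X, Y) ⟶ W at f
    rw [← Category.id_comp f, h2, Preadditive.sum_comp]
    refine Finset.sum_eq_zero fun i _ => ?_
    have h3 : N.map (X := (X, Y)) (Y := (X, Y)) (π i ≫ ι i, 𝟙 Y) =
        N.map (X := (X, Y)) (Y := (Z i, Y)) (π i, 𝟙 Y) ≫
          N.map (X := (Z i, Y)) (Y := (X, Y)) (ι i, 𝟙 Y) := by
      rw [← N.map_comp, prod_comp, Category.comp_id]
    rw [h3, Category.assoc, D.hom_eq_zero (hdeg i n (Z i) Y (hZ i) hY) hW (by omega)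
      (N.map (X := (Z i, Y)) (Y := (X, Y)) (ι i, 𝟙 Y) ≫ f), comp_zero]

end IsBilinearFunctor

theorem pairFunctor_map_eta {C : Type u} [Category.{v} C] {p q : C × C}
    (f : (pairFunctor C).obj p ⟶ (pairFunctor C).obj q) :
    (pairFunctor C).map ((f 0, f 1) : p ⟶ q) = f := by
  funext i
  match i with
  | 0 => rfl
  | 1 => rfl

namespace SSHCategory

variable {k : Type v} [Field k] (H : SSHCategory.{u, v} k)

section

variable {S T : Type} [Finite S] [Finite T]

theorem map₂_deg (φ : Fin 2 → S → T) (n n' : ℕ) (X Y : H.obj S) (hX : (H.obj S).deg n X)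
    (hY : (H.obj S).deg n' Y) : (H.obj T).deg (n + n') ((H.functor.map₂ φ).obj (X, Y)) := by
  have h := H.isDegreeZero (I := Fin 2) (S := fun _ => S) φ ![n, n']
    ((pairFunctor (H.obj S)).obj (X, Y)) (fun i => match i with
      | 0 => hX
      | 1 => hY)
  rwa [finsum_eq_sum_of_fintype, Fin.sum_univ_two] at h

theorem isBilinear_map₂ (φ : Fin 2 → S → T) :
    IsBilinearFunctor (C := H.obj S) (C' := H.obj S) (D := H.obj T) (H.functor.map₂ φ) := by
  have hml := fun p q : H.obj S × H.obj S =>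
    (H.isMultiExact (I := Fin 2) (S := fun _ => S) φ).multilinear
      ((pairFunctor (H.obj S)).obj p) ((pairFunctor (H.obj S)).obj q)
  refine ⟨?_, ?_, ?_, ?_⟩
  · intro X X' Y Y' f f' g
    obtain ⟨L, hL⟩ := hml (X, Y) (X', Y')
    have h := L.map_add_of_eq 0
      (f := (pairFunctor (H.obj S)).map (X := (X, Y)) (Y := (X', Y')) (f + f', g))
      (f' := (pairFunctor (H.obj S)).map (X := (X, Y)) (Y := (X', Y')) (f, g))
      (f'' := (pairFunctor (H.obj S)).map (X := (X, Y)) (Y := (X', Y')) (f', g)) rfl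
      (fun j hj => by
        obtain rfl : j = 1 := by omega
        rfl)
      (fun j hj => by
        obtain rfl : j = 1 := by omega
        rfl)
    exact (hL _).trans (h.trans (congrArg₂ (· + ·) (hL _).symm (hL _).symm))
  · intro X X' Y Y' f g g'
    obtain ⟨L, hL⟩ := hml (X, Y) (X', Y')
    have h := L.map_add_of_eq 1
      (f := (pairFunctor (H.obj S)).map (X := (X, Y)) (Y := (X', Y')) (f, g + g'))
      (f' := (pairFunctor (H.obj S)).map (X := (X, Y)) (Y := (X', Y')) (f, g))
      (f'' := (pairFunctor (H.obj S)).map (X := (X, Y)) (Y := (X', Y')) (f, g')) rfl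
      (fun j hj => by
        obtain rfl : j = 0 := by omega
        rfl)
      (fun j hj => by
        obtain rfl : j = 0 := by omega
        rfl)
    exact (hL _).trans (h.trans (congrArg₂ (· + ·) (hL _).symm (hL _).symm))
  · intro X X' Y Y' r f g
    obtain ⟨L, hL⟩ := hml (X, Y) (X', Y')
    have h := L.map_smul_of_eq 0 (c := r)
      (f := (pairFunctor (H.obj S)).map (X := (X, Y)) (Y := (X', Y')) (r • f, g))
      (f' := (pairFunctor (H.obj S)).map (X := (X, Y)) (Y := (X', Y')) (f, g)) rfl
      (fun j hj => by
        obtain rfl : j = 1 := by omega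
        rfl)
    exact (hL _).trans (h.trans (congrArg (r • ·) (hL _).symm))
  · intro X X' Y Y' r f g
    obtain ⟨L, hL⟩ := hml (X, Y) (X', Y')
    have h := L.map_smul_of_eq 1 (c := r)
      (f := (pairFunctor (H.obj S)).map (X := (X, Y)) (Y := (X', Y')) (f, r • g))
      (f' := (pairFunctor (H.obj S)).map (X := (X, Y)) (Y := (X', Y')) (f, g)) rfl
      (fun j hj => by
        obtain rfl : j = 0 := by omega
        rfl)
    exact (hL _).trans (h.trans (congrArg (r • ·) (hL _).symm))

theorem isTwoVectMor_curry_map₂ (φ : Fin 2 → S → T) (X : H.obj S) :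
    IsTwoVectMor (C := H.obj S) (D := H.obj T)
      ((Functor.curry.obj (H.functor.map₂ φ)).obj X) :=
  (H.isBilinear_map₂ φ).isTwoVectMor_curry (H.map₂_deg φ) X

end

theorem isTwoVectMor_m : IsTwoVectMor H.m := H.isTwoVectMor_map₁ _

theorem isTwoVectMor_mSq : IsTwoVectMor H.mSq := H.isTwoVectMor_map₁ _

theorem isTwoVectMor_mBar : IsTwoVectMor H.mBar := H.isTwoVectMor_map₁ _

instance : H.m.Additive := H.isTwoVectMor_m.additive
instance : H.m.Linear k := H.isTwoVectMor_m.linear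
instance : H.mSq.Additive := H.isTwoVectMor_mSq.additive
instance : H.mSq.Linear k := H.isTwoVectMor_mSq.linear
instance : H.mBar.Additive := H.isTwoVectMor_mBar.additive
instance : H.mBar.Linear k := H.isTwoVectMor_mBar.linear

theorem isTwoVectMor_i (F : H.C₁) : IsTwoVectMor (H.i.obj F) := H.isTwoVectMor_curry_map₂ _ F

theorem isTwoVectMor_i₂ (Φ : H.C₂) : IsTwoVectMor (H.i₂.obj Φ) := H.isTwoVectMor_curry_map₂ _ Φ

theorem nonempty_adjoints : Nonempty H.Adjoints := by
  obtain ⟨Δr, ⟨adjΔr⟩⟩ := H.isTwoVectMor_m.isLeftAdjoint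
  obtain ⟨Δl, ⟨adjΔl⟩⟩ := H.isTwoVectMor_m.isRightAdjoint
  obtain ⟨ΔrSq, ⟨adjΔrSq⟩⟩ := H.isTwoVectMor_mSq.isLeftAdjoint
  have h := fun F => (H.isTwoVectMor_i F).isLeftAdjoint
  have h₂ := fun Φ => (H.isTwoVectMor_i₂ Φ).isLeftAdjoint
  exact ⟨⟨Δr, adjΔr, Δl, adjΔl, ΔrSq, adjΔrSq, fun F => (h F).exists_rightAdjoint.choose,
    fun F => (h F).exists_rightAdjoint.choose_spec.some,
    fun Φ => (h₂ Φ).exists_rightAdjoint.choose,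
    fun Φ => (h₂ Φ).exists_rightAdjoint.choose_spec.some⟩⟩

end SSHCategory

/-! ### The Heisenberg relation -/

namespace SSHCategory

variable {k : Type v} [Field k] (H : SSHCategory.{u, v} k)

theorem isDeligneTensor_box : IsDeligneTensor (C := fun _ : Fin 2 => H.C₁) (D := H.C₂)
    (H.functor.map (S := fun _ : Fin 2 => Fin 1) (fun (i : Fin 2) (_ : Fin 1) => i)) :=
  H.isDeligneTensor _ (by decide)

theorem isDeligneTensor_box₂ : IsDeligneTensor (C := fun _ : Fin 2 => H.C₂) (D := H.C₄)
    (H.functor.map (S := fun _ : Fin 2 => Fin 2) (![![0, 2], ![1, 3]] : Fin 2 → Fin 2 → Fin 4)) :=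
  H.isDeligneTensor _ (by decide)

namespace Adjoints

variable {H} (D : H.Adjoints)

/-- The map `Hom(Δˡ F ⊠ Δˡ Y, Z) → Hom(F ⊠ Y, mBar Z)`. -/
def boxAdj (F Y : H.C₁) (Z : H.C₄) :
    (H.box₂.obj (D.Δl.obj F, D.Δl.obj Y) ⟶ Z) →ₗ[k] (H.box.obj (F, Y) ⟶ H.mBar.obj Z) :=
  Linear.leftComp k _ (H.box.map (X := (F, Y)) (Y := (H.m.obj (D.Δl.obj F), H.m.obj (D.Δl.obj Y)))
      (D.adjΔl.unit.app F, D.adjΔl.unit.app Y) ≫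
    H.boxBarIso.hom.app (D.Δl.obj F, D.Δl.obj Y)) ∘ₗ H.mBar.mapLinearMap k

theorem boxAdj_apply (F Y : H.C₁) (Z : H.C₄) (h : H.box₂.obj (D.Δl.obj F, D.Δl.obj Y) ⟶ Z) :
    D.boxAdj F Y Z h = (H.box.map (X := (F, Y))
      (Y := (H.m.obj (D.Δl.obj F), H.m.obj (D.Δl.obj Y)))
      (D.adjΔl.unit.app F, D.adjΔl.unit.app Y) ≫
        H.boxBarIso.hom.app (D.Δl.obj F, D.Δl.obj Y)) ≫ H.mBar.map h := rfl

/-- On an object Φ ⊠ X both Hom spaces are tensor products, by the Deligne property of ⊠ on 𝒞 and on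
𝒞^{⊗ 2}. The map becomes the tensor product of the bijections Hom(Δˡ F, Φ) ≅ Hom(F, m Φ) and Hom(Δˡ
Y, X) ≅ Hom(Y, m X), followed by `boxBarIso`. -/
theorem boxAdj_bijective_box (F Y : H.C₁) (Φ X : H.C₂) :
    Function.Bijective (D.boxAdj F Y (H.box₂.obj (Φ, X))) := by
  obtain ⟨L, hL⟩ := H.isDeligneTensor_box₂.isMultiExact.multilinear
    ((pairFunctor H.C₂).obj (D.Δl.obj F, D.Δl.obj Y)) ((pairFunctor H.C₂).obj (Φ, X))
  obtain ⟨L', hL'⟩ := H.isDeligneTensor_box.isMultiExact.multilinear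
    ((pairFunctor H.C₁).obj (F, Y)) ((pairFunctor H.C₁).obj (H.m.obj Φ, H.m.obj X))
  have hbij := H.isDeligneTensor_box₂.lift_bijective _ _ L hL
  have hbij' := H.isDeligneTensor_box.lift_bijective _ _ L' hL'
  let e : ∀ i, ((pairFunctor H.C₂).obj (D.Δl.obj F, D.Δl.obj Y) i ⟶
      (pairFunctor H.C₂).obj (Φ, X) i) ≃ₗ[k] ((pairFunctor H.C₁).obj (F, Y) i ⟶
      (pairFunctor H.C₁).obj (H.m.obj Φ, H.m.obj X) i) := fun i => match i with
    | 0 => rightLinearEquiv k D.adjΔl F Φ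
    | 1 => rightLinearEquiv k D.adjΔl Y X
  let iso : H.box.obj (H.m.obj Φ, H.m.obj X) ≅ H.mBar.obj (H.box₂.obj (Φ, X)) :=
    H.boxBarIso.app (Φ, X)
  -- It suffices to compare on pure tensors, where the identity is naturality of `boxBarIso`
  -- combined with the unit formula for the adjunctions.
  have hcomp : D.boxAdj F Y (H.box₂.obj (Φ, X)) ∘ₗ PiTensorProduct.lift L =
      Linear.rightComp k (H.box.obj (F, Y)) iso.hom ∘ₗ PiTensorProduct.lift L' ∘ₗ
        (PiTensorProduct.congr e).toLinearMap := by
    apply PiTensorProduct.ext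
    ext f
    change D.boxAdj F Y _ (PiTensorProduct.lift L (PiTensorProduct.tprod k f)) =
      (PiTensorProduct.lift L' (PiTensorProduct.congr e (PiTensorProduct.tprod k f))) ≫ iso.hom
    rw [PiTensorProduct.congr_tprod, PiTensorProduct.lift.tprod, PiTensorProduct.lift.tprod]
    have h1 : L f = H.box₂.map (X := (D.Δl.obj F, D.Δl.obj Y)) (Y := (Φ, X)) (f 0, f 1) :=
      (hL f).symm.trans (congrArg _ (pairFunctor_map_eta (p := (D.Δl.obj F, D.Δl.obj Y))
        (q := (Φ, X)) f).symm)
    have h2 : (L' fun i => e i (f i)) = H.box.map (X := (F, Y)) (Y := (H.m.obj Φ, H.m.obj X))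
        (D.adjΔl.unit.app F ≫ H.m.map (f 0), D.adjΔl.unit.app Y ≫ H.m.map (f 1)) := by
      refine (hL' (fun i => e i (f i))).symm.trans (congrArg (H.functor.map _).map ?_)
      refine (pairFunctor_map_eta (p := (F, Y)) (q := (H.m.obj Φ, H.m.obj X))
        (fun i => e i (f i))).symm.trans ?_
      have h3 : e 0 (f 0) = D.adjΔl.unit.app F ≫ H.m.map (f 0) := rightLinearEquiv_apply k _ _
      have h4 : e 1 (f 1) = D.adjΔl.unit.app Y ≫ H.m.map (f 1) := rightLinearEquiv_apply k _ _
      rw [h3, h4]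
      rfl
    rw [h1, h2]
    refine (D.boxAdj_apply F Y (H.box₂.obj (Φ, X)) (H.box₂.map (X := (D.Δl.obj F, D.Δl.obj Y))
      (Y := (Φ, X)) (f 0, f 1))).trans ?_
    have h5 := H.boxBarIso.hom.naturality (X := (D.Δl.obj F, D.Δl.obj Y)) (Y := (Φ, X)) (f 0, f 1)
    have h6 : H.box.map (X := (F, Y)) (Y := (H.m.obj Φ, H.m.obj X))
        (D.adjΔl.unit.app F ≫ H.m.map (f 0), D.adjΔl.unit.app Y ≫ H.m.map (f 1)) =
        H.box.map (X := (F, Y)) (Y := (H.m.obj (D.Δl.obj F), H.m.obj (D.Δl.obj Y)))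
          (D.adjΔl.unit.app F, D.adjΔl.unit.app Y) ≫ (H.m.prod H.m ⋙ H.box).map
            (X := (D.Δl.obj F, D.Δl.obj Y)) (Y := (Φ, X)) (f 0, f 1) := by
      exact H.box.map_comp (X := (F, Y)) (Y := (H.m.obj (D.Δl.obj F), H.m.obj (D.Δl.obj Y)))
        (Z := (H.m.obj Φ, H.m.obj X)) (D.adjΔl.unit.app F, D.adjΔl.unit.app Y)
        (H.m.map (f 0), H.m.map (f 1))
    rw [h6]
    exact (Category.assoc _ _ _).trans ((congrArg _ h5.symm).trans (Category.assoc _ _ _).symm)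
  refine (Function.Bijective.of_comp_iff (D.boxAdj F Y (H.box₂.obj (Φ, X)))
    (g := PiTensorProduct.lift L) hbij).1 ?_
  have hfun := congrArg DFunLike.coe hcomp
  rw [LinearMap.coe_comp, LinearMap.coe_comp, LinearMap.coe_comp] at hfun
  refine (congrArg Function.Bijective hfun).mpr ?_
  refine Function.Bijective.comp ?_ (Function.Bijective.comp hbij' (PiTensorProduct.congr e).bijective)
  refine Function.bijective_iff_has_inverse.2 ⟨fun g => g ≫ iso.inv, fun g => ?_, fun g => ?_⟩
  · change (g ≫ iso.hom) ≫ iso.inv = g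
    simp
  · change (g ≫ iso.inv) ≫ iso.hom = g
    simp

/-- Both sides are additive and natural in Z, and every Z is a direct sum of objects S ⊠ S' with S,
S' simple in 𝒞^{⊗ 2}. Bijectivity therefore passes from these to all Z. -/
theorem boxAdj_bijective (F Y : H.C₁) (Z : H.C₄) : Function.Bijective (D.boxAdj F Y Z) := by
  have hnat : ∀ {Z Z' : H.C₄} (h : H.box₂.obj (D.Δl.obj F, D.Δl.obj Y) ⟶ Z) (t : Z ⟶ Z'),
      D.boxAdj F Y Z' (h ≫ t) = D.boxAdj F Y Z h ≫ H.mBar.map t := by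
    intro Z Z' h t
    rw [boxAdj_apply, boxAdj_apply, H.mBar.map_comp, Category.assoc, Category.assoc,
      Category.assoc]
  obtain ⟨n, f, ι, π, -, -, hsum⟩ := (H.isDeligneTensor_box₂.semisimpleFamily
    (fun _ => H.C₂.semisimpleFamily)).exists_total Z
  have hbox : ∀ a, Function.Bijective (D.boxAdj F Y ((H.functor.map
      (S := fun _ : Fin 2 => Fin 2) (![![0, 2], ![1, 3]] : Fin 2 → Fin 2 → Fin 4)).obj
        (fun i => H.C₂.simpleObj (f a i)))) := by
    intro a
    have h : (fun i => H.C₂.simpleObj (f a i)) = (pairFunctor H.C₂).obj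
        (H.C₂.simpleObj (f a 0), H.C₂.simpleObj (f a 1)) := by
      funext i
      match i with
      | 0 => rfl
      | 1 => rfl
    rw [h]
    exact D.boxAdj_bijective_box F Y _ _
  constructor
  · refine (injective_iff_map_eq_zero (D.boxAdj F Y Z)).2 fun h hh => ?_
    have h0 : ∀ a, h ≫ π a = 0 := by
      intro a
      apply (hbox a).1
      rw [hnat, hh, zero_comp, map_zero]
    rw [← Category.comp_id h, ← hsum, Preadditive.comp_sum]
    exact Finset.sum_eq_zero fun a _ => by rw [← Category.assoc, h0, zero_comp]
  · intro w
    choose g hg using fun a => (hbox a).2 (w ≫ H.mBar.map (π a))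
    refine ⟨∑ a, g a ≫ ι a, ?_⟩
    rw [map_sum]
    have : ∀ a, D.boxAdj F Y Z (g a ≫ ι a) = w ≫ H.mBar.map (π a ≫ ι a) := by
      intro a
      rw [hnat, hg, H.mBar.map_comp, Category.assoc]
    simp only [this]
    rw [← Preadditive.comp_sum, ← Functor.map_sum, hsum, H.mBar.map_id, Category.comp_id]

/-- The square `i_F ∘ m ⟶ mBar ∘ i_{Δˡ F}`. -/
def boxSquare (F : H.C₁) :
    TwoSquare H.m (H.i₂.obj (D.Δl.obj F)) (H.i.obj F) H.mBar :=
  TwoSquare.mk _ _ _ _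
    { app := fun X => H.box.map (X := (F, H.m.obj X)) (Y := (H.m.obj (D.Δl.obj F), H.m.obj X))
        (D.adjΔl.unit.app F, 𝟙 _) ≫ H.boxBarIso.hom.app (D.Δl.obj F, X)
      naturality := fun X Y f => by
        have h1 := H.boxBarIso.hom.naturality (X := (D.Δl.obj F, X)) (Y := (D.Δl.obj F, Y)) (𝟙 _, f)
        have h2 : H.box.map (X := (F, H.m.obj X)) (Y := (F, H.m.obj Y)) (𝟙 F, H.m.map f) ≫
            H.box.map (X := (F, H.m.obj Y)) (Y := (H.m.obj (D.Δl.obj F), H.m.obj Y))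
              (D.adjΔl.unit.app F, 𝟙 _) =
            H.box.map (X := (F, H.m.obj X)) (Y := (H.m.obj (D.Δl.obj F), H.m.obj X))
              (D.adjΔl.unit.app F, 𝟙 _) ≫ (H.m.prod H.m ⋙ H.box).map
                (X := (D.Δl.obj F, X)) (Y := (D.Δl.obj F, Y)) (𝟙 _, f) := by
          rw [← H.box.map_comp]
          refine Eq.trans ?_ (H.box.map_comp (X := (F, H.m.obj X))
            (Y := (H.m.obj (D.Δl.obj F), H.m.obj X)) (Z := (H.m.obj (D.Δl.obj F), H.m.obj Y))
            (D.adjΔl.unit.app F, 𝟙 _) (H.m.map (𝟙 _), H.m.map f))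
          congr 1
          rw [prod_comp, prod_comp, H.m.map_id, Category.id_comp, Category.id_comp, Category.comp_id,
            Category.comp_id]
        change H.box.map (X := (F, H.m.obj X)) (Y := (F, H.m.obj Y)) (𝟙 F, H.m.map f) ≫ _ ≫ _ =
          (_ ≫ _) ≫ (H.box₂ ⋙ H.mBar).map (X := (D.Δl.obj F, X)) (Y := (D.Δl.obj F, Y)) (𝟙 _, f)
        rw [← Category.assoc, h2, Category.assoc, h1, Category.assoc] }

theorem boxSquare_app (F : H.C₁) (X : H.C₂) : (D.boxSquare F).natTrans.app X =
    H.box.map (X := (F, H.m.obj X)) (Y := (H.m.obj (D.Δl.obj F), H.m.obj X))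
        (D.adjΔl.unit.app F, 𝟙 _) ≫ H.boxBarIso.hom.app (D.Δl.obj F, X) := rfl

/-- By Yoneda it suffices to test on morphisms from Y. There Hom(Y, m jʳ Z) ≅ Hom(Δˡ Y, jʳ Z) ≅
Hom(Δˡ F ⊠ Δˡ Y, Z), where jʳ is right adjoint to i_{Δˡ F}, and Hom(Y, jʳ_F mBar Z) ≅ Hom(F ⊠ Y,
mBar Z). Under these bijections the mate becomes `boxAdj`. -/
theorem isIso_boxMate (F : H.C₁) :
    IsIso (mateEquiv (D.adjjr₂ (D.Δl.obj F)) (D.adjjr F) (D.boxSquare F)).natTrans := by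
  rw [NatTrans.isIso_iff_isIso_app]
  intro Z
  rw [isIso_iff_yoneda_map_bijective]
  intro Y
  have hadj := D.boxAdj_bijective F Y Z
  rw [← Function.Bijective.of_comp_iff _ (D.adjΔl.homEquiv Y _).bijective,
    ← Function.Bijective.of_comp_iff _ ((D.adjjr₂ (D.Δl.obj F)).homEquiv (D.Δl.obj Y) Z).bijective,
    ← Function.Bijective.of_comp_iff' ((D.adjjr F).homEquiv _ _).symm.bijective]
  have hg : ∀ h : (H.i₂.obj (D.Δl.obj F)).obj (D.Δl.obj Y) ⟶ Z,
      ((D.adjjr F).homEquiv _ _).symm (D.adjΔl.homEquiv Y _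
        ((D.adjjr₂ (D.Δl.obj F)).homEquiv (D.Δl.obj Y) Z h) ≫
          (mateEquiv (D.adjjr₂ (D.Δl.obj F)) (D.adjjr F) (D.boxSquare F)).natTrans.app Z) =
        D.boxAdj F Y Z h := by
    intro h
    have h1 := mateEquiv_counit (D.adjjr₂ (D.Δl.obj F)) (D.adjjr F) (D.boxSquare F) Z
    obtain ⟨g, rfl⟩ := ((D.adjjr₂ (D.Δl.obj F)).homEquiv (D.Δl.obj Y) Z).symm.surjective h
    rw [Equiv.apply_symm_apply, Adjunction.homEquiv_counit, Adjunction.homEquiv_counit,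
      Adjunction.homEquiv_unit, Functor.map_comp, Category.assoc]
    refine (congrArg (_ ≫ ·) h1).trans ?_
    have h2 := (D.boxSquare F).natTrans.naturality g
    rw [Functor.map_comp, Category.assoc]
    refine (congrArg (_ ≫ ·) ((Category.assoc _ _ _).symm.trans
      (congrArg (· ≫ H.mBar.map ((D.adjjr₂ (D.Δl.obj F)).counit.app Z)) h2))).trans ?_
    refine Eq.trans ?_ (D.boxAdj_apply F Y Z _).symm
    rw [boxSquare_app]
    have h3 : (H.i.obj F).map (D.adjΔl.unit.app Y) ≫
        H.box.map (X := (F, H.m.obj (D.Δl.obj Y)))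
          (Y := (H.m.obj (D.Δl.obj F), H.m.obj (D.Δl.obj Y))) (D.adjΔl.unit.app F, 𝟙 _) =
        H.box.map (X := (F, Y)) (Y := (H.m.obj (D.Δl.obj F), H.m.obj (D.Δl.obj Y)))
          (D.adjΔl.unit.app F, D.adjΔl.unit.app Y) := by
      refine (H.box.map_comp (X := (F, Y)) (Y := (F, H.m.obj (D.Δl.obj Y)))
        (Z := (H.m.obj (D.Δl.obj F), H.m.obj (D.Δl.obj Y))) (𝟙 F, D.adjΔl.unit.app Y)
        (D.adjΔl.unit.app F, 𝟙 _)).symm.trans ?_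
      rw [prod_comp, Category.id_comp, Category.comp_id]
    have h4 : ∀ {A₁ A₂ A₃ A₄ A₅ A₆ : H.C₂} (a : A₁ ⟶ A₂) (b : A₂ ⟶ A₃) (c : A₃ ⟶ A₄)
        (d : A₄ ⟶ A₅) (e : A₅ ⟶ A₆), a ≫ ((b ≫ c) ≫ d) ≫ e = ((a ≫ b) ≫ c) ≫ (d ≫ e) := by
      intros
      simp only [Category.assoc]
    refine (h4 _ _ _ _ _).trans ?_
    exact congrArg₂ (fun s t => (s ≫ H.boxBarIso.hom.app (D.Δl.obj F, D.Δl.obj Y)) ≫ t) h3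
      (H.mBar.map_comp _ _).symm
  exact (congrArg Function.Bijective (funext hg)).mpr hadj

/-- The canonical square is `boxSquare` pasted with the Hopf square. Taking mates turns the pasting
of squares into a composite of mates, and both factors are invertible. -/
theorem isIso_heisenbergMate (F : H.C₁) : IsIso (D.heisenbergMate F) := by
  let α := D.boxSquare F
  let β : TwoSquare H.mBar H.mSq H.m H.m := TwoSquare.mk _ _ _ _ H.hopfSquareIso.hom
  have hαβ : D.heisenbergSquare F = α.vComp β := by
    apply NatTrans.ext
    funext X
    have h : (α.vComp β).natTrans.app X =
        H.m.map ((D.boxSquare F).natTrans.app X) ≫ H.hopfSquareIso.hom.app _ := by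
      simp [TwoSquare.vComp, α, β]
    refine Eq.trans ?_ h.symm
    refine Eq.trans ?_ (congrArg (· ≫ H.hopfSquareIso.hom.app _) (H.m.map_comp
      (H.box.map (X := (F, H.m.obj X)) (Y := (H.m.obj (D.Δl.obj F), H.m.obj X))
        (D.adjΔl.unit.app F, 𝟙 _)) (H.boxBarIso.hom.app (D.Δl.obj F, X)))).symm
    exact (Category.assoc _ _ _).symm
  have h1 : IsIso (mateEquiv (D.adjjr₂ (D.Δl.obj F)) (D.adjjr F) α).natTrans := D.isIso_boxMate F
  -- The square is Cartesian: the two maps from the four-element set are the projections of a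
  -- product of two two-element sets.
  have h2 : IsIso (mateEquiv D.adjΔrSq D.adjΔr β).natTrans :=
    H.beckChevalley (![0, 1, 0, 1] : Fin 4 → Fin 2) (![0, 0, 1, 1] : Fin 4 → Fin 2)
      (fun _ => (0 : Fin 1)) (fun _ => (0 : Fin 1)) rfl (by unfold ExistsUnique; decide) D.ΔrSq D.Δr D.adjΔrSq D.adjΔr
  have h3 := mateEquiv_hcomp (D.adjjr₂ (D.Δl.obj F)) (D.adjjr F) D.adjΔrSq D.adjΔr α β
  have h4 : D.heisenbergMate F = (mateEquiv ((D.adjjr₂ (D.Δl.obj F)).comp D.adjΔrSq)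
      ((D.adjjr F).comp D.adjΔr) (α.vComp β)).natTrans := by
    rw [← hαβ]
    rfl
  suffices h : IsIso ((mateEquiv D.adjΔrSq D.adjΔr β).hComp
      (mateEquiv (D.adjjr₂ (D.Δl.obj F)) (D.adjjr F) α)).natTrans by
    rw [h4, h3]
    exact h
  rw [NatTrans.isIso_iff_isIso_app]
  intro Z
  have h5 := (NatTrans.isIso_iff_isIso_app _).1 h1
  have h6 := (NatTrans.isIso_iff_isIso_app _).1 h2
  have h7 : ((mateEquiv D.adjΔrSq D.adjΔr β).hComp
      (mateEquiv (D.adjjr₂ (D.Δl.obj F)) (D.adjjr F) α)).natTrans.app Z =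
      (mateEquiv (D.adjjr₂ (D.Δl.obj F)) (D.adjjr F) α).natTrans.app (D.ΔrSq.obj Z) ≫
        (D.jr F).map ((mateEquiv D.adjΔrSq D.adjΔr β).natTrans.app Z) := by
    simp [TwoSquare.hComp]
  rw [h7]
  have := h5 (D.ΔrSq.obj Z)
  have := h6 Z
  infer_instance

end Adjoints

end SSHCategory

/-! ### Naturality of the associativity isomorphisms -/


/-- A morphism of triples. -/
def tripleHom {C : Type u} [Category.{v} C] {F F' G G' X X' : C} (f : F ⟶ F') (g : G ⟶ G')
    (x : X ⟶ X') : (![F, G, X] : Fin 3 → C) ⟶ ![F', G', X'] := fun i => match i with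
  | 0 => f
  | 1 => g
  | 2 => x

section

variable {C D : Type*} [Category* C] [Category* D] {X X' Y Y' Z Z' : C}

/-- The associativity isomorphisms are long composites of structure isomorphisms. Their naturality
is pasted from single squares by means of this lemma and the next two. -/
theorem comp_natural {p : X ⟶ Y} {q : Y ⟶ Z} {p' : X' ⟶ Y'} {q' : Y' ⟶ Z'} {f : X ⟶ X'}
    {g : Y ⟶ Y'} {h : Z ⟶ Z'} (h₁ : f ≫ p' = p ≫ g) (h₂ : g ≫ q' = q ≫ h) :
    f ≫ p' ≫ q' = (p ≫ q) ≫ h := by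
  rw [← Category.assoc, h₁, Category.assoc, h₂, Category.assoc]

theorem inv_natural {p : X ≅ Y} {p' : X' ≅ Y'} {f : X ⟶ X'} {g : Y ⟶ Y'}
    (h : f ≫ p'.hom = p.hom ≫ g) : g ≫ p'.inv = p.inv ≫ f := by
  rw [Iso.comp_inv_eq, Category.assoc, h, Iso.inv_hom_id_assoc]

theorem map_natural (F : C ⥤ D) {p : X ⟶ Y} {p' : X' ⟶ Y'} {f : X ⟶ X'} {g : Y ⟶ Y'}
    (h : f ≫ p' = p ≫ g) : F.map f ≫ F.map p' = F.map p ≫ F.map g := by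
  rw [← F.map_comp, h, F.map_comp]

end

/-- The horizontal composite is split into two whiskerings, each of which is compatible with
conjugation; the order of the factors is reversed because right adjoints compose in the opposite
order. -/
theorem conjugateEquiv_hcomp {A B C : Type*} [Category* A] [Category* B] [Category* C]
    {L L' : A ⥤ B} {R R' : B ⥤ A} {M M' : B ⥤ C} {S S' : C ⥤ B} (adj : L ⊣ R) (adj' : L' ⊣ R')
    (adjM : M ⊣ S) (adjM' : M' ⊣ S') (a : L ⟶ L') (b : M ⟶ M') :
    conjugateEquiv (adj'.comp adjM') (adj.comp adjM) (a ◫ b) =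
      conjugateEquiv adjM' adjM b ◫ conjugateEquiv adj' adj a := by
  have h : a ◫ b = Functor.whiskerLeft L b ≫ Functor.whiskerRight a M' := by ext; simp
  rw [h, ← conjugateEquiv_comp _ (adj.comp adjM'), conjugateEquiv_whiskerLeft,
    conjugateEquiv_whiskerRight]
  ext X
  simp

namespace PseudoMultifunctor

variable {obj : ∀ (S : Type) [Finite S], Type u} [∀ (S : Type) [Finite S], Category.{v} (obj S)]
  (P : PseudoMultifunctor.{u, v} obj)

/-- The functoriality of the tensor product of a family. -/
def bigTensorMap {S I : Type} [Finite S] [Finite I] {Z Z' : I → obj S} (f : ∀ i, Z i ⟶ Z' i) :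
    P.bigTensor Z ⟶ P.bigTensor Z' :=
  (P.map (I := I) (S := fun _ => S) (fun _ => id)).map f

theorem bigTensorOne_naturality {S I : Type} [Finite S] [Finite I] (e : Unit ≃ I)
    {Z Z' : I → obj S} (f : ∀ i, Z i ⟶ Z' i) :
    P.bigTensorMap f ≫ (P.bigTensorOne e Z').hom = (P.bigTensorOne e Z).hom ≫ f (e ()) :=
  comp_natural ((P.reindexIso e (S := fun _ => S) (fun _ => id)).inv.naturality f)
    ((P.unitIso S).hom.naturality (X := fun i => Z (e i)) (Y := fun i => Z' (e i))
      (fun i => f (e i)))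

theorem bigTensorTwo_naturality {S I : Type} [Finite S] [Finite I] (e : Fin 2 ≃ I)
    {Z Z' : I → obj S} (f : ∀ i, Z i ⟶ Z' i) :
    P.bigTensorMap f ≫ (P.bigTensorTwo e Z').hom = (P.bigTensorTwo e Z).hom ≫
      (P.tensor S).map (X := (Z (e 0), Z (e 1))) (Y := (Z' (e 0), Z' (e 1)))
        (f (e 0), f (e 1)) := by
  refine comp_natural ((P.reindexIso e (S := fun _ => S) (fun _ => id)).inv.naturality f)
    (map_natural (P.map (I := Fin 2) (S := fun _ => S) (T := S) (fun _ => id)) ?_)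
  funext i
  match i with
  | 0 => exact (Category.comp_id _).trans (Category.id_comp _).symm
  | 1 => exact (Category.comp_id _).trans (Category.id_comp _).symm

theorem bigTensorFibres_naturality {S I J : Type} [Finite S] [Finite I] [Finite J] (p : I → J)
    {Z Z' : I → obj S} (f : ∀ i, Z i ⟶ Z' i) :
    P.bigTensorMap (fun j : J => P.bigTensorMap (fun i : {i // p i = j} => f i.1)) ≫
      (P.bigTensorFibres p Z').hom = (P.bigTensorFibres p Z).hom ≫ P.bigTensorMap f :=
  comp_natural ((P.compIso (J := J) (I := fun j => {i // p i = j}) (S := fun _ _ => S)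
    (T := fun _ => S) (fun _ _ => id) (fun _ => id)).hom.naturality (X := fun _ i => Z i.1)
      (Y := fun _ i => Z' i.1) (fun _ i => f i.1))
    ((P.reindexIso (Equiv.sigmaFiberEquiv p) (S := fun _ => S) (fun _ => id)).hom.naturality f)

theorem tensorRight_naturality {S : Type} [Finite S] {F F' G G' X X' : obj S} (f : F ⟶ F')
    (g : G ⟶ G') (x : X ⟶ X') :
    (P.tensor S).map (X := (F, (P.tensor S).obj (G, X))) (Y := (F', (P.tensor S).obj (G', X')))
      (f, (P.tensor S).map (X := (G, X)) (Y := (G', X')) (g, x)) ≫ (P.tensorRight F' G' X').hom =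
    (P.tensorRight F G X).hom ≫ P.bigTensorMap (tripleHom f g x) := by
  refine comp_natural (map_natural (P.map (I := Fin 2) (S := fun _ => S) (T := S) (fun _ => id)) ?_)
    (P.bigTensorFibres_naturality (![0, 1, 1] : Fin 3 → Fin 2) (tripleHom f g x))
  funext i
  match i with
  | 0 => exact inv_natural (P.bigTensorOne_naturality fibre011zero
        (fun i : {i : Fin 3 // (![0, 1, 1] : Fin 3 → Fin 2) i = 0} => tripleHom f g x i.1))
  | 1 => exact inv_natural (P.bigTensorTwo_naturality fibre011one
        (fun i : {i : Fin 3 // (![0, 1, 1] : Fin 3 → Fin 2) i = 1} => tripleHom f g x i.1))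

theorem tensorLeft_naturality {S : Type} [Finite S] {F F' G G' X X' : obj S} (f : F ⟶ F')
    (g : G ⟶ G') (x : X ⟶ X') :
    (P.tensor S).map (X := ((P.tensor S).obj (F, G), X)) (Y := ((P.tensor S).obj (F', G'), X'))
      ((P.tensor S).map (X := (F, G)) (Y := (F', G')) (f, g), x) ≫ (P.tensorLeft F' G' X').hom =
    (P.tensorLeft F G X).hom ≫ P.bigTensorMap (tripleHom f g x) := by
  refine comp_natural (map_natural (P.map (I := Fin 2) (S := fun _ => S) (T := S) (fun _ => id)) ?_)
    (P.bigTensorFibres_naturality (![0, 0, 1] : Fin 3 → Fin 2) (tripleHom f g x))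
  funext i
  match i with
  | 0 => exact inv_natural (P.bigTensorTwo_naturality fibre001zero
        (fun i : {i : Fin 3 // (![0, 0, 1] : Fin 3 → Fin 2) i = 0} => tripleHom f g x i.1))
  | 1 => exact inv_natural (P.bigTensorOne_naturality fibre001one
        (fun i : {i : Fin 3 // (![0, 0, 1] : Fin 3 → Fin 2) i = 1} => tripleHom f g x i.1))

end PseudoMultifunctor

namespace SSHCategory

variable {k : Type v} [Field k] (H : SSHCategory.{u, v} k)

theorem mulMulIso_naturality {F F' G G' X X' : H.C₁} (f : F ⟶ F') (g : G ⟶ G') (x : X ⟶ X') :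
    (H.box ⋙ H.m).map (X := (F, (H.mul.obj G).obj X)) (Y := (F', (H.mul.obj G').obj X'))
      (f, (H.box ⋙ H.m).map (X := (G, X)) (Y := (G', X')) (g, x)) ≫ (H.mulMulIso F' G' X').hom =
    (H.mulMulIso F G X).hom ≫ (H.box ⋙ H.m).map (X := (H.tensor.obj (F, G), X))
      (Y := (H.tensor.obj (F', G'), X'))
      (H.tensor.map (X := (F, G)) (Y := (F', G')) (f, g), x) := by
  refine comp_natural (H.boxMulIso.hom.naturality (X := (F, (H.mul.obj G).obj X))
    (Y := (F', (H.mul.obj G').obj X'))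
    (f, (H.box ⋙ H.m).map (X := (G, X)) (Y := (G', X')) (g, x))) ?_
  refine comp_natural (g := H.tensor.map (X := (F, H.tensor.obj (G, X)))
    (Y := (F', H.tensor.obj (G', X'))) (f, H.tensor.map (X := (G, X)) (Y := (G', X')) (g, x)))
    (map_natural H.tensor ?_) ?_
  · refine Prod.ext ((Category.comp_id _).trans (Category.id_comp _).symm) ?_
    exact H.boxMulIso.hom.naturality (X := (G, X)) (Y := (G', X')) (g, x)
  · refine comp_natural (H.functor.tensorRight_naturality f g x) ?_
    refine comp_natural (inv_natural (H.functor.tensorLeft_naturality f g x)) ?_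
    exact H.boxMulIso.inv.naturality (X := (H.tensor.obj (F, G), X))
      (Y := (H.tensor.obj (F', G'), X')) (H.tensor.map (X := (F, G)) (Y := (F', G')) (f, g), x)

/-- The isomorphism `m_F m_G ≅ m_{F ⊗ G}`. -/
def mulComp (F G : H.C₁) : H.mul.obj G ⋙ H.mul.obj F ≅ H.mul.obj (H.tensor.obj (F, G)) :=
  NatIso.ofComponents (fun X => H.mulMulIso F G X) (fun {X X'} x => by
    refine Eq.trans (H.mulMulIso_naturality (𝟙 F) (𝟙 G) x) ?_
    congr 2
    exact congrArg (fun t => (t, x)) (H.tensor.map_id (F, G)))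

theorem mulComp_app (F G X : H.C₁) : (H.mulComp F G).app X = H.mulMulIso F G X := rfl

theorem mulComp_naturality {F F' G G' : H.C₁} (f : F ⟶ F') (g : G ⟶ G') :
    (H.mul.map g ◫ H.mul.map f) ≫ (H.mulComp F' G').hom =
      (H.mulComp F G).hom ≫ H.mul.map (H.tensor.map (X := (F, G)) (Y := (F', G')) (f, g)) := by
  ext X
  refine Eq.trans ?_ (H.mulMulIso_naturality f g (𝟙 X))
  refine congrArg (· ≫ (H.mulMulIso F' G' X).hom) ?_
  refine ((H.box ⋙ H.m).map_comp (X := (F, (H.mul.obj G).obj X)) (Y := (F', (H.mul.obj G).obj X))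
    (Z := (F', (H.mul.obj G').obj X)) (f, 𝟙 _)
    (𝟙 F', (H.box ⋙ H.m).map (X := (G, X)) (Y := (G', X)) (g, 𝟙 X))).symm.trans ?_
  exact congrArg _ (Prod.ext (Category.comp_id _) (Category.id_comp _))

namespace Adjoints

variable {H} (D : H.Adjoints)

/-- The isomorphism `Δʳ_G Δʳ_F ≅ Δʳ_{F ⊗ G}`. -/
def ΔComp (F G : H.C₁) : D.Δ F ⋙ D.Δ G ≅ D.Δ (H.tensor.obj (F, G)) :=
  conjugateIsoEquiv ((D.adj G).comp (D.adj F)) (D.adj (H.tensor.obj (F, G))) (H.mulComp F G).symm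

/-- This is the conjugate of `mulComp_naturality`. Conjugation is contravariant, so the inverses of
the isomorphisms `mulComp` enter. -/
theorem ΔComp_naturality {F F' G G' : H.C₁} (f : F ⟶ F') (g : G ⟶ G') :
    (D.Δfunctor.map f.op ◫ D.Δfunctor.map g.op) ≫ (D.ΔComp F G).hom =
      (D.ΔComp F' G').hom ≫
        D.Δfunctor.map (H.tensor.map (X := (F, G)) (Y := (F', G')) (f, g)).op := by
  have h1 : D.Δfunctor.map f.op ◫ D.Δfunctor.map g.op =
      conjugateEquiv ((D.adj G').comp (D.adj F')) ((D.adj G).comp (D.adj F))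
        (H.mul.map g ◫ H.mul.map f) := by
    exact (conjugateEquiv_hcomp _ _ _ _ _ _).symm
  rw [h1]
  refine (conjugateEquiv_comp _ _ _ _ _).trans (Eq.trans ?_ (conjugateEquiv_comp _ _ _ _ _).symm)
  refine congrArg _ ?_
  change (H.mulComp F G).inv ≫ _ = H.mul.map _ ≫ (H.mulComp F' G').inv
  rw [Iso.inv_comp_eq, ← Category.assoc, Iso.eq_comp_inv]
  exact H.mulComp_naturality f g

end Adjoints

end SSHCategory

/-! ### Duality and the existence of `𝒞 ⊗ 𝒞ᵒᵖ` -/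

section Multiplicities

variable {k : Type v} [Field k] {C D : GrTwoVect.{u, v} k} {J : Type} {S : J → C} {S' : J → D}

/-- The functor of multiplicity spaces `X ↦ (Hom(S_j, X))_j`. -/
def multFunctor (S : J → C) : C ⥤ (J → FGModuleCat.{v} k) := Functor.pi' fun j => homVect (S j)

theorem SemisimpleFamily.map_multFunctor_bijective (hS : SemisimpleFamily k S) (X Y : C) :
    Function.Bijective ((multFunctor S).map (X := X) (Y := Y)) := by
  have h := hS.restrict_bijective (𝟭 C) X Y
  constructor
  · intro f g hfg
    apply h.1
    funext j
    exact congrArg (fun t : (multFunctor S).obj X ⟶ (multFunctor S).obj Y => (t j).hom.hom) hfg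
  · intro t
    obtain ⟨g, hg⟩ := h.2 (fun j => (t j).hom.hom)
    refine ⟨g, ?_⟩
    funext j
    apply FGModuleCat.hom_ext
    exact congrFun hg j

theorem SemisimpleFamily.multFunctor_faithful (hS : SemisimpleFamily k S) :
    (multFunctor S).Faithful := ⟨fun {X Y} _ _ h => (hS.map_multFunctor_bijective X Y).1 h⟩

theorem SemisimpleFamily.multFunctor_full (hS : SemisimpleFamily k S) :
    (multFunctor S).Full := ⟨fun {X Y} => (hS.map_multFunctor_bijective X Y).2⟩

theorem SemisimpleFamily.multFunctor_mem_essImage (hS : SemisimpleFamily k S)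
    (hS' : SemisimpleFamily k S') (X : C) : (multFunctor S').essImage ((multFunctor S).obj X) := by
  obtain ⟨Y, hY⟩ := hS'.exists_multiplicities (hS.basis.repr (K₀.mk X) |>.mapRange Int.toNat rfl)
  refine ⟨Y, ⟨Pi.isoMk fun j => (LinearEquiv.ofFinrankEq (R := k) (S' j ⟶ Y) (S j ⟶ X)
    ?_).toFGModuleCatIso⟩⟩
  rw [hY, Finsupp.mapRange_apply, hS.basis_repr, homForm_mk, Int.toNat_natCast]

/-- The multiplicity functors of both categories are fully faithful with the same essential image,
the families of finite dimensional spaces that occur as multiplicity spaces. Hence a common index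
set of simple objects determines the category up to equivalence. -/
theorem SemisimpleFamily.exists_equivalence (hS : SemisimpleFamily k S)
    (hS' : SemisimpleFamily k S') : ∃ e : C ≌ D, e.functor.Additive ∧ e.functor.Linear k ∧
      Nonempty (e.functor ⋙ multFunctor S' ≅ multFunctor S) := by
  have := hS.multFunctor_faithful
  have := hS.multFunctor_full
  have := hS'.multFunctor_faithful
  have := hS'.multFunctor_full
  let E : C ⥤ D := Functor.essImage.liftFunctor (multFunctor S) (multFunctor S')
    (hS.multFunctor_mem_essImage hS')
  let θ : E ⋙ multFunctor S' ≅ multFunctor S := Functor.essImage.liftFunctorCompIso _ _ _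
  have : E.Faithful := by
    have : (E ⋙ multFunctor S').Faithful := Functor.Faithful.of_iso θ.symm
    exact Functor.Faithful.of_comp E (multFunctor S')
  have : E.Full := by
    have : (E ⋙ multFunctor S').Full := Functor.Full.of_iso θ.symm
    exact Functor.Full.of_comp_faithful E (multFunctor S')
  have : E.EssSurj := ⟨fun Y => by
    obtain ⟨X, ⟨φ⟩⟩ := hS'.multFunctor_mem_essImage hS Y
    exact ⟨X, ⟨(multFunctor S').preimageIso (θ.app X ≪≫ φ)⟩⟩⟩
  have : E.IsEquivalence := {}
  -- This formula expresses E through functors Hom(S j, -), which are known to be linear, and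
  -- additivity and linearity of E are read off from it.
  obtain ⟨a, b, hmap⟩ : ∃ (a : ∀ X j, (homVect (S' j)).obj (E.obj X) ⟶ (homVect (S j)).obj X)
      (b : ∀ X j, (homVect (S j)).obj X ⟶ (homVect (S' j)).obj (E.obj X)),
      ∀ {X Y : C} (f : X ⟶ Y) (j : J), (homVect (S' j)).map (E.map f) =
        a X j ≫ (homVect (S j)).map f ≫ b Y j := by
    refine ⟨fun X j => θ.hom.app X j, fun X j => θ.inv.app X j, fun {X Y} f j => ?_⟩
    have h1 := congrArg (· ≫ θ.inv.app Y) (θ.hom.naturality f)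
    simp only [Category.assoc, Iso.hom_inv_id_app, Category.comp_id] at h1
    exact congrFun h1 j
  refine ⟨E.asEquivalence, ⟨?_⟩, ⟨?_⟩, ⟨θ⟩⟩
  · intro X Y f g
    apply (multFunctor S').map_injective
    funext j
    have hadd := fun Z : D => (isVectMor_homVect Z).additive
    have hadd' := fun Z : C => (isVectMor_homVect Z).additive
    refine (hmap (f + g) j).trans ?_
    refine Eq.trans ?_ ((homVect (S' j)).map_add).symm
    refine Eq.trans ?_ (congrArg₂ (· + ·) (hmap f j) (hmap g j)).symm
    rw [(homVect (S j)).map_add, Preadditive.add_comp, Preadditive.comp_add]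
  · intro X Y f r
    apply (multFunctor S').map_injective
    funext j
    have hadd := fun Z : D => (isVectMor_homVect Z).additive
    have hadd' := fun Z : C => (isVectMor_homVect Z).additive
    have hlin := fun Z : D => (isVectMor_homVect Z).linear
    have hlin' := fun Z : C => (isVectMor_homVect Z).linear
    refine (hmap (r • f) j).trans ?_
    refine Eq.trans ?_ ((homVect (S' j)).map_smul r _).symm
    refine Eq.trans ?_ (congrArg (r • ·) (hmap f j)).symm
    rw [(homVect (S j)).map_smul, Linear.smul_comp, Linear.comp_smul]

end Multiplicities

section Degrees

variable {k : Type v} [Field k] {C D : GrTwoVect.{u, v} k}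

/-- That zero objects are homogeneous is not an axiom. It follows because each graded piece is
equivalent to a sum of copies of the category of vector spaces. -/
theorem GrTwoVect.exists_isZero_deg (n : ℕ) : ∃ Z : C, C.deg n Z ∧ IsZero Z := by
  obtain ⟨r, e, he⟩ := C.isTwoVectorSpace n
  let Z := e.inverse.obj (fun _ => FGModuleCat.of k PUnit)
  refine ⟨Z.obj, Z.property, ?_⟩
  rw [IsZero.iff_id_eq_zero]
  have h : 𝟙 Z = 0 := by
    apply e.functor.map_injective
    funext i
    have := (he i).1
    refine Eq.trans ?_ ((e.functor ⋙ Pi.eval _ i).map_zero Z Z).symm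
    have hz : IsZero ((e.functor.obj Z) i) := by
      refine IsZero.of_iso ?_ (Pi.isoApp (e.counitIso.app (fun _ => FGModuleCat.of k PUnit)) i)
      exact isZero_of_forall_eq_zero fun x => Subsingleton.elim (α := PUnit) _ _
    exact hz.eq_of_src _ _
  exact congrArg (fun t : Z ⟶ Z => t.hom) h

/-- In a homogeneous decomposition all components of degree other than n vanish. Either the
component of degree n remains and is isomorphic to X, or there is none and X is a zero object. -/
theorem GrTwoVect.deg_of_hom_eq_zero {n : ℕ} {X : C}
    (h : ∀ (m : ℕ) (Y : C), C.deg m Y → m ≠ n → ∀ f : X ⟶ Y, f = 0) : C.deg n X := by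
  obtain ⟨N, Y, hY, ⟨e⟩⟩ := C.exists_decomposition X
  have hsum : ∑ i, (e.hom ≫ biproduct.π Y i) ≫ biproduct.ι Y i ≫ e.inv = 𝟙 X := by
    have h : ∑ i, e.hom ≫ (biproduct.π Y i ≫ biproduct.ι Y i) ≫ e.inv = 𝟙 X := by
      rw [← Preadditive.comp_sum, ← Preadditive.sum_comp, biproduct.total]
      simp
    simpa using h
  by_cases hn : n < N
  · rw [Finset.sum_eq_single ⟨n, hn⟩ (fun i _ hi => by
      rw [h i (Y i) (hY i) (fun hc => hi (Fin.ext hc)) (e.hom ≫ biproduct.π Y i), zero_comp])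
      (fun hc => absurd (Finset.mem_univ _) hc)] at hsum
    exact C.deg_of_iso n
      ⟨biproduct.ι Y ⟨n, hn⟩ ≫ e.inv, e.hom ≫ biproduct.π Y ⟨n, hn⟩, by simp, hsum⟩ (hY ⟨n, hn⟩)
  · rw [Finset.sum_eq_zero (fun i _ => by
      rw [h i (Y i) (hY i) (by omega) (e.hom ≫ biproduct.π Y i), zero_comp])] at hsum
    obtain ⟨Z, hZ, hZ'⟩ := C.exists_isZero_deg n
    exact C.deg_of_iso n (hZ'.iso ((IsZero.iff_id_eq_zero X).2 hsum.symm)) hZ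

/-- Homogeneity can be seen from multiplicities: a simple object of degree other than n does not
occur in X, hence not in Y. -/
theorem SemisimpleFamily.deg_of_finrank_eq {J : Type} {S : J → C} {S' : J → D}
    (hS' : SemisimpleFamily k S') {d : J → ℕ} (hd : ∀ j, C.deg (d j) (S j))
    (hd' : ∀ j, D.deg (d j) (S' j)) {X : C} {Y : D}
    (h : ∀ j, Module.finrank k (S' j ⟶ Y) = Module.finrank k (S j ⟶ X)) {n : ℕ}
    (hX : C.deg n X) : D.deg n Y := by
  apply GrTwoVect.deg_of_hom_eq_zero
  intro m Z hZ hmn f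
  have hY : ∀ j, d j ≠ n → ∀ g : S' j ⟶ Y, g = 0 := fun j hj g => by
    have : Subsingleton (S j ⟶ X) := ⟨fun a b => by
      rw [C.hom_eq_zero (hd j) hX hj a, C.hom_eq_zero (hd j) hX hj b]⟩
    have h1 := h j
    rw [Module.finrank_zero_of_subsingleton (M := S j ⟶ X)] at h1
    have := Module.finrank_zero_iff.1 h1
    exact Subsingleton.elim _ _
  apply (hS'.restrict_bijective (𝟭 D) Y Z).1
  funext j
  apply LinearMap.ext
  intro g
  change g ≫ f = g ≫ 0
  by_cases hj : d j = n
  · rw [D.hom_eq_zero (hd' j) hZ (by rw [hj]; exact Ne.symm hmn) (g ≫ f), comp_zero]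
  · rw [hY j hj g, zero_comp, zero_comp]

/-- The simple objects of the opposite category are those of C, with the same index set and degrees,
so `exists_equivalence` applies. The equivalence reduces the existence of 𝒞 ⊗ 𝒞ᵒᵖ to that of 𝒞 ⊗ 𝒞.
-/
theorem GrTwoVect.exists_dual (C : GrTwoVect.{u, v} k) : ∃ e : C ≌ C.op,
    e.functor.Additive ∧ e.functor.Linear k ∧ (∀ n X, C.deg n X → C.op.deg n (e.functor.obj X)) ∧
      ∀ n Y, C.op.deg n Y → C.deg n (e.inverse.obj Y) := by
  have hS := C.semisimpleFamily
  obtain ⟨S', hS', hd'⟩ : ∃ S' : C.Irr → C.op,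
      SemisimpleFamily k S' ∧ ∀ j, C.op.deg (C.irrDeg j) (S' j) :=
    ⟨_, C.semisimpleFamily_op, C.deg_simpleObj⟩
  obtain ⟨e, hadd, hlin, ⟨θ⟩⟩ := hS.exists_equivalence hS'
  have hfin : ∀ X j, Module.finrank k (S' j ⟶ e.functor.obj X) =
      Module.finrank k (C.simpleObj j ⟶ X) := fun X j =>
    (FGModuleCat.isoToLinearEquiv (Pi.isoApp (θ.app X) j)).finrank_eq
  refine ⟨e, hadd, hlin, fun n X hX => hS'.deg_of_finrank_eq C.deg_simpleObj hd' (hfin X) hX,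
    fun n Y hY => hS.deg_of_finrank_eq hd' C.deg_simpleObj (fun j => ?_) hY⟩
  rw [← hfin]
  exact (FGModuleCat.isoToLinearEquiv ((homVect (S' j)).mapIso (e.counitIso.app Y))).finrank_eq

end Degrees

section Transport

variable {k : Type v} [Field k] {I : Type} [Finite I] {C C' : I → GrTwoVect.{u, v} k}
  {D : GrTwoVect.{u, v} k}

theorem IsMultiExact.pi_comp {M : (∀ i, C' i) ⥤ D} (hM : IsMultiExact M)
    (F : ∀ i, C i ⥤ C' i) [∀ i, (F i).Additive] [∀ i, (F i).Linear k]
    (hF : ∀ i n X, (C i).deg n X → (C' i).deg n ((F i).obj X)) :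
    IsMultiExact (C := C) (Functor.pi F ⋙ M) where
  multilinear X Y := by
    obtain ⟨L, hL⟩ := hM.multilinear ((Functor.pi F).obj X) ((Functor.pi F).obj Y)
    exact ⟨L.compLinearMap fun i => (F i).mapLinearMap k, fun f => hL ((Functor.pi F).map f)⟩
  bounded := by
    obtain ⟨N, hN⟩ := hM.bounded
    exact ⟨N, fun n m X Y hX hY h f => hN n m ((Functor.pi F).obj X) Y
      (fun i => hF i _ _ (hX i)) hY h f⟩

theorem IsDeligneTensor.pi_comp {B : (∀ i, C' i) ⥤ D} (hB : IsDeligneTensor B)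
    (e : ∀ i, C i ≌ C' i) [∀ i, (e i).functor.Additive] [∀ i, (e i).functor.Linear k]
    (he : ∀ i n X, (C i).deg n X → (C' i).deg n ((e i).functor.obj X))
    (he' : ∀ i n Y, (C' i).deg n Y → (C i).deg n ((e i).inverse.obj Y)) :
    IsDeligneTensor (C := C) ((Equivalence.pi e).functor ⋙ B) where
  isMultiExact := hB.isMultiExact.pi_comp (fun i => (e i).functor) he
  essSurj E M hM := by
    obtain ⟨G, hG, ⟨φ⟩⟩ := hB.essSurj E _ (hM.pi_comp (fun i => (e i).inverse) he')
    exact ⟨G, hG, ⟨Functor.isoWhiskerLeft (Equivalence.pi e).functor φ ≪≫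
      Functor.isoWhiskerRight (Equivalence.pi e).unitIso.symm M ≪≫ M.leftUnitor⟩⟩
  fullyFaithful E G G' hG hG' := by
    have h := hB.fullyFaithful E G G' hG hG'
    have h' : Function.Bijective (fun τ : B ⋙ G ⟶ B ⋙ G' =>
        Functor.whiskerLeft (Equivalence.pi e).functor τ) :=
      (Functor.FullyFaithful.ofFullyFaithful ((Functor.whiskeringLeft _ _ E.carrier).obj
        (Equivalence.pi e).functor)).map_bijective _ _
    exact h'.comp h

end Transport

theorem SSHCategory.exists_isDeligneTensor_op {k : Type v} [Field k] (H : SSHCategory.{u, v} k) :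
    ∃ (T : GrTwoVect.{u, v} k) (B : (∀ i : Fin 2, (![H.C₁, H.C₁.op] i).carrier) ⥤ T),
      IsDeligneTensor (C := ![H.C₁, H.C₁.op]) B := by
  obtain ⟨e, hadd, hlin, hdeg, hdeg'⟩ := H.C₁.exists_dual
  let E : ∀ i : Fin 2, (![H.C₁, H.C₁.op] i).carrier ≌ H.C₁.carrier := fun i => match i with
    | 0 => CategoryTheory.Equivalence.refl
    | 1 => e.symm
  have : ∀ i, (E i).functor.Additive := fun i => match i with
    | 0 => inferInstanceAs (𝟭 H.C₁).Additive
    | 1 => inferInstanceAs e.inverse.Additive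
  have : ∀ i, (E i).functor.Linear k := fun i => match i with
    | 0 => inferInstanceAs ((𝟭 H.C₁).Linear k)
    | 1 => inferInstanceAs (e.inverse.Linear k)
  exact ⟨H.C₂, _, H.isDeligneTensor_box.pi_comp (C := ![H.C₁, H.C₁.op]) E
    (fun i => match i with
      | 0 => fun n X h => h
      | 1 => hdeg')
    (fun i => match i with
      | 0 => fun n X h => h
      | 1 => hdeg)⟩

/-! ### The functor `𝒞 ⊗ 𝒞ᵒᵖ ⥤ End_ad(𝒞)` -/

section TwoVectMor

variable {k : Type v} [Field k] {C D E : GrTwoVect.{u, v} k}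

theorem IsTwoVectMor.comp {F : C ⥤ D} {G : D ⥤ E} (hF : IsTwoVectMor F) (hG : IsTwoVectMor G) :
    IsTwoVectMor (F ⋙ G) where
  additive := by
    have := hF.additive
    have := hG.additive
    infer_instance
  linear := by
    have := hF.linear
    have := hG.linear
    infer_instance
  bounded := by
    have := hG.additive
    obtain ⟨N, hN⟩ := hF.bounded
    obtain ⟨N', hN'⟩ := hG.bounded
    refine ⟨N + N', fun n m X Y hX hY hnm f => ?_⟩
    obtain ⟨M, Z, ι, π, hZ, h⟩ := GrTwoVect.exists_homogeneous (F.obj X)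
    have h1 : 𝟙 (G.obj (F.obj X)) = ∑ i, G.map (π i) ≫ G.map (ι i) := by
      rw [← G.map_id, ← h, G.map_sum]
      exact Finset.sum_congr rfl fun i _ => G.map_comp _ _
    change G.obj (F.obj X) ⟶ Y at f
    rw [← Category.id_comp f, h1, Preadditive.sum_comp]
    refine Finset.sum_eq_zero fun i _ => ?_
    by_cases hi : (i : ℕ) + N < n ∨ n + N < i
    · rw [hN n i X (Z i) hX (hZ i) hi (π i), G.map_zero, zero_comp, zero_comp]
    · rw [Category.assoc, hN' i m (Z i) Y (hZ i) hY (by omega) (G.map (ι i) ≫ f), comp_zero]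

/-- For the bound, Hom(R X, Y) vanishes together with Hom(Y, R X) = Hom(L Y, X), so the constant for
L works for R. -/
theorem IsTwoVectMor.of_rightAdjoint {L : C ⥤ D} {R : D ⥤ C} (hL : IsTwoVectMor L) (adj : L ⊣ R) :
    IsTwoVectMor R where
  additive := by
    have := hL.additive
    exact adj.right_adjoint_additive
  linear := by
    have := hL.additive
    have := hL.linear
    exact _root_.Adjunction.linear_right k adj
  bounded := by
    have := hL.additive
    obtain ⟨N, hN⟩ := hL.bounded
    refine ⟨N, fun n m X Y hX hY hnm f => GrTwoVect.hom_eq_zero_comm (fun g => ?_) f⟩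
    apply (adj.homEquiv Y X).symm.injective
    rw [hN m n Y X hY hX (by omega) ((adj.homEquiv Y X).symm g),
      hN m n Y X hY hX (by omega) ((adj.homEquiv Y X).symm 0)]

theorem IsTwoVectMor.of_iso {F G : C ⥤ D} (hF : IsTwoVectMor F) (e : F ≅ G) : IsTwoVectMor G where
  additive := by
    have := hF.additive
    exact Functor.additive_of_iso e
  linear := by
    have := hF.linear
    exact Functor.linear_of_iso k e
  bounded := by
    obtain ⟨N, hN⟩ := hF.bounded
    refine ⟨N, fun n m X Y hX hY hnm f => ?_⟩
    rw [← cancel_epi (e.hom.app X), hN n m X Y hX hY hnm (e.hom.app X ≫ f), comp_zero]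

/-- A finite direct sum of 1-morphisms is a 1-morphism. -/
theorem IsTwoVectMor.of_total {α : Type} [Fintype α] {P : C ⥤ D} {Q : α → (C ⥤ D)}
    (ι : ∀ a, Q a ⟶ P) (π : ∀ a, P ⟶ Q a) (h : ∑ a, π a ≫ ι a = 𝟙 P)
    (hQ : ∀ a, IsTwoVectMor (Q a)) : IsTwoVectMor P := by
  have h1 : ∀ X, 𝟙 (P.obj X) = ∑ a, (π a).app X ≫ (ι a).app X := fun X => by
    have := congrArg (fun t : P ⟶ P => t.app X) h
    rw [NatTrans.app_sum] at this
    exact this.symm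
  have hmap : ∀ {X Y : C} (f : X ⟶ Y), P.map f = ∑ a, (π a).app X ≫ (Q a).map f ≫ (ι a).app Y := by
    intro X Y f
    rw [← Category.id_comp (P.map f), h1, Preadditive.sum_comp]
    exact Finset.sum_congr rfl fun a _ => by rw [Category.assoc, (ι a).naturality]
  refine ⟨⟨fun {X Y f g} => ?_⟩, ⟨fun {X Y} f r => ?_⟩, ?_⟩
  · rw [hmap, hmap, hmap, ← Finset.sum_add_distrib]
    refine Finset.sum_congr rfl fun a _ => ?_
    have := (hQ a).additive
    rw [(Q a).map_add, Preadditive.add_comp, Preadditive.comp_add]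
  · rw [hmap, hmap, Finset.smul_sum]
    refine Finset.sum_congr rfl fun a _ => ?_
    have := (hQ a).linear
    rw [(Q a).map_smul, Linear.smul_comp, Linear.comp_smul]
  · choose N hN using fun a => (hQ a).bounded
    refine ⟨∑ a, N a, fun n m X Y hX hY hnm f => ?_⟩
    rw [← Category.id_comp f, h1, Preadditive.sum_comp]
    refine Finset.sum_eq_zero fun a _ => ?_
    have : N a ≤ ∑ a, N a := Finset.single_le_sum (fun _ _ => Nat.zero_le _) (Finset.mem_univ a)
    rw [Category.assoc, hN a n m X Y hX hY (by omega) ((ι a).app X ≫ f), comp_zero]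

end TwoVectMor

section Families

variable {k : Type v} [Field k]

theorem IsBilinearFunctor.multilinear {C : Fin 2 → GrTwoVect.{u, v} k} {D : GrTwoVect.{u, v} k}
    {N : C 0 × C 1 ⥤ D} (hN : IsBilinearFunctor N) (X Y : ∀ i, C i) :
    ∃ L : MultilinearMap k (fun i => X i ⟶ Y i) (((Pi.eval (fun i => (C i).carrier) 0).prod'
      (Pi.eval (fun i => (C i).carrier) 1) ⋙ N).obj X ⟶ ((Pi.eval (fun i => (C i).carrier) 0).prod'
      (Pi.eval (fun i => (C i).carrier) 1) ⋙ N).obj Y),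
      ∀ f : X ⟶ Y, ((Pi.eval (fun i => (C i).carrier) 0).prod'
        (Pi.eval (fun i => (C i).carrier) 1) ⋙ N).map f = L (fun i => f i) := by
  have h01 : (0 : Fin 2) ≠ 1 := by decide
  refine ⟨{
    toFun := fun f => N.map (X := (X 0, X 1)) (Y := (Y 0, Y 1)) (f 0, f 1)
    map_update_add' := ?_
    map_update_smul' := ?_ }, fun f => rfl⟩
  · intro _ f i x y
    match i with
    | 0 =>
      simp only [Function.update_self, Function.update_of_ne h01.symm]
      exact hN.add_left _ _ _
    | 1 =>
      simp only [Function.update_self, Function.update_of_ne h01]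
      exact hN.add_right _ _ _
  · intro _ f i r x
    match i with
    | 0 =>
      simp only [Function.update_self, Function.update_of_ne h01.symm]
      exact hN.smul_left _ _ _
    | 1 =>
      simp only [Function.update_self, Function.update_of_ne h01]
      exact hN.smul_right _ _ _

variable {I : Type} [Finite I] {C : I → GrTwoVect.{u, v} k} {T E : GrTwoVect.{u, v} k}
  {B : (∀ i, C i) ⥤ T}

/-- The universal property of the Deligne tensor product, with parameters. -/
theorem IsDeligneTensor.exists_functor (hB : IsDeligneTensor B) {A : Type*} [Category* A]
    (W : (∀ i, C i) ⥤ A ⥤ E) (hW : ∀ X, IsMultiExact (W ⋙ (evaluation A E).obj X)) :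
    ∃ Γ : T ⥤ A ⥤ E, (∀ X, IsTwoVectMor (Γ ⋙ (evaluation A E).obj X)) ∧
      Nonempty (B ⋙ Γ ≅ W) := by
  choose G hG φ using fun X => hB.essSurj E _ (hW X)
  replace φ := fun X => (φ X).some
  have hff := fun X Y => hB.fullyFaithful E (G X) (G Y) (hG X) (hG Y)
  let w : ∀ {X Y : A} (x : X ⟶ Y), W ⋙ (evaluation A E).obj X ⟶ W ⋙ (evaluation A E).obj Y :=
    fun x => Functor.whiskerLeft W ((evaluation A E).map x)
  choose g hg using fun (X Y : A) (x : X ⟶ Y) => (hff X Y).2 ((φ X).hom ≫ w x ≫ (φ Y).inv)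
  replace hg : ∀ {X Y : A} (x : X ⟶ Y), Functor.whiskerLeft B (g X Y x) =
    (φ X).hom ≫ w x ≫ (φ Y).inv := fun {X Y} x => hg X Y x
  -- Each X gives its own extension `G X`. Uniqueness of extensions of transformations makes X ↦ `G
  -- X` functorial, and exchanging the variables gives the functor on T.
  let Γ' : A ⥤ T ⥤ E :=
    { obj := G
      map := fun {X Y} x => g X Y x
      map_id := fun X => (hff X X).1 (by
        change Functor.whiskerLeft B (g X X (𝟙 X)) = Functor.whiskerLeft B (𝟙 (G X))
        rw [hg]
        ext t
        simp [w])
      map_comp := fun {X Y Z} x y => (hff X Z).1 (by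
        change Functor.whiskerLeft B (g X Z (x ≫ y)) =
          Functor.whiskerLeft B (g X Y x ≫ g Y Z y)
        rw [Functor.whiskerLeft_comp, hg, hg, hg]
        ext t
        simp [w]) }
  refine ⟨Γ'.flip, hG, ⟨NatIso.ofComponents (fun t => NatIso.ofComponents
    (fun X => (φ X).app t) (fun {X Y} x => ?_)) (fun {t t'} f => ?_)⟩⟩
  · have h := congrArg (fun s => NatTrans.app s t) (hg x)
    change (g X Y x).app (B.obj t) ≫ (φ Y).hom.app t = (φ X).hom.app t ≫ (W.obj t).map x
    change (g X Y x).app (B.obj t) = (φ X).hom.app t ≫ (W.obj t).map x ≫ (φ Y).inv.app t at h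
    rw [h, Category.assoc, Category.assoc, Iso.inv_hom_id_app]
    exact congrArg _ (Category.comp_id _)
  · ext X
    exact (φ X).hom.naturality f

end Families

section Conjugates

variable {k : Type*} [Field k] {C D : Type*} [Category* C] [Category* D] [Preadditive C]
  [Preadditive D] [Linear k C] [Linear k D] {L L' : C ⥤ D} {R R' : D ⥤ C} (adj : L ⊣ R)
  (adj' : L' ⊣ R')

theorem conjugateEquiv_add_app [R'.Additive] {α β γ : L' ⟶ L} (h : ∀ X, γ.app X = α.app X + β.app X)
    (Y : D) :
    (conjugateEquiv adj adj' γ).app Y =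
      (conjugateEquiv adj adj' α).app Y + (conjugateEquiv adj adj' β).app Y := by
  simp [conjugateEquiv_apply_app, h]

theorem conjugateEquiv_smul_app [R'.Linear k] {α γ : L' ⟶ L} {r : k}
    (h : ∀ X, γ.app X = r • α.app X) (Y : D) :
    (conjugateEquiv adj adj' γ).app Y = r • (conjugateEquiv adj adj' α).app Y := by
  simp [conjugateEquiv_apply_app, h]

end Conjugates

namespace SSHCategory

variable {k : Type v} [Field k] (H : SSHCategory.{u, v} k)

theorem isTwoVectMor_mul (F : H.C₁) : IsTwoVectMor (H.mul.obj F) :=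
  (H.isTwoVectMor_i F).comp H.isTwoVectMor_m

theorem isBilinear_box : IsBilinearFunctor H.box := H.isBilinear_map₂ _

theorem tensor_deg {n n' : ℕ} {X Y : H.C₁} (hX : H.C₁.deg n X) (hY : H.C₁.deg n' Y) :
    H.C₁.deg (n + n') (H.tensor.obj (X, Y)) := H.map₂_deg _ n n' X Y hX hY

theorem mul_deg {n n' : ℕ} {X Y : H.C₁} (hX : H.C₁.deg n X) (hY : H.C₁.deg n' Y) :
    H.C₁.deg (n + n') ((H.mul.obj X).obj Y) :=
  H.C₁.deg_of_iso _ (H.boxMulIso.app (X, Y)).symm (H.tensor_deg hX hY)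

theorem mul_map_add {F F' : H.C₁} (f f' : F ⟶ F') (X : H.C₁) :
    (H.mul.map (f + f')).app X = (H.mul.map f).app X + (H.mul.map f').app X :=
  (congrArg H.m.map (H.isBilinear_box.add_left f f' (𝟙 X))).trans H.m.map_add

theorem mul_map_smul {F F' : H.C₁} (r : k) (f : F ⟶ F') (X : H.C₁) :
    (H.mul.map (r • f)).app X = r • (H.mul.map f).app X :=
  (congrArg H.m.map (H.isBilinear_box.smul_left r f (𝟙 X))).trans (H.m.map_smul _ _)

namespace Adjoints

variable {H} (D : H.Adjoints)

theorem isTwoVectMor_Δ (G : H.C₁) : IsTwoVectMor (D.Δ G) :=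
  (H.isTwoVectMor_mul G).of_rightAdjoint (D.adj G)

theorem isTwoVectMor_fock (F G : H.C₁) : IsTwoVectMor (D.fock.obj (F, Opposite.op G)) :=
  (D.isTwoVectMor_Δ G).comp (H.isTwoVectMor_mul F)

theorem Δfunctor_map_add {G G' : H.C₁} (g g' : G ⟶ G') (X : H.C₁) :
    (D.Δfunctor.map (g + g').op).app X =
      (D.Δfunctor.map g.op).app X + (D.Δfunctor.map g'.op).app X := by
  have := (D.isTwoVectMor_Δ G).additive
  exact conjugateEquiv_add_app (D.adj G') (D.adj G) (fun Y => H.mul_map_add g g' Y) X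

theorem Δfunctor_map_smul {G G' : H.C₁} (r : k) (g : G ⟶ G') (X : H.C₁) :
    (D.Δfunctor.map (r • g).op).app X = r • (D.Δfunctor.map g.op).app X := by
  have := (D.isTwoVectMor_Δ G).linear
  exact conjugateEquiv_smul_app (k := k) (D.adj G') (D.adj G) (fun Y => H.mul_map_smul r g Y) X

theorem isBilinear_fock (X : H.C₁) : IsBilinearFunctor (C := H.C₁) (C' := H.C₁.op) (D := H.C₁)
    (D.fock ⋙ (evaluation _ _).obj X) := by
  have hmap : ∀ {F F' : H.C₁} {G G' : (H.C₁)ᵒᵖ} (f : F ⟶ F') (g : G ⟶ G'),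
      (D.fock.map (X := (F, G)) (Y := (F', G')) (f, g)).app X =
        (H.mul.map f).app ((D.Δ G.unop).obj X) ≫
          (H.mul.obj F').map ((D.Δfunctor.map g).app X) := fun f g => rfl
  have hadd := fun F => (H.isTwoVectMor_mul F).additive
  have hlin := fun F => (H.isTwoVectMor_mul F).linear
  refine ⟨fun f f' g => ?_, fun {_ X' _ _} f g g' => ?_, fun r f g => ?_,
    fun {_ X' _ _} r f g => ?_⟩
  · refine (hmap _ _).trans (Eq.trans ?_ (congrArg₂ (· + ·) (hmap _ _) (hmap _ _)).symm)
    exact (congrArg (· ≫ _) (H.mul_map_add f f' _)).trans (Preadditive.add_comp _ _ _ _ _ _)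
  · refine (hmap _ _).trans (Eq.trans ?_ (congrArg₂ (· + ·) (hmap _ _) (hmap _ _)).symm)
    exact (congrArg (_ ≫ ·) ((congrArg (H.mul.obj X').map
      (D.Δfunctor_map_add g.unop g'.unop X)).trans (H.mul.obj X').map_add)).trans
        (Preadditive.comp_add _ _ _ _ _ _)
  · refine (hmap _ _).trans (Eq.trans ?_ (congrArg (r • ·) (hmap _ _)).symm)
    exact (congrArg (· ≫ _) (H.mul_map_smul r f _)).trans (Linear.smul_comp _ _ _ _ _ _)
  · refine (hmap _ _).trans (Eq.trans ?_ (congrArg (r • ·) (hmap _ _)).symm)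
    exact (congrArg (_ ≫ ·) ((congrArg (H.mul.obj X').map
      (D.Δfunctor_map_smul r g.unop X)).trans ((H.mul.obj X').map_smul _ _))).trans
        (Linear.comp_smul _ _ _ _ _ _)

/-- Let the degrees of X lie below N. By adjunction, a component of degree i of Δʳ_G X forces n' + i
< N, so i and n' differ by less than N, and the degree n + i of m_F Δʳ_G X stays within N of n + n'.
The bound depends only on X, as the universal property with parameters requires. -/
theorem fock_bounded (X : H.C₁) : ∃ N : ℕ, ∀ (n n' m : ℕ) (F G Y : H.C₁), H.C₁.deg n F →
    H.C₁.deg n' G → H.C₁.deg m Y → (m + N < n + n' ∨ n + n' + N < m) →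
      ∀ f : (H.mul.obj F).obj ((D.Δ G).obj X) ⟶ Y, f = 0 := by
  obtain ⟨N, hN⟩ := GrTwoVect.exists_degree_bound X
  refine ⟨N, fun n n' m F G Y hF hG hY hnm f => ?_⟩
  have := (H.isTwoVectMor_mul F).additive
  have := (H.isTwoVectMor_mul G).additive
  obtain ⟨M, Z, ι, π, hZ, h⟩ := GrTwoVect.exists_homogeneous ((D.Δ G).obj X)
  have h1 : 𝟙 ((H.mul.obj F).obj ((D.Δ G).obj X)) =
      ∑ i, (H.mul.obj F).map (π i) ≫ (H.mul.obj F).map (ι i) := by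
    rw [← (H.mul.obj F).map_id, ← h, (H.mul.obj F).map_sum]
    exact Finset.sum_congr rfl fun i _ => (H.mul.obj F).map_comp _ _
  rw [← Category.id_comp f, h1, Preadditive.sum_comp]
  refine Finset.sum_eq_zero fun i _ => ?_
  rw [Category.assoc]
  by_cases hi : N ≤ n' + i
  · have h2 : ι i = 0 := by
      apply ((D.adj G).homEquiv (Z i) X).symm.injective
      have h3 : ∀ g : (H.mul.obj G).obj (Z i) ⟶ X, g = 0 := fun g =>
        GrTwoVect.hom_eq_zero_comm (fun t => hN (n' + i) _ (H.mul_deg hG (hZ i)) hi t) g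
      rw [h3 (((D.adj G).homEquiv (Z i) X).symm (ι i)), h3 (((D.adj G).homEquiv (Z i) X).symm 0)]
    rw [h2, Functor.map_zero, zero_comp, comp_zero]
  · rw [H.C₁.hom_eq_zero (H.mul_deg hF (hZ i)) hY (by omega) ((H.mul.obj F).map (ι i) ≫ f),
      comp_zero]

/-- The bifunctor `(F, G) ↦ m_F ∘ Δʳ_G` on families. -/
def fockPi : (∀ i : Fin 2, (![H.C₁, H.C₁.op] i).carrier) ⥤ H.C₁ ⥤ H.C₁ :=
  (Pi.eval (fun i : Fin 2 => (![H.C₁, H.C₁.op] i).carrier) 0).prod'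
    (Pi.eval (fun i : Fin 2 => (![H.C₁, H.C₁.op] i).carrier) 1) ⋙ D.fock

theorem isMultiExact_fockPi (X : H.C₁) : IsMultiExact (C := ![H.C₁, H.C₁.op]) (D := H.C₁)
    (D.fockPi ⋙ (evaluation _ _).obj X) where
  multilinear := (D.isBilinear_fock X).multilinear (C := ![H.C₁, H.C₁.op])
  bounded := by
    obtain ⟨N, hN⟩ := D.fock_bounded X
    refine ⟨N, fun n m Z Y hZ hY hnm f => hN (n 0) (n 1) m (Z 0) (Opposite.unop (Z 1)) Y (hZ 0)
      (hZ 1) hY ?_ f⟩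
    rwa [finsum_eq_sum_of_fintype, Fin.sum_univ_two] at hnm

/-- The simple objects of `𝒞` and `𝒞ᵒᵖ`. -/
def simplePair (i : Fin 2) (j : H.C₁.Irr) : ![H.C₁, H.C₁.op] i := match i with
  | 0 => H.C₁.simpleObj j
  | 1 => Opposite.op (H.C₁.simpleObj j)

theorem semisimpleFamily_simplePair (i : Fin 2) : SemisimpleFamily k (simplePair (H := H) i) :=
  match i with
  | 0 => H.C₁.semisimpleFamily
  | 1 => H.C₁.semisimpleFamily_op

/-- The universal property with parameters controls Γ t X only as a functor of t. That Γ t is linear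
and bounded in X holds because t is a direct sum of objects F ⊠ G with F, G simple; both adjoints
then exist automatically. -/
theorem exists_fockFunctor {T : GrTwoVect.{u, v} k}
    {B : (∀ i : Fin 2, (![H.C₁, H.C₁.op] i).carrier) ⥤ T}
    (hB : IsDeligneTensor (C := ![H.C₁, H.C₁.op]) B) :
    ∃ Ψ : T ⥤ (EndAd H.C₁).FullSubcategory, Ψ.Additive ∧ Ψ.Linear k ∧
      Nonempty (pairOp H.C₁ ⋙ B ⋙ Ψ ⋙ (EndAd H.C₁).ι ≅ D.fock) := by
  obtain ⟨Γ, hΓ, ⟨θ⟩⟩ := hB.exists_functor D.fockPi D.isMultiExact_fockPi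
  have hadd : Γ.Additive := ⟨fun {X Y f g} => by
    ext Z
    exact (hΓ Z).additive.map_add⟩
  have hlin : Γ.Linear k := ⟨fun {X Y} f r => by
    ext Z
    exact (hΓ Z).linear.map_smul f r⟩
  have hmor : ∀ t, IsTwoVectMor (Γ.obj t) := by
    intro t
    obtain ⟨n, f, ι, π, -, -, h⟩ :=
      (hB.semisimpleFamily semisimpleFamily_simplePair).exists_total t
    refine IsTwoVectMor.of_total (fun a => Γ.map (ι a)) (fun a => Γ.map (π a)) ?_ (fun a => ?_)
    · rw [← Γ.map_id, ← h, Γ.map_sum]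
      exact Finset.sum_congr rfl fun a _ => (Γ.map_comp _ _).symm
    · exact (D.isTwoVectMor_fock _ _).of_iso (θ.app _).symm
  let Ψ : T ⥤ (EndAd H.C₁).FullSubcategory := (EndAd H.C₁).lift Γ
    (fun t => ⟨hmor t, (hmor t).isLeftAdjoint, (hmor t).isRightAdjoint⟩)
  refine ⟨Ψ, ⟨fun {X Y f g} => ?_⟩, ⟨fun {X Y} f r => ?_⟩, ⟨Functor.isoWhiskerLeft (pairOp H.C₁) θ⟩⟩
  · apply ObjectProperty.hom_ext
    exact Γ.map_add
  · apply ObjectProperty.hom_ext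
    exact Γ.map_smul r f

end Adjoints

end SSHCategory

/-! ### Self-adjoint bialgebras -/

/-- The multiplication of `A ⊗ A` induced by a multiplication of `A`. -/
def tensorMul {A : Type*} [AddCommGroup A] (f : A ⊗[ℤ] A →ₗ[ℤ] A) (u v : A ⊗[ℤ] A) : A ⊗[ℤ] A :=
  TensorProduct.map f f (TensorProduct.tensorTensorTensorComm ℤ A A A A (u ⊗ₜ v))

section TensorMul

variable {A : Type*} [AddCommGroup A] (f : A ⊗[ℤ] A →ₗ[ℤ] A)

theorem tensorMul_tmul (a b c d : A) :
    tensorMul f (a ⊗ₜ b) (c ⊗ₜ d) = f (a ⊗ₜ c) ⊗ₜ f (b ⊗ₜ d) := rfl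

theorem add_tensorMul (u u' v : A ⊗[ℤ] A) :
    tensorMul f (u + u') v = tensorMul f u v + tensorMul f u' v :=
  (congrArg (fun t => TensorProduct.map f f (TensorProduct.tensorTensorTensorComm ℤ A A A A t))
    (TensorProduct.add_tmul u u' v)).trans
      ((congrArg (TensorProduct.map f f) (map_add _ _ _)).trans (map_add (TensorProduct.map f f) _ _))

theorem tensorMul_add (u v v' : A ⊗[ℤ] A) :
    tensorMul f u (v + v') = tensorMul f u v + tensorMul f u v' :=
  (congrArg (fun t => TensorProduct.map f f (TensorProduct.tensorTensorTensorComm ℤ A A A A t))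
    (TensorProduct.tmul_add u v v')).trans
      ((congrArg (TensorProduct.map f f) (map_add _ _ _)).trans (map_add (TensorProduct.map f f) _ _))

theorem zero_tensorMul (v : A ⊗[ℤ] A) : tensorMul f 0 v = 0 := by
  simpa using add_tensorMul f 0 0 v

theorem tensorMul_zero (u : A ⊗[ℤ] A) : tensorMul f u 0 = 0 := by
  simpa using tensorMul_add f u 0 0

end TensorMul

/-- A graded bialgebra with a positive self-adjoint structure. The remaining axioms of a PSH
algebra, in particular connectedness, follow from these. -/
structure SelfAdjointBialgebra (A : Type*) [AddCommGroup A] where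
  mul : A ⊗[ℤ] A →ₗ[ℤ] A
  one : A
  comul : A →ₗ[ℤ] A ⊗[ℤ] A
  inner : A →ₗ[ℤ] A →ₗ[ℤ] ℤ
  ι : Type
  basis : Module.Basis ι ℤ A
  deg : ι → ℕ
  finite_deg : ∀ n, {b | deg b = n}.Finite
  inner_basis_self : ∀ b, inner (basis b) (basis b) = 1
  inner_basis_of_ne : ∀ b c, b ≠ c → inner (basis b) (basis c) = 0
  mul_assoc : ∀ x y z, mul (mul (x ⊗ₜ y) ⊗ₜ z) = mul (x ⊗ₜ mul (y ⊗ₜ z))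
  one_mul : ∀ x, mul (one ⊗ₜ x) = x
  mul_one : ∀ x, mul (x ⊗ₜ one) = x
  comul_mul : ∀ x y, comul (mul (x ⊗ₜ y)) = TensorProduct.map mul mul
    (TensorProduct.tensorTensorTensorComm ℤ A A A A (comul x ⊗ₜ comul y))
  comul_one : comul one = one ⊗ₜ one
  inner_one_one : inner one one = 1
  deg_mul : ∀ a b c, basis.repr (mul (basis a ⊗ₜ basis b)) c ≠ 0 → deg c = deg a + deg b
  deg_one : ∀ b, basis.repr one b ≠ 0 → deg b = 0
  inner_mul : ∀ x y z, inner (mul (x ⊗ₜ y)) z =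
    LinearMap.mul' ℤ ℤ (TensorProduct.map (inner x) (inner y) (comul z))
  mul_nonneg : ∀ a b c, 0 ≤ basis.repr (mul (basis a ⊗ₜ basis b)) c
  one_nonneg : ∀ b, 0 ≤ basis.repr one b

namespace SelfAdjointBialgebra

variable {A : Type*} [AddCommGroup A] (P : SelfAdjointBialgebra A)

theorem repr_eq (x : A) (b : P.ι) : P.basis.repr x b = P.inner (P.basis b) x := by
  classical
  have h : Finsupp.lapply b ∘ₗ P.basis.repr.toLinearMap = P.inner (P.basis b) := by
    apply P.basis.ext
    intro c
    change P.basis.repr (P.basis c) b = _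
    rw [Module.Basis.repr_self]
    by_cases hbc : c = b
    · subst hbc
      rw [Finsupp.single_eq_same, P.inner_basis_self]
    · rw [Finsupp.single_eq_of_ne (Ne.symm hbc), P.inner_basis_of_ne _ _ (Ne.symm hbc)]
  exact LinearMap.congr_fun h x

theorem inner_comm (x y : A) : P.inner x y = P.inner y x := by
  have h : P.inner = P.inner.flip := by
    apply P.basis.ext
    intro b
    apply P.basis.ext
    intro c
    rw [LinearMap.flip_apply]
    by_cases hbc : b = c
    · rw [hbc]
    · rw [P.inner_basis_of_ne _ _ hbc, P.inner_basis_of_ne _ _ (Ne.symm hbc)]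
  exact LinearMap.congr_fun (LinearMap.congr_fun h x) y

theorem ext_inner {x y : A} (h : ∀ z, P.inner z x = P.inner z y) : x = y := by
  apply P.basis.ext_elem
  intro b
  rw [repr_eq, repr_eq, h]

/-- The form `⟨x ⊗ y, -⟩` on `A ⊗ A`. -/
def inner₂ (x y : A) : A ⊗[ℤ] A →ₗ[ℤ] ℤ :=
  LinearMap.mul' ℤ ℤ ∘ₗ TensorProduct.map (P.inner x) (P.inner y)

@[simp]
theorem inner₂_tmul (x y z w : A) : P.inner₂ x y (z ⊗ₜ w) = P.inner x z * P.inner y w := rfl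

theorem inner₂_comul (x y z : A) : P.inner₂ x y (P.comul z) = P.inner (P.mul (x ⊗ₜ y)) z :=
  (P.inner_mul x y z).symm

theorem repr₂_eq (w : A ⊗[ℤ] A) (b c : P.ι) :
    (P.basis.tensorProduct P.basis).repr w (b, c) = P.inner₂ (P.basis b) (P.basis c) w := by
  induction w with
  | zero => simp
  | add w w' h h' => rw [map_add, map_add, Finsupp.add_apply, h, h']
  | tmul x y =>
    rw [Module.Basis.tensorProduct_repr_tmul_apply, inner₂_tmul, repr_eq, repr_eq, smul_eq_mul,
      mul_comm]

/-- `Δ_x`, the adjoint of the multiplication by `x`. -/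
def comulOp (x : A) : A →ₗ[ℤ] A :=
  (TensorProduct.lid ℤ A).toLinearMap ∘ₗ (P.inner x).rTensor A ∘ₗ P.comul

theorem inner_comulOp (x y z : A) : P.inner y (P.comulOp x z) = P.inner (P.mul (x ⊗ₜ y)) z := by
  rw [← inner₂_comul]
  have h : P.inner y ∘ₗ (TensorProduct.lid ℤ A).toLinearMap ∘ₗ (P.inner x).rTensor A =
      P.inner₂ x y := by
    exact TensorProduct.ext' fun a b => by
      simp
      rfl
  exact LinearMap.congr_fun h (P.comul z)

theorem comulOp_one (x : A) : P.comulOp P.one x = x :=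
  P.ext_inner fun z => by rw [inner_comulOp, P.one_mul]

theorem comulOp_comulOp (x y z : A) : P.comulOp x (P.comulOp y z) = P.comulOp (P.mul (y ⊗ₜ x)) z :=
  P.ext_inner fun w => by rw [inner_comulOp, inner_comulOp, inner_comulOp, P.mul_assoc]

theorem comulOp_add (x x' y : A) : P.comulOp (x + x') y = P.comulOp x y + P.comulOp x' y :=
  P.ext_inner fun z => by
    simp only [map_add, inner_comulOp, TensorProduct.add_tmul, LinearMap.add_apply]

/-- The bilinear dependence of `Δ_x y` on `x` and `y`. -/
def comulOpₗ : A →ₗ[ℤ] A →ₗ[ℤ] A :=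
  LinearMap.mk₂ ℤ (fun x y => P.comulOp x y) P.comulOp_add
    (fun c x y => map_zsmul (AddMonoidHom.mk' (fun x => P.comulOp x y)
      (fun x x' => P.comulOp_add x x' y)) c x)
    (fun _ y y' => map_add _ y y') (fun c _ y => map_smul _ c y)

/-- The map `p ⊗ q ↦ Δ_p(y) Δ_q(z)`. -/
def comulOp₂ (y z : A) : A ⊗[ℤ] A →ₗ[ℤ] A :=
  P.mul ∘ₗ TensorProduct.map (P.comulOpₗ.flip y) (P.comulOpₗ.flip z)

@[simp]
theorem comulOp₂_tmul (y z p q : A) :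
    P.comulOp₂ y z (p ⊗ₜ q) = P.mul (P.comulOp p y ⊗ₜ P.comulOp q z) := rfl

/-- Multiplication by p ⊗ q is adjoint to Δ_p ⊗ Δ_q. Applied to the Hopf axiom, this yields the
formula for Δ_x of a product. -/
theorem inner₂_tensorMul (y z p q : A) (v : A ⊗[ℤ] A) :
    P.inner₂ y z (tensorMul P.mul (p ⊗ₜ q) v) =
      P.inner₂ (P.comulOp p y) (P.comulOp q z) v := by
  induction v with
  | zero => rw [tensorMul_zero, map_zero, map_zero]
  | add v v' h h' => rw [tensorMul_add, map_add, h, h', map_add]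
  | tmul r s =>
    rw [tensorMul_tmul, inner₂_tmul, inner₂_tmul, inner_comm P y, inner_comm P z,
      inner_comm P (P.comulOp p y), inner_comm P (P.comulOp q z), inner_comulOp, inner_comulOp]

/-- `Δ_x (y z) = ∑ Δ_{x₁}(y) Δ_{x₂}(z)`. -/
theorem comulOp_mul (x y z : A) :
    P.comulOp x (P.mul (y ⊗ₜ z)) = P.comulOp₂ y z (P.comul x) := by
  apply P.ext_inner
  intro t
  rw [inner_comulOp, inner_comm, ← inner₂_comul, P.comul_mul]
  suffices h : ∀ u : A ⊗[ℤ] A, P.inner₂ y z (tensorMul P.mul u (P.comul t)) =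
      P.inner t (P.comulOp₂ y z u) from h _
  intro u
  induction u with
  | zero => rw [zero_tensorMul, map_zero, map_zero, map_zero]
  | add u u' h h' => rw [add_tensorMul, map_add, h, h', map_add, map_add]
  | tmul p q => rw [inner₂_tensorMul, inner₂_comul, comulOp₂_tmul, inner_comm P t]

/-! #### Positivity -/

/-- Elements with nonnegative coefficients. -/
def IsPos (x : A) : Prop := ∀ b, 0 ≤ P.basis.repr x b

variable {P}

theorem IsPos.add {x y : A} (hx : P.IsPos x) (hy : P.IsPos y) : P.IsPos (x + y) := fun b => by
  rw [map_add, Finsupp.add_apply]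
  exact add_nonneg (hx b) (hy b)

theorem IsPos.smul {c : ℤ} {x : A} (hc : 0 ≤ c) (hx : P.IsPos x) : P.IsPos (c • x) := fun b => by
  rw [map_smul, Finsupp.smul_apply, smul_eq_mul]
  exact _root_.mul_nonneg hc (hx b)

theorem isPos_zero : P.IsPos 0 := fun b => by simp

theorem isPos_sum {α : Type*} {s : Finset α} {x : α → A} (h : ∀ a ∈ s, P.IsPos (x a)) :
    P.IsPos (∑ a ∈ s, x a) := by
  classical
  induction s using Finset.induction_on with
  | empty => simpa using isPos_zero
  | insert a s ha ih =>
    rw [Finset.sum_insert ha]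
    exact (h a (Finset.mem_insert_self a s)).add
      (ih fun b hb => h b (Finset.mem_insert_of_mem hb))

theorem isPos_basis (b : P.ι) : P.IsPos (P.basis b) := fun c => by
  classical
  rw [Module.Basis.repr_self, Finsupp.single_apply]
  split_ifs <;> simp

variable (P) in
theorem eq_sum (x : A) : x = ∑ b ∈ (P.basis.repr x).support, P.basis.repr x b • P.basis b :=
  (P.basis.linearCombination_repr x).symm

/-- An additive map is positive as soon as it is positive on the basis. -/
theorem isPos_map {f : A →ₗ[ℤ] A} (hf : ∀ b, P.IsPos (f (P.basis b))) {x : A} (hx : P.IsPos x) :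
    P.IsPos (f x) := by
  rw [P.eq_sum x, map_sum]
  exact isPos_sum fun b _ => by
    rw [map_smul]
    exact (hf b).smul (hx b)

theorem IsPos.mul {x y : A} (hx : P.IsPos x) (hy : P.IsPos y) : P.IsPos (P.mul (x ⊗ₜ y)) := by
  refine isPos_map (f := P.mul ∘ₗ TensorProduct.mk ℤ A A x) (fun c => ?_) hy
  refine isPos_map (f := P.mul ∘ₗ (TensorProduct.mk ℤ A A).flip (P.basis c)) (fun b => ?_) hx
  exact P.mul_nonneg b c

theorem IsPos.inner {x y : A} (hx : P.IsPos x) (hy : P.IsPos y) : 0 ≤ P.inner x y := by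
  rw [P.eq_sum x, map_sum, LinearMap.sum_apply]
  refine Finset.sum_nonneg fun b _ => ?_
  rw [map_smul, LinearMap.smul_apply, smul_eq_mul, ← repr_eq]
  exact _root_.mul_nonneg (hx b) (hy b)

theorem IsPos.comulOp {x y : A} (hx : P.IsPos x) (hy : P.IsPos y) : P.IsPos (P.comulOp x y) :=
  fun b => by
    rw [repr_eq, inner_comulOp]
    exact (hx.mul (isPos_basis b)).inner hy

theorem isPos_one : P.IsPos P.one := P.one_nonneg

/-! #### Connectedness -/

variable (P)

theorem inner_eq_sum (x y : A) {s : Finset P.ι} (h : ∀ b, P.basis.repr y b ≠ 0 → b ∈ s) :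
    P.inner x y = ∑ b ∈ s, P.basis.repr x b * P.basis.repr y b := by
  conv_lhs => rw [P.eq_sum y, map_sum]
  refine (Finset.sum_subset (fun b hb => h b (Finsupp.mem_support_iff.1 hb))
    (fun b _ hb => ?_)).trans (Finset.sum_congr rfl fun b _ => ?_)
  · rw [Finsupp.notMem_support_iff.1 hb, zero_smul, map_zero]
  · rw [map_smul, smul_eq_mul, inner_comm, ← repr_eq, mul_comm]

/-- The identity ⟨1, 1⟩ = 1 writes 1 as a sum of squares of integer coordinates. Just one coordinate
is nonzero, and by positivity it equals 1. -/
theorem exists_one_eq_basis : ∃ e, P.one = P.basis e := by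
  have h1 : ∑ b ∈ (P.basis.repr P.one).support, P.basis.repr P.one b * P.basis.repr P.one b = 1 := by
    rw [← P.inner_eq_sum _ _ (fun b hb => Finsupp.mem_support_iff.2 hb), P.inner_one_one]
  obtain ⟨e, he⟩ : ∃ e, P.basis.repr P.one e ≠ 0 := by
    by_contra! hc
    rw [Finset.sum_eq_zero (fun b _ => by rw [hc b, zero_mul])] at h1
    exact zero_ne_one h1
  have hpos : ∀ b, 0 ≤ P.basis.repr P.one b := P.one_nonneg
  have hge : ∀ b ∈ (P.basis.repr P.one).support,
      1 ≤ P.basis.repr P.one b * P.basis.repr P.one b := fun b hb => by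
    have h2 := hpos b
    have h3 := Finsupp.mem_support_iff.1 hb
    have : 1 ≤ P.basis.repr P.one b := by omega
    nlinarith
  have hcard : (P.basis.repr P.one).support.card ≤ 1 := by
    have h2 := Finset.card_nsmul_le_sum _ _ 1 hge
    rw [h1] at h2
    simpa using h2
  have hsupp : (P.basis.repr P.one).support = {e} := by
    refine (Finset.eq_of_subset_of_card_le (Finset.singleton_subset_iff.2
      (Finsupp.mem_support_iff.2 he)) (by simpa using hcard)).symm
  rw [hsupp, Finset.sum_singleton] at h1
  have h2 : P.basis.repr P.one e = 1 := by
    have := hpos e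
    nlinarith
  refine ⟨e, ?_⟩
  rw [P.eq_sum P.one, hsupp, Finset.sum_singleton, h2, one_smul]

theorem mul_basis_deg_zero {x y : A} (hx : ∀ b, P.basis.repr x b ≠ 0 → P.deg b = 0)
    (hy : ∀ b, P.basis.repr y b ≠ 0 → P.deg b = 0) {b : P.ι}
    (h : P.basis.repr (P.mul (x ⊗ₜ y)) b ≠ 0) : P.deg b = 0 := by
  by_contra hb
  apply h
  rw [P.eq_sum x, P.eq_sum y, TensorProduct.sum_tmul, map_sum, map_sum, Finsupp.finsetSum_apply]
  refine Finset.sum_eq_zero fun c hc => ?_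
  rw [TensorProduct.tmul_sum, map_sum, map_sum, Finsupp.finsetSum_apply]
  refine Finset.sum_eq_zero fun d hd => ?_
  rw [TensorProduct.smul_tmul_smul, map_smul, map_smul, Finsupp.smul_apply]
  by_contra hne
  have h1 := P.deg_mul c d b (fun h0 => hne (by rw [h0, smul_zero]))
  rw [hx c (Finsupp.mem_support_iff.1 hc), hy d (Finsupp.mem_support_iff.1 hd)] at h1
  exact hb h1

/-- The powers of an element. -/
def pow (x : A) : ℕ → A
  | 0 => P.one
  | n + 1 => P.mul (x ⊗ₜ pow x n)

variable {P} in
theorem IsPos.eq_zero {x : A} (h : P.IsPos x) (h' : P.IsPos (-x)) : x = 0 := by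
  apply P.basis.ext_elem
  intro b
  have h1 := h b
  have h2 := h' b
  rw [map_neg, Finsupp.neg_apply] at h2
  rw [map_zero, Finsupp.zero_apply]
  omega

variable {P} in
theorem IsPos.pow {x : A} (hx : P.IsPos x) : ∀ n, P.IsPos (P.pow x n)
  | 0 => isPos_one
  | n + 1 => hx.mul (hx.pow n)

section Derivation

variable {P} {e i : P.ι}

/-- `Δ_x` is at least a derivation, for a basis element `x ≠ 1`. -/
theorem isPos_derivation (he : P.one = P.basis e) (hie : i ≠ e) {y : A} (hy : P.IsPos y) :
    P.IsPos (P.comulOp (P.basis i) (P.mul (P.basis i ⊗ₜ y)) - y -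
      P.mul (P.basis i ⊗ₜ P.comulOp (P.basis i) y)) := by
  classical
  set x := P.basis i with hx
  have hxpos : P.IsPos x := isPos_basis i
  have hinner : ∀ b c, P.inner (P.basis b) (P.basis c) = if b = c then 1 else 0 := fun b c => by
    split_ifs with h
    · rw [h, P.inner_basis_self]
    · exact P.inner_basis_of_ne _ _ h
  -- The coordinate of Δ x at b ⊗ c is ⟨b c, x⟩, which is nonnegative and equals 1 at x ⊗ 1 and at 1
  -- ⊗ x. These positions differ since x ≠ 1, so subtracting both terms leaves nonnegative
  -- coordinates.
  set w := P.comul x - x ⊗ₜ P.one - P.one ⊗ₜ x with hw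
  have hwpos : ∀ b c, 0 ≤ (P.basis.tensorProduct P.basis).repr w (b, c) := by
    intro b c
    rw [repr₂_eq, hw, map_sub, map_sub, inner₂_comul, inner₂_tmul, inner₂_tmul, he, hx, hinner,
      hinner, hinner, hinner]
    by_cases h1 : b = i
    · subst h1
      by_cases h2 : c = e
      · subst h2
        rw [← he, P.mul_one, P.inner_basis_self]
        simp [hie]
      · simpa [h2, hie] using (((isPos_basis b).mul (isPos_basis c)).inner (isPos_basis b))
    · by_cases h2 : b = e ∧ c = i
      · obtain ⟨rfl, rfl⟩ := h2
        rw [← he, P.one_mul, P.inner_basis_self]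
        simp [h1]
      · have h3 := ((isPos_basis b).mul (isPos_basis c)).inner (P := P) (isPos_basis i)
        rcases not_and_or.1 h2 with h2 | h2 <;> simpa [h1, h2] using h3
  have hcomul : P.comul x = w + x ⊗ₜ P.one + P.one ⊗ₜ x := by rw [hw]; abel
  have hw' : P.IsPos (P.comulOp₂ x y w) := by
    rw [← (P.basis.tensorProduct P.basis).linearCombination_repr w,
      Finsupp.linearCombination_apply, Finsupp.sum, map_sum]
    refine isPos_sum fun bc _ => ?_
    rw [map_zsmul, Module.Basis.tensorProduct_apply', comulOp₂_tmul]
    exact (((isPos_basis bc.1).comulOp hxpos).mul ((isPos_basis bc.2).comulOp hy)).smul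
      (hwpos bc.1 bc.2)
  -- The coordinate of Δ_x x at 1 is ⟨x, x⟩ = 1, so Δ_x x exceeds 1 by a positive element.
  have hxx : P.IsPos (P.comulOp x x - P.one) := by
    intro b
    rw [map_sub, Finsupp.sub_apply]
    by_cases hb : b = e
    · subst hb
      rw [repr_eq, repr_eq, inner_comulOp, ← he, P.mul_one, P.inner_basis_self, P.inner_one_one,
        sub_self]
    · rw [he, Module.Basis.repr_self, Finsupp.single_eq_of_ne hb, sub_zero]
      exact hxpos.comulOp hxpos b
  have h := hw'.add (hxx.mul hy)
  rw [P.comulOp_mul, hcomul, map_add, map_add, comulOp₂_tmul, comulOp₂_tmul, comulOp_one,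
    comulOp_one]
  convert h using 1
  rw [TensorProduct.sub_tmul, map_sub P.mul, P.one_mul]
  abel

/-- Induction with the derivation inequality Δ_x(x y) ≥ y + x Δ_x(y) at y = x^{n+1}: each step
contributes one more copy of the power, as in the rule for differentiating a power. -/
theorem isPos_comulOp_pow (he : P.one = P.basis e) (hie : i ≠ e) (n : ℕ) :
    P.IsPos (P.comulOp (P.basis i) (P.pow (P.basis i) (n + 1)) -
    ((n : ℤ) + 1) • P.pow (P.basis i) n) := by
  induction n with
  | zero =>
    have h := (isPos_derivation he hie (y := P.one) isPos_one).add
      ((isPos_basis i).mul ((isPos_basis i).comulOp isPos_one))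
    simpa [pow] using h
  | succ n ih =>
    have h := (isPos_derivation he hie ((isPos_basis i).pow (n + 1))).add ((isPos_basis i).mul ih)
    convert h using 1
    rw [TensorProduct.tmul_sub, map_sub, TensorProduct.tmul_smul, map_zsmul]
    change _ = P.comulOp (P.basis i) (P.pow (P.basis i) (n + 1 + 1)) - _ - _ +
      (_ - ((n : ℤ) + 1) • P.pow (P.basis i) (n + 1))
    push_cast
    rw [add_smul ((n : ℤ) + 1) 1, one_smul]
    abel

/-- If x^{n+1} were zero, the preceding inequality would make -(n+1) x^n positive. Since x^n is
positive too, it would vanish. -/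
theorem pow_ne_zero (he : P.one = P.basis e) (hie : i ≠ e) (n : ℕ) : P.pow (P.basis i) n ≠ 0 := by
  induction n with
  | zero =>
    intro h
    have h1 := P.inner_one_one
    rw [show P.one = 0 from h, map_zero] at h1
    simp at h1
  | succ n ih =>
    intro h
    apply ih
    have h1 := isPos_comulOp_pow he hie n
    rw [h, map_zero, zero_sub] at h1
    have h2 := IsPos.eq_zero (((isPos_basis i).pow n).smul (by positivity : (0 : ℤ) ≤ (n : ℤ) + 1)) h1
    have := Module.Free.of_basis P.basis
    exact (smul_eq_zero_iff_right (by positivity)).1 h2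

end Derivation

/-- Otherwise all powers of x = `P.basis i` lie in the degree zero part, which has finite rank. The
operator m_x Δ_x is self-adjoint and bounded there, yet the derivation inequality makes it multiply
high powers of x by arbitrarily large factors. -/
theorem basis_eq_one_of_deg_eq_zero {i : P.ι} (hi : P.deg i = 0) : P.basis i = P.one := by
  classical
  obtain ⟨e, he⟩ := P.exists_one_eq_basis
  by_contra hne
  have hie : i ≠ e := fun h => hne (by rw [h, he])
  set x := P.basis i with hx
  have hdeg : ∀ n b, P.basis.repr (P.pow x n) b ≠ 0 → b ∈ (P.finite_deg 0).toFinset := by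
    intro n
    suffices h : ∀ b, P.basis.repr (P.pow x n) b ≠ 0 → P.deg b = 0 from fun b hb => by
      simpa using h b hb
    induction n with
    | zero => exact P.deg_one
    | succ n ih =>
      refine fun b hb => P.mul_basis_deg_zero (fun c hc => ?_) ih hb
      have : c = i := by
        by_contra hci
        exact hc (by rw [hx, Module.Basis.repr_self, Finsupp.single_eq_of_ne hci])
      rw [this, hi]
  set F := (P.finite_deg 0).toFinset
  set u := ∑ b ∈ F, P.basis b with hu
  have hu1 : ∀ b ∈ F, P.basis.repr u b = 1 := by
    intro b hb
    rw [hu, map_sum, Finsupp.finsetSum_apply, Finset.sum_eq_single b]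
    · rw [Module.Basis.repr_self, Finsupp.single_eq_same]
    · intro c _ hc
      rw [Module.Basis.repr_self, Finsupp.single_eq_of_ne (Ne.symm hc)]
    · exact fun h => absurd hb h
  -- `u` is the sum of the basis elements of degree zero and `t` is its image under m_x Δ_x. The
  -- constant c below bounds the degree zero coordinates of `t`, and the power of x is then chosen
  -- to exceed this bound.
  set t := P.mul (x ⊗ₜ P.comulOp x u)
  obtain ⟨c, hc⟩ : ∃ c : ℕ, ∀ b ∈ F, P.basis.repr t b ≤ c :=
    ⟨∑ b ∈ F, (P.basis.repr t b).natAbs, fun b hb => by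
      have h1 := Finset.single_le_sum (f := fun b => (P.basis.repr t b).natAbs)
        (fun _ _ => Nat.zero_le _) hb
      have h2 : (P.basis.repr t b).natAbs ≤ ∑ b ∈ F, (P.basis.repr t b).natAbs := h1
      omega⟩
  set y := P.pow x (c + 1)
  have hy : P.IsPos y := (isPos_basis i).pow _
  have hupos : P.IsPos u := isPos_sum fun b _ => isPos_basis b
  have h1 : P.inner t y ≤ c * P.inner u y := by
    rw [P.inner_eq_sum t y (hdeg _), P.inner_eq_sum u y (hdeg _), Finset.mul_sum]
    refine Finset.sum_le_sum fun b hb => ?_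
    rw [hu1 b hb, _root_.one_mul]
    exact mul_le_mul_of_nonneg_right (hc b hb) (hy b)
  -- Multiplication by x and Δ_x are adjoint, so m_x Δ_x is self-adjoint.
  have h2 : P.inner t y = P.inner u (P.mul (x ⊗ₜ P.comulOp x y)) := by
    rw [← inner_comulOp, inner_comm, inner_comulOp, inner_comm]
  -- As y is x · x^c, the derivation inequality gives the factor c + 1, against the factor c allowed
  -- by `h1`. With ⟨u, y⟩ > 0 this is a contradiction.
  have h3 : ((c : ℤ) + 1) * P.inner u y ≤ P.inner u (P.mul (x ⊗ₜ P.comulOp x y)) := by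
    have h := hupos.inner ((isPos_basis i).mul (isPos_comulOp_pow he hie c))
    rw [TensorProduct.tmul_sub, map_sub, TensorProduct.tmul_smul, map_zsmul, map_sub, map_zsmul,
      smul_eq_mul, sub_nonneg] at h
    exact h
  have h4 : 0 < P.inner u y := by
    refine lt_of_le_of_ne (hupos.inner hy) fun h0 => pow_ne_zero he hie (c + 1) ?_
    rw [P.inner_eq_sum u y (hdeg _)] at h0
    have h5 := (Finset.sum_eq_zero_iff_of_nonneg (fun b hb => by
      rw [hu1 b hb, _root_.one_mul]; exact hy b)).1 h0.symm
    apply P.basis.ext_elem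
    intro b
    rw [map_zero, Finsupp.zero_apply]
    by_contra hb
    have h6 := h5 b (hdeg _ b hb)
    rw [hu1 b (hdeg _ b hb), _root_.one_mul] at h6
    exact hb h6
  nlinarith

end SelfAdjointBialgebra

namespace SelfAdjointBialgebra

variable {A : Type*} [AddCommGroup A] (P : SelfAdjointBialgebra A)

/-! #### The PSH algebra and its Fock space representation -/

/-- The form `⟨x ⊗ y ⊗ z, -⟩` on `A ⊗ (A ⊗ A)`. -/
def inner₃ (x y z : A) : A ⊗[ℤ] (A ⊗[ℤ] A) →ₗ[ℤ] ℤ :=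
  LinearMap.mul' ℤ ℤ ∘ₗ TensorProduct.map (P.inner x) (P.inner₂ y z)

theorem ext_inner₃ {u v : A ⊗[ℤ] (A ⊗[ℤ] A)} (h : ∀ x y z, P.inner₃ x y z u = P.inner₃ x y z v) :
    u = v := by
  let B₂ : @Module.Basis (P.ι × P.ι) ℤ (A ⊗[ℤ] A) _ _ (AddCommGroup.toIntModule _) :=
    P.basis.tensorProduct P.basis
  have hB₂ : ∀ w b c, B₂.repr w (b, c) = P.inner₂ (P.basis b) (P.basis c) w := P.repr₂_eq
  let B := P.basis.tensorProduct B₂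
  have hB : ∀ (w : A ⊗[ℤ] (A ⊗[ℤ] A)) b c d,
      B.repr w (b, (c, d)) = P.inner₃ (P.basis b) (P.basis c) (P.basis d) w := by
    intro w b c d
    induction w with
    | zero => simp
    | add w w' h h' => rw [map_add, map_add, Finsupp.add_apply, h, h']
    | tmul x y =>
      rw [Module.Basis.tensorProduct_repr_tmul_apply, repr_eq, hB₂, smul_eq_mul, mul_comm]
      rfl
  apply B.ext_elem
  rintro ⟨b, c, d⟩
  rw [hB, hB, h]

/-- Pairing with a ⊗ b ⊗ c turns the two sides into ⟨(a b) c, x⟩ and ⟨a (b c), x⟩, so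
coassociativity is adjoint to associativity. -/
theorem coassoc (x : A) : TensorProduct.assoc ℤ A A A (P.comul.rTensor A (P.comul x)) =
    P.comul.lTensor A (P.comul x) := by
  apply P.ext_inner₃
  intro a b c
  let α : (A ⊗[ℤ] A) ⊗[ℤ] A →+ A ⊗[ℤ] (A ⊗[ℤ] A) :=
    (TensorProduct.assoc ℤ A A A).toLinearMap.toAddMonoidHom
  have hα : ∀ (v : A ⊗[ℤ] A) (q : A),
      P.inner₃ a b c (α (v ⊗ₜ q)) = P.inner₂ a b v * P.inner c q := by
    intro v q
    induction v with
    | zero => rw [TensorProduct.zero_tmul, map_zero, map_zero, map_zero, zero_mul]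
    | add v v' h h' => rw [TensorProduct.add_tmul, map_add, map_add, h, h', map_add, add_mul]
    | tmul r s => exact (_root_.mul_assoc _ _ _).symm
  have h1 : ∀ u : A ⊗[ℤ] A, P.inner₃ a b c (α (P.comul.rTensor A u)) =
      P.inner₂ (P.mul (a ⊗ₜ b)) c u := by
    intro u
    induction u with
    | zero => simp
    | add u u' h h' => rw [map_add, map_add, map_add, h, h', map_add]
    | tmul p q => rw [inner₂_tmul, ← inner₂_comul, LinearMap.rTensor_tmul, hα]
  have h2 : ∀ u : A ⊗[ℤ] A, P.inner₃ a b c (P.comul.lTensor A u) =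
      P.inner₂ a (P.mul (b ⊗ₜ c)) u := by
    intro u
    induction u with
    | zero => simp
    | add u u' h h' => rw [map_add, map_add, h, h', map_add]
    | tmul p q =>
      rw [inner₂_tmul, ← inner₂_comul, LinearMap.lTensor_tmul]
      rfl
  refine (h1 _).trans ?_
  rw [h2, inner₂_comul, inner₂_comul, P.mul_assoc]

theorem counit_right (x : A) :
    TensorProduct.rid ℤ A ((P.inner P.one).lTensor A (P.comul x)) = x := by
  apply P.ext_inner
  intro z
  have h : ∀ u : A ⊗[ℤ] A, P.inner z (TensorProduct.rid ℤ A ((P.inner P.one).lTensor A u)) =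
      P.inner₂ z P.one u := by
    intro u
    induction u with
    | zero => simp
    | add u u' h h' => rw [map_add, map_add, map_add, h, h', map_add]
    | tmul p q =>
      rw [LinearMap.lTensor_tmul, TensorProduct.rid_tmul, map_smul, inner₂_tmul, smul_eq_mul,
        mul_comm]
  rw [h, inner₂_comul, P.mul_one]

/-- The PSH algebra given by a self-adjoint bialgebra. -/
def toPSH : PSHAlgebra A where
  mul := P.mul
  one := P.one
  comul := P.comul
  counit := P.inner P.one
  inner := P.inner
  ι := P.ι
  basis := P.basis
  deg := P.deg
  finite_deg := P.finite_deg
  inner_basis_self := P.inner_basis_self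
  inner_basis_of_ne := P.inner_basis_of_ne
  mul_assoc := P.mul_assoc
  one_mul := P.one_mul
  mul_one := P.mul_one
  coassoc := P.coassoc
  counit_left := P.comulOp_one
  counit_right := P.counit_right
  comul_mul := P.comul_mul
  comul_one := P.comul_one
  counit_mul x y := by
    rw [inner_comm, ← inner₂_comul, P.comul_one, inner₂_tmul, inner_comm, inner_comm P y]
  counit_one := P.inner_one_one
  deg_mul := P.deg_mul
  deg_comul a b c h := by
    rw [repr₂_eq, inner₂_comul, inner_comm, ← repr_eq] at h
    exact P.deg_mul b c a h
  deg_one := P.deg_one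
  deg_counit b h := by
    rw [inner_comm, ← repr_eq] at h
    exact P.deg_one b h
  inner_mul := P.inner_mul
  inner_one _ := rfl
  mul_nonneg := P.mul_nonneg
  comul_nonneg a b c := by
    rw [repr₂_eq, inner₂_comul, inner_comm, ← repr_eq]
    exact P.mul_nonneg b c a
  one_nonneg := P.one_nonneg
  counit_nonneg b := by
    rw [inner_comm, ← repr_eq]
    exact P.one_nonneg b
  connected b hb := by
    rw [P.basis_eq_one_of_deg_eq_zero hb, P.inner_one_one, one_smul]

theorem toPSH_fock_tmul (x y z : A) :
    P.toPSH.fock (x ⊗ₜ y) z = P.mul (x ⊗ₜ P.comulOp y z) := rfl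

/-- The coordinate of Δ_b(c) at d is ⟨b d, c⟩. For degree reasons only d of degree zero can
contribute, and by connectedness such a d is 1. -/
theorem comulOp_basis {b c : P.ι} (h : P.deg c ≤ P.deg b) [Decidable (b = c)] :
    P.comulOp (P.basis b) (P.basis c) = if b = c then P.one else 0 := by
  classical
  obtain ⟨e, he⟩ := P.exists_one_eq_basis
  apply P.basis.ext_elem
  intro d
  rw [repr_eq, inner_comulOp, inner_comm, ← repr_eq]
  by_cases hd : P.deg d = 0
  · have hde : d = e := P.basis.injective ((P.basis_eq_one_of_deg_eq_zero hd).trans he)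
    rw [hde, ← he, P.mul_one, Module.Basis.repr_self, Finsupp.single_apply]
    split_ifs
    · rw [he, Module.Basis.repr_self, Finsupp.single_eq_same]
    · simp
  · have h1 : P.basis.repr (P.mul (P.basis b ⊗ₜ P.basis d)) c = 0 := by
      by_contra hne
      have := P.deg_mul b d c hne
      omega
    rw [h1]
    split_ifs
    · by_contra hne
      exact hd (P.deg_one d (Ne.symm hne))
    · simp

/-- Choose (i, j) in the support of w with deg j minimal and evaluate at the basis element j. By
`comulOp_basis` every term with second factor other than j dies and the others survive as first
factors, so pairing with i recovers a nonzero coordinate. -/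
theorem toPSH_fock_injective : Function.Injective P.toPSH.fock := by
  classical
  rw [injective_iff_map_eq_zero]
  intro w hw
  by_contra hne
  let B := P.basis.tensorProduct P.basis
  have hsupp : (B.repr w).support.Nonempty := by
    rw [Finsupp.support_nonempty_iff]
    exact fun h => hne (B.repr.map_eq_zero_iff.1 h)
  obtain ⟨⟨i, j⟩, hij, hmin⟩ := Finset.exists_min_image _ (fun p : P.ι × P.ι => P.deg p.2) hsupp
  have h1 : P.inner (P.basis i) (P.toPSH.fock w (P.basis j)) = B.repr w (i, j) := by
    have h2 : w = ∑ p ∈ (B.repr w).support, B.repr w p • B p := (B.linearCombination_repr w).symm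
    conv_lhs => rw [h2, map_sum, LinearMap.sum_apply, map_sum]
    have h3 : ∀ p ∈ (B.repr w).support, P.inner (P.basis i)
        (P.toPSH.fock (B.repr w p • B p) (P.basis j)) = if p = (i, j) then B.repr w p else 0 := by
      rintro ⟨b, c⟩ hp
      have h4 : B (b, c) = P.basis b ⊗ₜ P.basis c := Module.Basis.tensorProduct_apply _ _ _ _
      rw [map_zsmul, LinearMap.smul_apply, map_zsmul, h4, toPSH_fock_tmul,
        P.comulOp_basis (hmin _ hp)]
      by_cases hc : c = j
      · rw [if_pos hc, P.mul_one]
        by_cases hb : b = i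
        · subst hb hc
          rw [P.inner_basis_self, if_pos rfl, smul_eq_mul, _root_.mul_one]
        · rw [P.inner_basis_of_ne _ _ (Ne.symm hb), smul_zero, if_neg]
          exact fun h => hb (congrArg Prod.fst h)
      · rw [if_neg hc, TensorProduct.tmul_zero, map_zero, map_zero, smul_zero, if_neg]
        exact fun h => hc (congrArg Prod.snd h)
    rw [Finset.sum_congr rfl h3, Finset.sum_ite_eq' _ (i, j), if_pos hij]
  rw [hw, LinearMap.zero_apply, map_zero] at h1
  exact (Finsupp.mem_support_iff.1 hij) h1.symm

/-- The product is normally ordered by Δ_y(z s) = ∑ Δ_{y₁}(z) Δ_{y₂}(s) and Δ_q Δ_t = Δ_{t q}: m_x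
Δ_y m_z Δ_t is the sum of the operators m_{x Δ_{y₁} z} Δ_{t y₂}. -/
theorem toPSH_fock_mul_mem (w w' : A ⊗[ℤ] A) :
    P.toPSH.fock w * P.toPSH.fock w' ∈ P.toPSH.fock.toAddMonoidHom.range := by
  induction w with
  | zero => rw [map_zero, zero_mul]; exact zero_mem _
  | add u u' h h' => rw [map_add, add_mul]; exact add_mem h h'
  | tmul x y =>
    induction w' with
    | zero => rw [map_zero, mul_zero]; exact zero_mem _
    | add u u' h h' => rw [map_add, mul_add]; exact add_mem h h'
    | tmul z t =>
      have key : ∀ u : A ⊗[ℤ] A, ∃ v : A ⊗[ℤ] A, ∀ s,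
          P.toPSH.fock v s = P.mul (x ⊗ₜ P.comulOp₂ z (P.comulOp t s) u) := by
        intro u
        induction u with
        | zero => exact ⟨0, fun s => by simp⟩
        | add u u' h h' =>
          obtain ⟨v, hv⟩ := h
          obtain ⟨v', hv'⟩ := h'
          exact ⟨v + v', fun s => by
            rw [map_add, LinearMap.add_apply, hv, hv', map_add, TensorProduct.tmul_add, map_add]⟩
        | tmul p q =>
          exact ⟨P.mul (x ⊗ₜ P.comulOp p z) ⊗ₜ P.mul (t ⊗ₜ q), fun s => by
            rw [toPSH_fock_tmul, comulOp₂_tmul, comulOp_comulOp, P.mul_assoc]⟩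
      obtain ⟨v, hv⟩ := key (P.comul y)
      refine ⟨v, LinearMap.ext fun s => ?_⟩
      refine (hv s).trans ?_
      rw [← P.comulOp_mul]
      rfl

theorem exists_subring_fock : ∃ R : Subring (Module.End ℤ A),
    (R : Set (Module.End ℤ A)) = Set.range P.toPSH.fock := by
  refine ⟨{ carrier := Set.range P.toPSH.fock
            mul_mem' := ?_
            one_mem' := ⟨P.one ⊗ₜ P.one, LinearMap.ext fun s => ?_⟩
            add_mem' := ?_
            zero_mem' := ⟨0, map_zero _⟩
            neg_mem' := ?_ }, rfl⟩
  · rintro _ _ ⟨w, rfl⟩ ⟨w', rfl⟩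
    exact P.toPSH_fock_mul_mem w w'
  · rw [toPSH_fock_tmul, comulOp_one, P.one_mul]
    rfl
  · rintro _ _ ⟨w, rfl⟩ ⟨w', rfl⟩
    exact ⟨w + w', map_add _ _ _⟩
  · rintro _ ⟨w, rfl⟩
    exact ⟨-w, map_neg _ _⟩

end SelfAdjointBialgebra

/-! ### Units and interchange -/

theorem pairFunctor_obj_eta {C : Type u} [Category.{v} C] (Z : Fin 2 → C) :
    (pairFunctor C).obj (Z 0, Z 1) = Z := by
  funext i
  match i with
  | 0 => rfl
  | 1 => rfl

namespace PseudoMultifunctor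

variable {obj : ∀ (S : Type) [Finite S], Type u} [∀ (S : Type) [Finite S], Category.{v} (obj S)]
  (P : PseudoMultifunctor.{u, v} obj)

theorem map₂_obj_eta {S T : Type} [Finite S] [Finite T] (φ : Fin 2 → S → T) (Z : Fin 2 → obj S) :
    (P.map₂ φ).obj (Z 0, Z 1) = (P.map (S := fun _ => S) φ).obj Z :=
  congrArg (P.map (S := fun _ => S) φ).obj (pairFunctor_obj_eta Z)

/-- The object assigned to the empty family. -/
def unitAt (T : Type) [Finite T] : obj T :=
  (P.map (I := Empty) (S := fun _ => Empty) (T := T) (fun i => i.elim)).obj (fun i => i.elim)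

/-- After reindexing along a bijection with `Empty`, families of sets, maps and objects are all
equal by function extensionality, so the values agree on the nose. -/
theorem map_empty_iso {I : Type} [Finite I] [IsEmpty I] {S : I → Type} [∀ i, Finite (S i)]
    {T : Type} [Finite T] (φ : ∀ i, S i → T) (X : ∀ i, obj (S i)) :
    Nonempty ((P.map φ).obj X ≅ P.unitAt T) := by
  have h : ∀ (S S' : Empty → Type) (_ : ∀ i, Finite (S i)) (_ : ∀ i, Finite (S' i))
      (φ : ∀ i, S i → T) (φ' : ∀ i, S' i → T) (X : ∀ i, obj (S i)) (X' : ∀ i, obj (S' i)),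
      (P.map φ).obj X = (P.map φ').obj X' := by
    intro S S' _ _ φ φ' X X'
    obtain rfl : S = S' := funext fun i => i.elim
    obtain rfl : φ = φ' := funext fun i => i.elim
    obtain rfl : X = X' := funext fun i => i.elim
    rfl
  let e : Empty ≃ I := Equiv.equivOfIsEmpty _ _
  exact ⟨((P.reindexIso e φ).app X).symm ≪≫ eqToIso (h _ _ _ _ _ _ _ _)⟩

/-- Composing a family of empty families gives an empty family again: every functor of the structure
preserves units. -/
theorem map_unitAt {J : Type} [Finite J] {T : J → Type} [∀ j, Finite (T j)] {U : Type} [Finite U]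
    (ψ : ∀ j, T j → U) : Nonempty ((P.map ψ).obj (fun j => P.unitAt (T j)) ≅ P.unitAt U) := by
  have : IsEmpty (Σ _ : J, Empty) := ⟨fun p => p.2.elim⟩
  exact ⟨(P.compIso (I := fun _ => Empty) (S := fun _ _ => Empty) (fun _ i => i.elim) ψ).app
    (fun _ i => i.elim) ≪≫ Classical.choice (P.map_empty_iso _ _)⟩

/-- The functor assigned to an identity map. -/
def mapOneId (S : Type) [Finite S] : P.map₁ (id : S → S) ≅ 𝟭 (obj S) :=
  Functor.isoWhiskerLeft (Functor.pi' fun _ : Unit => 𝟭 (obj S)) (P.unitIso S)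

/-- A tensor product over one element, grouped along a map from `Unit` to `Fin 2`, has one empty
fibre, contributing the unit, and one fibre with a single element. -/
theorem tensor_unitAt_left {S : Type} [Finite S] (X : obj S) :
    Nonempty ((P.tensor S).obj (P.unitAt S, X) ≅ X) := by
  let f : Unit → Fin 2 := fun _ => 1
  have : IsEmpty {i : Unit // f i = 0} := ⟨fun i => absurd i.2 (by decide)⟩
  obtain ⟨e₀⟩ := P.map_empty_iso (I := {i : Unit // f i = 0}) (S := fun _ => S) (fun _ => id)
    (fun _ => X)
  let e : Unit ≃ {i : Unit // f i = 1} := ⟨fun _ => ⟨(), rfl⟩, fun _ => (), fun _ => rfl, fun _ => rfl⟩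
  refine ⟨(P.map (I := Fin 2) (S := fun _ => S) (fun _ => id)).mapIso
    (Pi.isoMk (Y := fun j => P.bigTensor (fun _ : {i : Unit // f i = j} => X)) (fun j => match j with
      | 0 => e₀.symm
      | 1 => (P.bigTensorOne e (fun _ => X)).symm)) ≪≫
    P.bigTensorFibres f (fun _ => X) ≪≫ P.bigTensorOne (Equiv.refl _) (fun _ => X)⟩

theorem tensor_unitAt_right {S : Type} [Finite S] (X : obj S) :
    Nonempty ((P.tensor S).obj (X, P.unitAt S) ≅ X) := by
  let f : Unit → Fin 2 := fun _ => 0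
  have : IsEmpty {i : Unit // f i = 1} := ⟨fun i => absurd i.2 (by decide)⟩
  obtain ⟨e₁⟩ := P.map_empty_iso (I := {i : Unit // f i = 1}) (S := fun _ => S) (fun _ => id)
    (fun _ => X)
  let e : Unit ≃ {i : Unit // f i = 0} := ⟨fun _ => ⟨(), rfl⟩, fun _ => (), fun _ => rfl, fun _ => rfl⟩
  refine ⟨(P.map (I := Fin 2) (S := fun _ => S) (fun _ => id)).mapIso
    (Pi.isoMk (Y := fun j => P.bigTensor (fun _ : {i : Unit // f i = j} => X)) (fun j => match j with
      | 0 => (P.bigTensorOne e (fun _ => X)).symm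
      | 1 => e₁.symm)) ≪≫
    P.bigTensorFibres f (fun _ => X) ≪≫ P.bigTensorOne (Equiv.refl _) (fun _ => X)⟩

/-- The bijection `(i, j) ↦ (j, i)`. -/
def sigmaSwap : (Σ _ : Fin 2, Fin 2) ≃ (Σ _ : Fin 2, Fin 2) where
  toFun p := ⟨p.2, p.1⟩
  invFun p := ⟨p.2, p.1⟩

/-- The interchange isomorphism `(Z₀₀ ⊠ Z₀₁) ⊗ (Z₁₀ ⊠ Z₁₁) ≅ (Z₀₀ ⊗ Z₁₀) ⊠ (Z₀₁ ⊗ Z₁₁)`. -/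
def interchange (Z : Fin 2 → Fin 2 → obj (Fin 1)) :
    (P.map (I := Fin 2) (S := fun _ => Fin 2) (T := Fin 2) (fun _ => id)).obj
      (fun j => (P.map (I := Fin 2) (S := fun _ => Fin 1) (T := Fin 2) (fun i _ => i)).obj (Z j)) ≅
    (P.map (I := Fin 2) (S := fun _ => Fin 1) (T := Fin 2) (fun i _ => i)).obj
      (fun i => (P.map (I := Fin 2) (S := fun _ => Fin 1) (T := Fin 1) (fun _ => id)).obj
        (fun j => Z j i)) :=
  (P.compIso (J := Fin 2) (I := fun _ => Fin 2) (S := fun _ _ => Fin 1) (T := fun _ => Fin 2)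
      (fun _ i _ => i) (fun _ => id)).app Z ≪≫
    ((P.reindexIso sigmaSwap (S := fun _ => Fin 1) (T := Fin 2) (fun p _ => p.2)).app
      (fun p => Z p.1 p.2)).symm ≪≫
    ((P.compIso (J := Fin 2) (I := fun _ => Fin 2) (S := fun _ _ => Fin 1) (T := fun _ => Fin 1)
      (fun _ _ => id) (fun i _ => i)).app (fun i j => Z j i)).symm

end PseudoMultifunctor

theorem GrTwoVect.finrank_congr {k : Type v} [Field k] {C : GrTwoVect.{u, v} k} {X X' Y Y' : C}
    (e : X ≅ X') (e' : Y ≅ Y') : Module.finrank k (X ⟶ Y) = Module.finrank k (X' ⟶ Y') := by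
  rw [← Nat.cast_inj (R := ℤ), ← homForm_mk, ← homForm_mk, K₀.mk_iso e, K₀.mk_iso e']

namespace SSHCategory

variable {k : Type v} [Field k] (H : SSHCategory.{u, v} k)

/-- The functor `𝒞^{⊗ 2} × 𝒞^{⊗ 2} ⥤ 𝒞^{⊗ 4}` assigned to `{1, 2} ⊔ {3, 4}`. -/
def concat : H.C₂ × H.C₂ ⥤ H.C₄ := H.functor.map₂ ![![0, 1], ![2, 3]]

theorem isDeligneTensor_concat : IsDeligneTensor (C := fun _ : Fin 2 => H.C₂) (D := H.C₄)
    (H.functor.map (S := fun _ : Fin 2 => Fin 2) (![![0, 1], ![2, 3]] : Fin 2 → Fin 2 → Fin 4)) :=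
  H.isDeligneTensor _ (by decide)

/-- `m² (P ⊠ Q) ≅ m P ⊠ m Q` -/
def concatSqIso : H.concat ⋙ H.mSq ≅ H.m.prod H.m ⋙ H.box :=
  H.functor.comp₂₁ _ _ ≪≫ eqToIso (congrArg (fun φ => H.functor.map₂ φ) (by decide)) ≪≫
    (H.functor.comp₁₂ _ _).symm

/-- The multiplication in pairs, applied to `P ⊠ Q`, is `P ⊗ Q`. -/
def concatBarIso : H.concat ⋙ H.mBar ≅ H.functor.tensor (Fin 2) :=
  H.functor.comp₂₁ _ _ ≪≫ eqToIso (congrArg (fun φ => H.functor.map₂ φ) (by decide))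

/-- `(P₁ ⊠ P₂) ⊗ (Q₁ ⊠ Q₂) ≅ (P₁ ⊗ Q₁) ⊠ (P₂ ⊗ Q₂)` -/
theorem nonempty_interchange (P₁ P₂ Q₁ Q₂ : H.C₁) :
    Nonempty ((H.functor.tensor (Fin 2)).obj (H.box.obj (P₁, P₂), H.box.obj (Q₁, Q₂)) ≅
      H.box.obj (H.tensor.obj (P₁, Q₁), H.tensor.obj (P₂, Q₂))) := by
  have e := H.functor.interchange ![![P₁, P₂], ![Q₁, Q₂]]
  rw [← H.functor.map₂_obj_eta, ← H.functor.map₂_obj_eta, ← H.functor.map₂_obj_eta,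
    ← H.functor.map₂_obj_eta, ← H.functor.map₂_obj_eta, ← H.functor.map₂_obj_eta] at e
  exact ⟨e⟩

/-- This isomorphism is the Hopf axiom on the level of objects: the Beck–Chevalley condition for the
product square of a two-element set with itself. -/
theorem nonempty_hopf (D : H.Adjoints) (X : H.C₂) :
    Nonempty (H.mBar.obj (D.ΔrSq.obj X) ≅ D.Δr.obj (H.m.obj X)) := by
  have h := H.beckChevalley (![0, 1, 0, 1] : Fin 4 → Fin 2) (![0, 0, 1, 1] : Fin 4 → Fin 2)
      (fun _ => (0 : Fin 1)) (fun _ => (0 : Fin 1)) rfl (by unfold ExistsUnique; decide)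
      D.ΔrSq D.Δr D.adjΔrSq D.adjΔr
  exact ⟨(@asIso _ _ _ _ _ h).app X⟩

/-- The pullback of two points and the empty set over one point is empty. Beck–Chevalley for this
square identifies Δʳ of the unit with the unit of 𝒞^{⊗ 2}, which is the external product of two
units. -/
theorem nonempty_comul_unit (D : H.Adjoints) :
    Nonempty (D.Δr.obj H.unitObj ≅ H.box.obj (H.unitObj, H.unitObj)) := by
  let adj : H.functor.map₁ (id : Empty → Empty) ⊣ 𝟭 _ :=
    Adjunction.id.ofNatIsoLeft (H.functor.mapOneId Empty).symm
  have h := H.beckChevalley (Empty.elim : Empty → Fin 2) (id : Empty → Empty)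
    (fun _ => (0 : Fin 1)) (Empty.elim : Empty → Fin 1) (funext fun i => i.elim)
    (fun _ r => r.elim) (𝟭 _) D.Δr adj D.adjΔr
  have e₁ := (@asIso _ _ _ _ _ h).app (H.functor.unitAt Empty)
  obtain ⟨e₂⟩ := H.functor.map_unitAt (J := Unit) (fun _ => (Empty.elim : Empty → Fin 2))
  obtain ⟨e₃⟩ := H.functor.map_unitAt (J := Unit) (fun _ => (Empty.elim : Empty → Fin 1))
  obtain ⟨e₄⟩ := H.functor.map_unitAt (J := Fin 2) (fun (i : Fin 2) (_ : Fin 1) => i)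
  have h5 := H.functor.map₂_obj_eta (fun (i : Fin 2) (_ : Fin 1) => i)
    (fun _ => H.functor.unitAt (Fin 1))
  exact ⟨D.Δr.mapIso e₃.symm ≪≫ e₁.symm ≪≫ e₂ ≪≫ e₄.symm ≪≫ eqToIso h5.symm⟩

/-- The map from the empty set to a point is injective, so its square with identities is Cartesian,
and Beck–Chevalley gives E ≅ R (u E) for the unit E over the empty set. Hence End(𝟏) has the
dimension of End(E). The latter is one, since the empty set is an empty disjoint union and Hom is an
empty tensor product. -/
theorem finrank_unitObj : Module.finrank k (H.unitObj ⟶ H.unitObj) = 1 := by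
  let adj : H.functor.map₁ (id : Empty → Empty) ⊣ 𝟭 _ :=
    Adjunction.id.ofNatIsoLeft (H.functor.mapOneId Empty).symm
  let u := H.functor.map₁ (Empty.elim : Empty → Fin 1)
  obtain ⟨R, ⟨adjR⟩⟩ := (H.isTwoVectMor_map₁ (Empty.elim : Empty → Fin 1)).isLeftAdjoint
  have h := H.beckChevalley (id : Empty → Empty) (id : Empty → Empty)
    (Empty.elim : Empty → Fin 1) (Empty.elim : Empty → Fin 1) rfl
    (fun _ r => r.elim) (𝟭 _) R adj adjR
  let E := H.functor.unitAt Empty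
  have e₁ := (@asIso _ _ _ _ _ h).app E
  let e₂ : E ≅ R.obj (u.obj E) := ((H.functor.mapOneId Empty).app E).symm ≪≫ e₁
  obtain ⟨e₃⟩ := H.functor.map_unitAt (J := Unit) (fun _ => (Empty.elim : Empty → Fin 1))
  have h1 : Module.finrank k (E ⟶ E) = 1 := by
    have hB := H.isDeligneTensor (I := Empty) (S := fun _ => Empty) (T := Empty)
      (fun i => i.elim) ⟨fun i => i.1.elim, fun i => i.elim⟩
    exact (hB.finrank_hom (fun i => i.elim) (fun i => i.elim)).trans (by simp)
  have h2 := Adjunction.finrank_hom k adjR E (u.obj E)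
  exact (GrTwoVect.finrank_congr e₃.symm e₃.symm).trans
    (h2.trans ((GrTwoVect.finrank_congr (Iso.refl E) e₂.symm).trans h1))

end SSHCategory

/-! ### The Grothendieck group of a Deligne tensor product -/

namespace K₀

/-- Closure under subtraction covers zero, negatives and sums at once, so each use has one additive
step besides the classes of objects. -/
theorem induction_on {C : Type*} [Category* C] [Preadditive C] [HasZeroObject C]
    {p : K₀ C → Prop} (x : K₀ C) (mk : ∀ X, p (K₀.mk X)) (sub : ∀ x y, p x → p y → p (x - y)) :
    p x := by
  have zero : p 0 := by
    obtain ⟨Z, hZ⟩ := HasZeroObject.zero (C := C)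
    rw [← mk_zero hZ]
    exact mk Z
  have neg : ∀ x, p x → p (-x) := fun x hx => by
    rw [← zero_sub]
    exact sub _ _ zero hx
  have add : ∀ x y, p x → p y → p (x + y) := fun x y hx hy => by
    rw [← sub_neg_eq_add]
    exact sub _ _ hx (neg _ hy)
  induction x using QuotientAddGroup.induction_on with
  | H x =>
    induction x using FreeAbelianGroup.induction_on with
    | zero => exact zero
    | of X => exact mk X
    | neg X _ => exact neg _ (mk X)
    | add x y hx hy => exact add _ _ hx hy

theorem tensor_hom_ext {C C' : Type*} [Category* C] [Preadditive C] [HasZeroObject C]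
    [Category* C'] [Preadditive C'] [HasZeroObject C'] {A : Type*} [AddCommGroup A]
    {f g : K₀ C ⊗[ℤ] K₀ C' →+ A} (h : ∀ X Y, f (mk X ⊗ₜ mk Y) = g (mk X ⊗ₜ mk Y)) : f = g := by
  ext w
  induction w with
  | zero => rw [map_zero, map_zero]
  | add w w' h h' => rw [map_add, map_add, h, h']
  | tmul x y =>
    induction x using K₀.induction_on with
    | sub x x' hx hx' => rw [TensorProduct.sub_tmul, map_sub, map_sub, hx, hx']
    | mk X =>
      induction y using K₀.induction_on with
      | sub y y' hy hy' => rw [TensorProduct.tmul_sub, map_sub, map_sub, hy, hy']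
      | mk Y => exact h X Y

end K₀

theorem IsBilinearFunctor.additive_flip {k : Type v} [Field k] {C C' D : GrTwoVect.{u, v} k}
    {N : C × C' ⥤ D} (hN : IsBilinearFunctor N) (Y : C') :
    ((Functor.curry.obj N).flip.obj Y).Additive :=
  ⟨fun {_ _ f g} => hN.add_left f g (𝟙 Y)⟩

/-- The biadditive map on Grothendieck groups induced by a functor of two variables. -/
def IsBilinearFunctor.mapK {k : Type v} [Field k] {C C' D : GrTwoVect.{u, v} k}
    {N : C × C' ⥤ D} (hN : IsBilinearFunctor N) : K₀ C →+ K₀ C' →+ K₀ D :=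
  K₀.lift (fun X => have := hN.additive_curry X; K₀.map ((Functor.curry.obj N).obj X))
    (fun Y Z b hb => K₀.hom_ext fun W => by
      have := hN.additive_flip W
      have := hN.additive_curry
      rw [AddMonoidHom.add_apply, K₀.map_mk, K₀.map_mk, K₀.map_mk]
      exact K₀.mk_bicone (((Functor.curry.obj N).flip.obj W).mapBinaryBicone b)
        (K₀.mapBiconeIsBilimit _ b hb))

theorem IsBilinearFunctor.mapK_mk {k : Type v} [Field k] {C C' D : GrTwoVect.{u, v} k}
    {N : C × C' ⥤ D} (hN : IsBilinearFunctor N) (X : C) (Y : C') :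
    hN.mapK (K₀.mk X) (K₀.mk Y) = K₀.mk (N.obj (X, Y)) := by
  have := hN.additive_curry
  exact (DFunLike.congr_fun (K₀.lift_mk _ _ X) (K₀.mk Y)).trans (K₀.map_mk _ Y)

/-- Bases of simple classes are matched. Comparing objects only through multiplicities lets one
statement cover both 𝒞 ⊗ 𝒞 and 𝒞 ⊗ 𝒞ᵒᵖ, where the second variable lives in the opposite category. -/
theorem IsDeligneTensor.exists_addEquiv {k : Type v} [Field k] {C : Fin 2 → GrTwoVect.{u, v} k}
    {T : GrTwoVect.{u, v} k} {B : (∀ i, C i) ⥤ T} (hB : IsDeligneTensor B) {J : Type}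
    {S : ∀ i, J → C i} (hS : ∀ i, SemisimpleFamily k (S i)) {A : GrTwoVect.{u, v} k} {R : J → A}
    (hR : SemisimpleFamily k R) :
    ∃ e : K₀ T ≃+ K₀ A ⊗[ℤ] K₀ A, ∀ (Z : ∀ i, C i) (F G : A),
      (∀ j, Module.finrank k (S 0 j ⟶ Z 0) = Module.finrank k (R j ⟶ F)) →
      (∀ j, Module.finrank k (S 1 j ⟶ Z 1) = Module.finrank k (R j ⟶ G)) →
      e (K₀.mk (B.obj Z)) = K₀.mk F ⊗ₜ K₀.mk G := by
  let b := (hB.semisimpleFamily hS).basis.reindex (finTwoArrowEquiv J)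
  let b' := hR.basis.tensorProduct hR.basis
  refine ⟨(b.repr.trans b'.repr.symm).toAddEquiv, fun Z F G hF hG => ?_⟩
  apply b'.repr.injective
  refine (b'.repr.apply_symm_apply (b.repr (K₀.mk (B.obj Z)))).trans ?_
  ext ⟨j, j'⟩
  rw [Module.Basis.repr_reindex_apply, SemisimpleFamily.basis_repr, homForm_mk,
    hB.finrank_hom, Fin.prod_univ_two, Module.Basis.tensorProduct_repr_tmul_apply,
    SemisimpleFamily.basis_repr, SemisimpleFamily.basis_repr, homForm_mk, homForm_mk, smul_eq_mul,
    ← hF, ← hG, mul_comm, Nat.cast_mul]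
  rfl

namespace SSHCategory

variable {k : Type v} [Field k] (H : SSHCategory.{u, v} k)

theorem finrank_box (F G F' G' : H.C₁) :
    Module.finrank k (H.box.obj (F, G) ⟶ H.box.obj (F', G')) =
      Module.finrank k (F ⟶ F') * Module.finrank k (G ⟶ G') :=
  (H.isDeligneTensor_box.finrank_hom ((pairFunctor H.C₁.carrier).obj (F, G))
    ((pairFunctor H.C₁.carrier).obj (F', G'))).trans (Fin.prod_univ_two _)

theorem finrank_concat (P Q P' Q' : H.C₂) :
    Module.finrank k (H.concat.obj (P, Q) ⟶ H.concat.obj (P', Q')) =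
      Module.finrank k (P ⟶ P') * Module.finrank k (Q ⟶ Q') :=
  (H.isDeligneTensor_concat.finrank_hom ((pairFunctor H.C₂.carrier).obj (P, Q))
    ((pairFunctor H.C₂.carrier).obj (P', Q'))).trans (Fin.prod_univ_two _)

theorem exists_boxEquiv : ∃ κ : K₀ H.C₁ ⊗[ℤ] K₀ H.C₁ ≃+ K₀ H.C₂,
    ∀ F G : H.C₁, κ (K₀.mk F ⊗ₜ K₀.mk G) = K₀.mk (H.box.obj (F, G)) := by
  obtain ⟨e, he⟩ := H.isDeligneTensor_box.exists_addEquiv (fun _ => H.C₁.semisimpleFamily)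
    H.C₁.semisimpleFamily
  refine ⟨e.symm, fun F G => ?_⟩
  rw [AddEquiv.symm_apply_eq]
  exact (he ((pairFunctor H.C₁.carrier).obj (F, G)) F G (fun _ => rfl) (fun _ => rfl)).symm

/-- The isomorphism `K(𝒞) ⊗ K(𝒞) ≃ K(𝒞^{⊗ 2})`. -/
def boxEquiv : K₀ H.C₁ ⊗[ℤ] K₀ H.C₁ ≃+ K₀ H.C₂ := H.exists_boxEquiv.choose

theorem boxEquiv_mk (F G : H.C₁) :
    H.boxEquiv (K₀.mk F ⊗ₜ K₀.mk G) = K₀.mk (H.box.obj (F, G)) := H.exists_boxEquiv.choose_spec F G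

/-- The multiplication on `K(𝒞)`. -/
def mulK : K₀ H.C₁ ⊗[ℤ] K₀ H.C₁ →ₗ[ℤ] K₀ H.C₁ where
  toFun w := K₀.map H.m (H.boxEquiv w)
  map_add' _ _ := by rw [map_add, map_add]
  map_smul' c w := ((congrArg _ (map_zsmul H.boxEquiv c w)).trans (map_zsmul _ c _))

theorem mulK_apply (w : K₀ H.C₁ ⊗[ℤ] K₀ H.C₁) : H.mulK w = K₀.map H.m (H.boxEquiv w) := rfl

theorem mulK_mk (F G : H.C₁) : H.mulK (K₀.mk F ⊗ₜ K₀.mk G) = K₀.mk (H.tensor.obj (F, G)) := by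
  rw [mulK_apply, boxEquiv_mk, K₀.map_mk]
  exact K₀.mk_iso (H.boxMulIso.app (F, G))

theorem mulK_assoc (x y z : K₀ H.C₁) :
    H.mulK (H.mulK (x ⊗ₜ y) ⊗ₜ z) = H.mulK (x ⊗ₜ H.mulK (y ⊗ₜ z)) := by
  induction x using K₀.induction_on with
  | sub x x' hx hx' => simp only [TensorProduct.sub_tmul, map_sub, hx, hx']
  | mk F =>
    induction y using K₀.induction_on with
    | sub y y' hy hy' => simp only [TensorProduct.sub_tmul, TensorProduct.tmul_sub, map_sub, hy, hy']
    | mk G =>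
      induction z using K₀.induction_on with
      | sub z z' hz hz' => simp only [TensorProduct.tmul_sub, map_sub, hz, hz']
      | mk X =>
        simp only [mulK_mk]
        exact K₀.mk_iso (H.functor.tensorLeft F G X ≪≫ (H.functor.tensorRight F G X).symm)

theorem unit_mulK (x : K₀ H.C₁) : H.mulK (K₀.mk H.unitObj ⊗ₜ x) = x := by
  induction x using K₀.induction_on with
  | sub x x' hx hx' => simp only [TensorProduct.tmul_sub, map_sub, hx, hx']
  | mk X =>
    obtain ⟨e⟩ := H.functor.tensor_unitAt_left X
    exact (H.mulK_mk _ _).trans (K₀.mk_iso e)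

theorem mulK_unit (x : K₀ H.C₁) : H.mulK (x ⊗ₜ K₀.mk H.unitObj) = x := by
  induction x using K₀.induction_on with
  | sub x x' hx hx' => simp only [TensorProduct.sub_tmul, map_sub, hx, hx']
  | mk X =>
    obtain ⟨e⟩ := H.functor.tensor_unitAt_right X
    exact (H.mulK_mk _ _).trans (K₀.mk_iso e)

theorem homForm_boxEquiv (F G : H.C₁) (w : K₀ H.C₁ ⊗[ℤ] K₀ H.C₁) :
    homForm k (K₀.mk (H.box.obj (F, G))) (H.boxEquiv w) = LinearMap.mul' ℤ ℤ
      (TensorProduct.map (homForm k (K₀.mk F)) (homForm k (K₀.mk G)) w) := by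
  have h : ((homForm k (K₀.mk (H.box.obj (F, G)))).toAddMonoidHom.comp
      H.boxEquiv.toAddMonoidHom) = (LinearMap.mul' ℤ ℤ ∘ₗ
      TensorProduct.map (homForm k (K₀.mk F)) (homForm k (K₀.mk G))).toAddMonoidHom := by
    refine K₀.tensor_hom_ext fun X Y => ?_
    refine (congrArg (homForm k (K₀.mk (H.box.obj (F, G)))) (H.boxEquiv_mk X Y)).trans ?_
    refine Eq.trans ?_ (congrArg₂ (· * ·) (homForm_mk k F X) (homForm_mk k G Y)).symm
    rw [homForm_mk, finrank_box, Nat.cast_mul]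
  exact DFunLike.congr_fun h w

/-- By biadditivity it is enough to look at classes F ⊠ G, where the interchange isomorphism
applies. It identifies the product of 𝒞^{⊗ 2} with the product used in the Hopf axiom. -/
theorem boxEquiv_tensorMul (u v : K₀ H.C₁ ⊗[ℤ] K₀ H.C₁) :
    H.boxEquiv (tensorMul H.mulK u v) =
      (H.isBilinear_map₂ fun _ : Fin 2 => (id : Fin 2 → Fin 2)).mapK (H.boxEquiv u)
        (H.boxEquiv v) := by
  let N := (H.isBilinear_map₂ fun _ : Fin 2 => (id : Fin 2 → Fin 2)).mapK
  let f₁ (v) : K₀ H.C₁ ⊗[ℤ] K₀ H.C₁ →+ K₀ H.C₂ :=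
    AddMonoidHom.mk' (fun u => H.boxEquiv (tensorMul H.mulK u v))
      (fun u u' => by rw [add_tensorMul, map_add])
  let f₂ (u) : K₀ H.C₁ ⊗[ℤ] K₀ H.C₁ →+ K₀ H.C₂ :=
    AddMonoidHom.mk' (fun v => H.boxEquiv (tensorMul H.mulK u v))
      (fun u u' => by rw [tensorMul_add, map_add])
  let g₁ (v) : K₀ H.C₁ ⊗[ℤ] K₀ H.C₁ →+ K₀ H.C₂ :=
    AddMonoidHom.mk' (fun u => N (H.boxEquiv u) (H.boxEquiv v))
      (fun u u' => by rw [map_add, map_add, AddMonoidHom.add_apply])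
  let g₂ (u) : K₀ H.C₁ ⊗[ℤ] K₀ H.C₁ →+ K₀ H.C₂ :=
    AddMonoidHom.mk' (fun v => N (H.boxEquiv u) (H.boxEquiv v))
      (fun u u' => by rw [map_add, map_add])
  have h : f₁ v = g₁ v := K₀.tensor_hom_ext fun X Y => by
    have h' : f₂ (K₀.mk X ⊗ₜ K₀.mk Y) = g₂ (K₀.mk X ⊗ₜ K₀.mk Y) :=
      K₀.tensor_hom_ext fun X' Y' => by
        change H.boxEquiv (tensorMul H.mulK (K₀.mk X ⊗ₜ K₀.mk Y) (K₀.mk X' ⊗ₜ K₀.mk Y')) =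
          N (H.boxEquiv (K₀.mk X ⊗ₜ K₀.mk Y)) (H.boxEquiv (K₀.mk X' ⊗ₜ K₀.mk Y'))
        rw [tensorMul_tmul, mulK_mk, mulK_mk, boxEquiv_mk, boxEquiv_mk, boxEquiv_mk]
        obtain ⟨e⟩ := H.nonempty_interchange X Y X' Y'
        exact (K₀.mk_iso e).symm.trans (IsBilinearFunctor.mapK_mk _ _ _).symm
    exact DFunLike.congr_fun h' v
  exact DFunLike.congr_fun h u

theorem deg_unitObj : H.C₁.deg 0 H.unitObj := by
  have h := H.isDegreeZero (I := Empty) (S := fun _ => Empty) (T := Fin 1) (fun i => i.elim)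
    (fun i => i.elim) (fun i => i.elim) (fun i => i.elim)
  rw [finsum_of_isEmpty] at h
  exact h

end SSHCategory

/-! ### The PSH algebra of an SSH category -/

namespace SSHCategory

variable {k : Type v} [Field k] {H : SSHCategory.{u, v} k}

namespace Adjoints

variable (D : H.Adjoints)

theorem additive_Δr : D.Δr.Additive := (H.isTwoVectMor_m.of_rightAdjoint D.adjΔr).additive

theorem finrank_Δr (X : H.C₂) (Y : H.C₁) :
    Module.finrank k (X ⟶ D.Δr.obj Y) = Module.finrank k (H.m.obj X ⟶ Y) :=
  (Adjunction.finrank_hom k D.adjΔr X Y).symm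

/-- The comultiplication on `K(𝒞)`. -/
def comulK : K₀ H.C₁ →ₗ[ℤ] K₀ H.C₁ ⊗[ℤ] K₀ H.C₁ where
  toFun x := H.boxEquiv.symm (have := D.additive_Δr; K₀.map D.Δr x)
  map_add' _ _ := by rw [map_add, map_add]
  map_smul' c x := (congrArg _ (map_zsmul _ c x)).trans (map_zsmul _ c _)

theorem boxEquiv_comulK (X : H.C₁) : H.boxEquiv (D.comulK (K₀.mk X)) = K₀.mk (D.Δr.obj X) := by
  have := D.additive_Δr
  exact (H.boxEquiv.apply_symm_apply _).trans (K₀.map_mk D.Δr X)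

/-- Pairing with X gives dim Hom(F, m X) for Δˡ and dim Hom(m X, F) for Δʳ, which agree by symmetry
of the Hom form. -/
theorem mk_Δl (F : H.C₁) : (K₀.mk (D.Δl.obj F) : K₀ H.C₂) = K₀.mk (D.Δr.obj F) := by
  refine H.C₂.semisimpleFamily.ext_right fun X => ?_
  rw [H.C₂.semisimpleFamily.homForm_comm, homForm_mk, homForm_mk, finrank_Δr,
    Adjunction.finrank_hom' k D.adjΔl, H.C₁.semisimpleFamily.finrank_comm]

theorem mk_Δr_eq (D' : H.Adjoints) (F : H.C₁) :
    (K₀.mk (D.Δr.obj F) : K₀ H.C₂) = K₀.mk (D'.Δr.obj F) :=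
  K₀.mk_iso ((D.adjΔr.rightAdjointUniq D'.adjΔr).app F)

/-- Equality of classes is tested on simple objects of 𝒞^{⊗ 4} of the form P ⊠ Q. There m² (P ⊠ Q) ≅
m P ⊠ m Q, and both sides have dimension dim Hom(m P, F) · dim Hom(m Q, G). -/
theorem mk_ΔrSq_box (F G : H.C₁) : (K₀.mk (D.ΔrSq.obj (H.box.obj (F, G))) : K₀ H.C₄) =
    K₀.mk (H.concat.obj (D.Δr.obj F, D.Δr.obj G)) := by
  let hS := H.isDeligneTensor_concat.semisimpleFamily (fun _ => H.C₂.semisimpleFamily)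
  apply hS.basis.ext_elem
  intro j
  rw [hS.basis_repr, hS.basis_repr, homForm_mk, homForm_mk, Nat.cast_inj,
    ← Adjunction.finrank_hom k D.adjΔrSq]
  rw [← H.functor.map₂_obj_eta]
  refine (GrTwoVect.finrank_congr (H.concatSqIso.app (_, _)) (Iso.refl _)).trans ?_
  refine (H.finrank_box _ _ _ _).trans (Eq.trans ?_ (H.finrank_concat _ _ _ _).symm)
  rw [finrank_Δr, finrank_Δr]

/-- For classes of objects, Δʳ (m (F ⊠ G)) ≅ mBar ((Δʳ)² (F ⊠ G)) by Beck–Chevalley; the right side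
has the class of mBar applied to the external product of Δʳ F and Δʳ G, which is their product in
𝒞^{⊗ 2}. -/
theorem comulK_mulK (x y : K₀ H.C₁) :
    D.comulK (H.mulK (x ⊗ₜ y)) = tensorMul H.mulK (D.comulK x) (D.comulK y) := by
  have hneg : ∀ u v, tensorMul H.mulK (-u) v = -tensorMul H.mulK u v := fun u v => by
    rw [eq_neg_iff_add_eq_zero, ← add_tensorMul, neg_add_cancel, zero_tensorMul]
  have hneg' : ∀ u v, tensorMul H.mulK u (-v) = -tensorMul H.mulK u v := fun u v => by
    rw [eq_neg_iff_add_eq_zero, ← tensorMul_add, neg_add_cancel, tensorMul_zero]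
  induction x using K₀.induction_on with
  | sub x x' hx hx' =>
    rw [TensorProduct.sub_tmul, map_sub, map_sub, map_sub, hx, hx', sub_eq_add_neg,
      sub_eq_add_neg, add_tensorMul, hneg]
  | mk F =>
    induction y using K₀.induction_on with
    | sub y y' hy hy' =>
      rw [TensorProduct.tmul_sub, map_sub, map_sub, map_sub, hy, hy', sub_eq_add_neg,
        sub_eq_add_neg, tensorMul_add, hneg']
    | mk G =>
      apply H.boxEquiv.injective
      rw [boxEquiv_tensorMul, boxEquiv_comulK, boxEquiv_comulK, mulK_apply, boxEquiv_mk,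
        K₀.map_mk, boxEquiv_comulK]
      obtain ⟨e⟩ := H.nonempty_hopf D (H.box.obj (F, G))
      have h := congrArg (K₀.map H.mBar) (D.mk_ΔrSq_box F G)
      rw [K₀.map_mk, K₀.map_mk] at h
      refine (K₀.mk_iso e).symm.trans (h.trans ?_)
      exact (K₀.mk_iso (H.concatBarIso.app (_, _))).trans (IsBilinearFunctor.mapK_mk _ _ _).symm

theorem comulK_unit : D.comulK (K₀.mk H.unitObj) = K₀.mk H.unitObj ⊗ₜ K₀.mk H.unitObj := by
  apply H.boxEquiv.injective
  obtain ⟨e⟩ := H.nonempty_comul_unit D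
  rw [boxEquiv_comulK, boxEquiv_mk, K₀.mk_iso e]

/-- Trilinearity reduces the claim to objects, where it is the adjunction m ⊣ Δʳ combined with
multiplicativity of the Hom form on ⊠. -/
theorem homForm_mulK (x y z : K₀ H.C₁) : homForm k (H.mulK (x ⊗ₜ y)) z =
    LinearMap.mul' ℤ ℤ (TensorProduct.map (homForm k x) (homForm k y) (D.comulK z)) := by
  have hsub : ∀ (f f' g : K₀ H.C₁ →ₗ[ℤ] ℤ) (w : K₀ H.C₁ ⊗[ℤ] K₀ H.C₁),
      LinearMap.mul' ℤ ℤ (TensorProduct.map (f - f') g w) =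
        LinearMap.mul' ℤ ℤ (TensorProduct.map f g w) -
          LinearMap.mul' ℤ ℤ (TensorProduct.map f' g w) := by
    intro f f' g w
    induction w with
    | zero => simp
    | add w w' h h' => rw [map_add, map_add, map_add, map_add, map_add, map_add, h, h']; abel
    | tmul a b => exact sub_mul (f a) (f' a) (g b)
  have hsub' : ∀ (f g g' : K₀ H.C₁ →ₗ[ℤ] ℤ) (w : K₀ H.C₁ ⊗[ℤ] K₀ H.C₁),
      LinearMap.mul' ℤ ℤ (TensorProduct.map f (g - g') w) =
        LinearMap.mul' ℤ ℤ (TensorProduct.map f g w) -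
          LinearMap.mul' ℤ ℤ (TensorProduct.map f g' w) := by
    intro f g g' w
    induction w with
    | zero => simp
    | add w w' h h' => rw [map_add, map_add, map_add, map_add, map_add, map_add, h, h']; abel
    | tmul a b => exact mul_sub (f a) (g b) (g' b)
  induction x using K₀.induction_on with
  | sub x x' hx hx' =>
    rw [TensorProduct.sub_tmul, map_sub, map_sub, LinearMap.sub_apply, hx, hx', map_sub, hsub]
  | mk F =>
    induction y using K₀.induction_on with
    | sub y y' hy hy' =>
      rw [TensorProduct.tmul_sub, map_sub, map_sub, LinearMap.sub_apply, hy, hy', map_sub, hsub']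
    | mk G =>
      induction z using K₀.induction_on with
      | sub z z' hz hz' => rw [map_sub, map_sub, map_sub, map_sub, hz, hz']
      | mk X =>
        rw [← homForm_boxEquiv, boxEquiv_comulK, homForm_mk, finrank_Δr, mulK_apply, boxEquiv_mk,
          K₀.map_mk, homForm_mk]

/-- The self-adjoint bialgebra structure on `K(𝒞)`. -/
def bialgebra : SelfAdjointBialgebra (K₀ H.C₁) where
  mul := H.mulK
  one := K₀.mk H.unitObj
  comul := D.comulK
  inner := homForm k
  ι := H.C₁.Irr
  basis := H.C₁.semisimpleFamily.basis
  deg := H.C₁.irrDeg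
  finite_deg := H.C₁.finite_irrDeg
  inner_basis_self b := by
    rw [SemisimpleFamily.basis_apply, H.C₁.semisimpleFamily.homForm_self]
  inner_basis_of_ne b c h := by
    rw [SemisimpleFamily.basis_apply, SemisimpleFamily.basis_apply,
      H.C₁.semisimpleFamily.homForm_ne h]
  mul_assoc := H.mulK_assoc
  one_mul := H.unit_mulK
  mul_one := H.mulK_unit
  comul_mul := D.comulK_mulK
  comul_one := D.comulK_unit
  inner_one_one := by rw [homForm_mk, finrank_unitObj, Nat.cast_one]
  deg_mul a b c h := by
    rw [SemisimpleFamily.basis_repr, SemisimpleFamily.basis_apply, SemisimpleFamily.basis_apply,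
      mulK_mk, homForm_mk] at h
    by_contra hc
    have h1 := H.C₁.hom_eq_zero (H.C₁.deg_simpleObj c)
      (H.tensor_deg (H.C₁.deg_simpleObj a) (H.C₁.deg_simpleObj b)) hc
    have : Subsingleton (H.C₁.simpleObj c ⟶
      H.tensor.obj (H.C₁.simpleObj a, H.C₁.simpleObj b)) := ⟨fun f g => (h1 f).trans (h1 g).symm⟩
    exact h (by rw [Module.finrank_zero_of_subsingleton, Nat.cast_zero])
  deg_one b h := by
    rw [SemisimpleFamily.basis_repr, homForm_mk] at h
    by_contra hc
    have h1 := H.C₁.hom_eq_zero (H.C₁.deg_simpleObj b) H.deg_unitObj hc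
    have : Subsingleton (H.C₁.simpleObj b ⟶ H.unitObj) := ⟨fun f g => (h1 f).trans (h1 g).symm⟩
    exact h (by rw [Module.finrank_zero_of_subsingleton, Nat.cast_zero])
  inner_mul := D.homForm_mulK
  mul_nonneg a b c := by
    rw [SemisimpleFamily.basis_repr, SemisimpleFamily.basis_apply, SemisimpleFamily.basis_apply,
      mulK_mk, homForm_mk]
    exact Nat.cast_nonneg _
  one_nonneg b := by
    rw [SemisimpleFamily.basis_repr, homForm_mk]
    exact Nat.cast_nonneg _

/-- Both sides represent the functional adjoint to multiplication by [G]. The adjoints `D'` may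
differ from those defining the bialgebra, since only dimensions are compared. -/
theorem bialgebra_comulOp (D' : H.Adjoints) (G X : H.C₁) :
    D.bialgebra.comulOp (K₀.mk G) (K₀.mk X) = K₀.mk ((D'.Δ G).obj X) := by
  have := (H.isTwoVectMor_mul G).additive
  have := (H.isTwoVectMor_mul G).linear
  refine H.C₁.semisimpleFamily.ext_right fun Y => ?_
  refine (D.bialgebra.inner_comulOp (K₀.mk G) (K₀.mk Y) (K₀.mk X)).trans ?_
  refine (congrArg (fun t => homForm k t (K₀.mk X)) ((H.mulK_mk G Y).trans
    (K₀.mk_iso (H.boxMulIso.app (G, Y))).symm)).trans ?_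
  rw [homForm_mk, homForm_mk, Nat.cast_inj]
  exact Adjunction.finrank_hom k (D'.adj G) Y X

theorem bialgebra_fock (D' : H.Adjoints) (F G X : H.C₁) :
    D.bialgebra.toPSH.fock (K₀.mk F ⊗ₜ K₀.mk G) (K₀.mk X) =
      K₀.mk ((D'.fock.obj (F, Opposite.op G)).obj X) := by
  refine (D.bialgebra.toPSH_fock_tmul _ _ _).trans ?_
  rw [D.bialgebra_comulOp D']
  exact (H.mulK_mk F _).trans (K₀.mk_iso (H.boxMulIso.app (F, (D'.Δ G).obj X))).symm

theorem exists_opEquiv {T : GrTwoVect.{u, v} k}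
    {B : (∀ i : Fin 2, (![H.C₁, H.C₁.op] i).carrier) ⥤ T}
    (hB : IsDeligneTensor (C := ![H.C₁, H.C₁.op]) B) :
    ∃ κ : K₀ T ≃+ K₀ H.C₁ ⊗[ℤ] K₀ H.C₁, ∀ F G : H.C₁,
      κ (K₀.mk (B.obj ((pairOp H.C₁).obj (F, Opposite.op G)))) = K₀.mk F ⊗ₜ K₀.mk G := by
  obtain ⟨e, he⟩ := hB.exists_addEquiv semisimpleFamily_simplePair H.C₁.semisimpleFamily
  refine ⟨e, fun F G => he _ F G (fun _ => rfl) fun j => ?_⟩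
  exact (opLinearEquiv k (H.C₁.simpleObj j) G).finrank_eq.trans
    (H.C₁.semisimpleFamily.finrank_comm _ _)

/-- With X fixed, both sides are additive in t, so it suffices to take t = F ⊠ G with F and G
simple, where Ψ t is m_F Δʳ_G. -/
theorem mk_obj_eq_fock {T : GrTwoVect.{u, v} k}
    {B : (∀ i : Fin 2, (![H.C₁, H.C₁.op] i).carrier) ⥤ T}
    (hB : IsDeligneTensor (C := ![H.C₁, H.C₁.op]) B) (D' : H.Adjoints)
    (Ψ : T ⥤ (EndAd H.C₁).FullSubcategory) [Ψ.Additive]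
    (e : pairOp H.C₁ ⋙ B ⋙ Ψ ⋙ (EndAd H.C₁).ι ≅ D'.fock)
    (κ : K₀ T ≃+ K₀ H.C₁ ⊗[ℤ] K₀ H.C₁)
    (hκ : ∀ F G : H.C₁, κ (K₀.mk (B.obj ((pairOp H.C₁).obj (F, Opposite.op G)))) =
      K₀.mk F ⊗ₜ K₀.mk G) (t : T) (X : H.C₁) :
    K₀.mk ((Ψ.obj t).obj.obj X) = D.bialgebra.toPSH.fock (κ (K₀.mk t)) (K₀.mk X) := by
  let ev : T ⥤ H.C₁ := Ψ ⋙ (EndAd H.C₁).ι ⋙ (evaluation _ _).obj X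
  have : ev.Additive := ⟨fun {_ _ f g} => by
    change (Ψ.map (f + g)).hom.app X = (Ψ.map f).hom.app X + (Ψ.map g).hom.app X
    rw [Ψ.map_add]
    rfl⟩
  have h : K₀.map ev = (AddMonoidHom.mk' (fun x => D.bialgebra.toPSH.fock (κ x) (K₀.mk X))
      (fun x y => by rw [map_add, map_add]; rfl)) := by
    let hS := hB.semisimpleFamily semisimpleFamily_simplePair
    suffices h' : (K₀.map ev).toIntLinearMap = (AddMonoidHom.mk'
        (fun x => D.bialgebra.toPSH.fock (κ x) (K₀.mk X))
        (fun x y => by rw [map_add, map_add]; rfl)).toIntLinearMap from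
      AddMonoidHom.ext fun x => LinearMap.congr_fun h' x
    refine hS.basis.ext fun j => ?_
    have hj : (fun i => simplePair (H := H) i (j i)) = (pairOp H.C₁).obj
        (H.C₁.simpleObj (j 0), Opposite.op (H.C₁.simpleObj (j 1))) := funext fun i => match i with
      | 0 => rfl
      | 1 => rfl
    rw [hS.basis_apply, hj]
    refine (K₀.map_mk ev _).trans ((K₀.mk_iso ((e.app (_, _)).app X)).trans ?_)
    exact (D.bialgebra_fock D' _ _ X).symm.trans
      (congrArg (fun w => D.bialgebra.toPSH.fock w (K₀.mk X)) (hκ _ _).symm)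
  exact (K₀.map_mk ev t).symm.trans (DFunLike.congr_fun h (K₀.mk t))

end Adjoints

end SSHCategory

end

/-! ### The main theorem -/

theorem theorem5p1 {k : Type v} [Field k] [CharZero k] (H : SSHCategory.{u, v} k) :
    -- the adjoints exist, and so does the Deligne tensor product `𝒞 ⊗ 𝒞ᵒᵖ`
    Nonempty H.Adjoints ∧
    (∃ (T : GrTwoVect.{u, v} k) (B : (∀ i : Fin 2, (![H.C₁, H.C₁.op] i).carrier) ⥤ T),
      IsDeligneTensor (C := ![H.C₁, H.C₁.op]) B) ∧
    -- the isomorphisms `m_F m_G ≅ m_{F ⊗ G}`, natural in `F` and `G`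
    (∃ μ : ∀ F G : H.C₁, H.mul.obj G ⋙ H.mul.obj F ≅ H.mul.obj (H.tensor.obj (F, G)),
      (∀ F G X : H.C₁, (μ F G).app X = H.mulMulIso F G X) ∧
      (∀ (F F' G G' : H.C₁) (f : F ⟶ F') (g : G ⟶ G'),
        (H.mul.map g ◫ H.mul.map f) ≫ (μ F' G').hom =
          (μ F G).hom ≫ H.mul.map (H.tensor.map (X := (F, G)) (Y := (F', G')) (f, g))) ∧
      -- the adjoint isomorphisms `Δʳ_G Δʳ_F ≅ Δʳ_{F ⊗ G}`, natural in `F` and `G`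
      ∀ D : H.Adjoints, ∃ δ : ∀ F G : H.C₁, D.Δ F ⋙ D.Δ G ≅ D.Δ (H.tensor.obj (F, G)),
        (∀ F G : H.C₁, δ F G = conjugateIsoEquiv ((D.adj G).comp (D.adj F))
          (D.adj (H.tensor.obj (F, G))) (μ F G).symm) ∧
        (∀ (F F' G G' : H.C₁) (f : F ⟶ F') (g : G ⟶ G'),
          (D.Δfunctor.map f.op ◫ D.Δfunctor.map g.op) ≫ (δ F G).hom =
            (δ F' G').hom ≫
              D.Δfunctor.map (H.tensor.map (X := (F, G)) (Y := (F', G')) (f, g)).op)) ∧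
    -- the Heisenberg relation `m ∘ (Δʳ)²_{Δˡ F} ≅ Δʳ_F ∘ m`
    (∀ (D : H.Adjoints) (F : H.C₁), IsIso (D.heisenbergMate F)) ∧
    -- the PSH algebra structure on the Grothendieck group and its Heisenberg double
    (∃ (P : PSHAlgebra (K₀ H.C₁)) (κ : K₀ H.C₁ ⊗[ℤ] K₀ H.C₁ ≃+ K₀ H.C₂),
      (∀ F G : H.C₁, P.mul (K₀.mk F ⊗ₜ K₀.mk G) = K₀.mk (H.tensor.obj (F, G))) ∧
      P.one = K₀.mk H.unitObj ∧
      (∀ F G : H.C₁, κ (K₀.mk F ⊗ₜ K₀.mk G) = K₀.mk (H.box.obj (F, G))) ∧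
      (∀ (D : H.Adjoints) (F : H.C₁), κ (P.comul (K₀.mk F)) = K₀.mk (D.Δr.obj F) ∧
        κ (P.comul (K₀.mk F)) = K₀.mk (D.Δl.obj F)) ∧
      (∀ F G : H.C₁, P.inner (K₀.mk F) (K₀.mk G) = Module.finrank k (F ⟶ G)) ∧
      (∀ b, ∃ X : H.C₁, Simple X ∧ H.C₁.deg (P.deg b) X ∧ P.basis b = K₀.mk X) ∧
      Function.Injective P.fock ∧
      (∃ R : Subring (Module.End ℤ (K₀ H.C₁)), (R : Set (Module.End ℤ (K₀ H.C₁))) =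
        Set.range P.fock) ∧
      -- the functor `𝒞 ⊗ 𝒞ᵒᵖ ⥤ End_ad(𝒞)`, `F ⊠ G ↦ m_F ∘ Δʳ_G`, and its decategorification
      ∀ (D : H.Adjoints) (T : GrTwoVect.{u, v} k)
        (B : (∀ i : Fin 2, (![H.C₁, H.C₁.op] i).carrier) ⥤ T),
        IsDeligneTensor (C := ![H.C₁, H.C₁.op]) B →
        ∃ (Ψ : T ⥤ (EndAd H.C₁).FullSubcategory) (κ' : K₀ T ≃+ K₀ H.C₁ ⊗[ℤ] K₀ H.C₁),
          Ψ.Additive ∧ Ψ.Linear k ∧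
          Nonempty (pairOp H.C₁ ⋙ B ⋙ Ψ ⋙ (EndAd H.C₁).ι ≅ D.fock) ∧
          (∀ F G : H.C₁, κ' (K₀.mk (B.obj ((pairOp H.C₁).obj (F, Opposite.op G)))) =
            K₀.mk F ⊗ₜ K₀.mk G) ∧
          (∀ (t : T) (X : H.C₁),
            K₀.mk ((Ψ.obj t).obj.obj X) = P.fock (κ' (K₀.mk t)) (K₀.mk X))) := by
  refine ⟨H.nonempty_adjoints, H.exists_isDeligneTensor_op, ⟨H.mulComp, H.mulComp_app, ?_, ?_⟩,
    fun D F => D.isIso_heisenbergMate F, ?_⟩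
  · exact fun F F' G G' f g => H.mulComp_naturality f g
  · exact fun D => ⟨D.ΔComp, fun F G => rfl, fun F F' G G' f g => D.ΔComp_naturality f g⟩
  -- The algebra structure is fixed by one choice of adjoints. Any other choice gives the same
  -- classes, by uniqueness of adjoints.
  · obtain ⟨D₀⟩ := H.nonempty_adjoints
    refine ⟨D₀.bialgebra.toPSH, H.boxEquiv, H.mulK_mk, rfl, H.boxEquiv_mk, fun D F => ?_,
      homForm_mk k, fun b => ⟨H.C₁.simpleObj b, H.C₁.semisimpleFamily.simple b,
        H.C₁.deg_simpleObj b, H.C₁.semisimpleFamily.basis_apply b⟩,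
      D₀.bialgebra.toPSH_fock_injective, D₀.bialgebra.exists_subring_fock, fun D T B hB => ?_⟩
    · have h := (D₀.boxEquiv_comulK F).trans (D₀.mk_Δr_eq D F)
      exact ⟨h, h.trans (D.mk_Δl F).symm⟩
    · obtain ⟨Ψ, hadd, hlin, ⟨e⟩⟩ := D.exists_fockFunctor hB
      obtain ⟨κ, hκ⟩ := SSHCategory.Adjoints.exists_opEquiv hB
      exact ⟨Ψ, κ, hadd, hlin, ⟨e⟩, hκ, D₀.mk_obj_eq_fock hB D Ψ e κ hκ⟩
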